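/- **Variation of Toeplitz determinants with piecewise analytic symbols.** Let $\beta_0,\dots,\beta_m$ ($m\ge 0$) be distinct points of the unit circle in counterclockwise order, let $\gamma_j$ be the closed counterclockwise arc from $\beta_j$ to the next point (cyclically), and let $a$ be the function on the circle that equals $a_j$ on $\gamma_j$, where $a_j$ is analytic in a neighbourhood of $\gamma_j$. Suppose that the $\beta_j$ and the $a_j$ depend on parameters $s$ in an open subset of a finite-dimensional real vector space: the arguments of the $\beta_j$ are $C^1$ in $s$, and the $a_j(z;s)$ are jointly $C^1$ in $(z,s)$ and analytic in $z$. For $n\ge 0$ put $$T_n[a]=\det[\mu_{j-i}]_{i,j=1}^n,\qquad \mu_k=\oint_{|z|=1}z^k a(z)\frac{dz}{2\pi i z},\qquad T_0[a]=1,\qquad w(z)=z^{-n}a(z),\qquad w_j=z^{-n}a_j .$$ All circles are oriented counterclockwise; $\Gamma_+$ and $\Gamma_-$ denote the boundary values from the outside and from the inside of a circle. Consider the Riemann–Hilbert problem (RHP): $\Gamma$ is a $2\times2$ matrix function, analytic off $|z|=1$, with continuous boundary values on the open arcs, $$\Gamma_+=\Gamma_-\begin{pmatrix}1&w\\0&1\end{pmatrix}\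 (|z|=1,\ z\ne\beta_j),\qquad \Gamma(z)=(\mathbf 1+O(z^{-1}))\,z^{n\sigma_3}\ (z\to\infty),\qquad \Gamma(z)=O(\ln|z-\beta_j|)\ (z\to\beta_j).$$ The differential $\Omega_n$ at a parameter value $s$ is defined as follows. Let $\beta_j^0=\beta_j(s)$, let $\varepsilon\in(0,1)$ be such that the closed discs $|z-\beta^0_j|\le\varepsilon$ are disjoint, let $R>1+\varepsilon$, and put $\mathcal C[w](z)=\oint_{|x|=1}\frac{w(x)}{x-z}\frac{dx}{2\pi i}$. Let $\widetilde\Gamma=\Gamma z^{-n\sigma_3}$ for $|z|>R$, $\widetilde\Gamma=\Gamma\begin{pmatrix}1&\mathcal C[w]\\0&1\end{pmatrix}$ for $|z-\beta^0_j|<\varepsilon$, and $\widetilde\Gamma=\Gamma$ elsewhere. Its jump matrices $M$ (with $\widetilde\Gamma_+=\widetilde\Gamma_-M$) are $\begin{pmatrix}1&w\\0&1\end{pmatrix}$ on the part of $|z|=1$ with $|z-\beta_j^0|>\varepsilon$ for all $j$, $\begin{pmatrix}1&-\mathcal C[w]\\0&1\end{pmatrix}$ on $|z-\beta^0_j|=\varepsilon$,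 and $z^{-n\sigma_3}$ on $|z|=R$. With $\Sigma$ this contour, kept fixed under the deformation, and $\partial$ the derivative in a direction of the parameter space, $$\Omega_n(\partial)=-\int_\Sigma\mathrm{Tr}\big(\widetilde\Gamma_-^{-1}\widetilde\Gamma_-'\,\partial M\,M^{-1}\big)\frac{dx}{2\pi i}-\frac12\int_\Sigma \mathrm{Tr}\big(M'M^{-1}\,\partial M\,M^{-1}\big)\frac{dx}{2\pi i}.$$ **Theorem.** At every parameter value the RHP has a solution if and only if $T_n[a]\neq0$. If $\Gamma$ is a solution, then $$\mathbf K_{21}(z,w)=\frac{[\Gamma^{-1}(z)\Gamma(w)]_{21}}{z-w}$$ is (the restriction to $z\ne w$ off the circle of) a polynomial of degree $\le n-1$ in each variable (zero if $n=0$), which also defines $\mathbf K_{21}$ on the diagonal and on the circle; $\ln T_n[a]$ (any local branch) is differentiable in the parameters; for all admissible $\varepsilon,R$ $$\delta\ln T_n[a]=\Omega_n ;$$ and for every direction $\partial$ $$\partial\ln T_n[a]=\oint_{|x|=1}\mathbf K_{21}(x,x)\,x^{-n}\,\partial a(x)\,\frac{dx}{2\pi i}+\sum_j\frac{\Delta_j}{2\pi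 i}\,\mathbf K_{21}(\beta_j,\beta_j)\,\partial\beta_j,\qquad \Delta_j=w_{j-1}(\beta_j)-w_j(\beta_j)$$ (indices cyclic, $\partial a=\partial a_j$ on $\gamma_j$). That is, $\partial\ln T_n=\oint\mathbf K_{21}(x,x)x^{-n}\partial a\,\frac{dx}{2\pi i}$ for deformations of the symbol with fixed $\beta_j$, and $\partial_{\beta_j}\ln T_n=\frac{\Delta_j}{2\pi i}\mathbf K_{21}(\beta_j,\beta_j)$ for the motion of $\beta_j$ along the circle. -/

import Mathlib

open Complex Filter Topology MeasureTheory

noncomputable section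

namespace ToeplitzRHP

/-- Angle of the end point of the arc that starts at the angle `θ j`, the arcs being listed
counterclockwise; the last arc closes up at `θ 0 + 2π`. -/
def nextAngle {m : ℕ} (θ : Fin (m + 1) → ℝ) (j : Fin (m + 1)) : ℝ :=
  if h : j.val + 1 < m + 1 then θ ⟨j.val + 1, h⟩ else θ 0 + 2 * Real.pi

/-- The separating point with angle `t` on the unit circle. -/
def pt (t : ℝ) : ℂ := circleMap 0 1 t

/-- `∮ f(x) dx / (2πi)` over the counterclockwise unit circle, where `f` is the piecewise function
equal to `f j` on the `j`-th arc. -/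
def arcInt {m : ℕ} (θ : Fin (m + 1) → ℝ) (f : Fin (m + 1) → ℂ → ℂ) : ℂ :=
  ∑ j, ∫ t in (θ j)..(nextAngle θ j),
    f j (circleMap 0 1 t) * (circleMap 0 1 t * I) / (2 * Real.pi * I)

/-- The moment `μ_k = ∮ z ^ k a(z) dz / (2πi z)`. -/
def moment {m : ℕ} (θ : Fin (m + 1) → ℝ) (a : Fin (m + 1) → ℂ → ℂ) (k : ℤ) : ℂ :=
  arcInt θ (fun j z => z ^ k * a j z / z)

/-- The Toeplitz determinant `T_n[a] = det [μ_{j-i}]`, with `T_0[a] = 1`. -/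
def toeplitz {m : ℕ} (n : ℕ) (θ : Fin (m + 1) → ℝ) (a : Fin (m + 1) → ℂ → ℂ) : ℂ :=
  (Matrix.of fun i j : Fin n => moment θ a ((j : ℤ) - (i : ℤ))).det

/-- The Cauchy transform `C[w](z) = ∮ w(x) / (x - z) dx / (2πi)`. -/
def cauchy {m : ℕ} (θ : Fin (m + 1) → ℝ) (w : Fin (m + 1) → ℂ → ℂ) (z : ℂ) : ℂ :=
  arcInt θ (fun j x => w j x / (x - z))

/-- The matrix `[[1, u], [0, 1]]`. -/
def upper (u : ℂ) : Matrix (Fin 2) (Fin 2) ℂ := !![1, u; 0, 1]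

/-- The matrix `z ^ (k σ₃)`. -/
def sigmaPow (k : ℤ) (z : ℂ) : Matrix (Fin 2) (Fin 2) ℂ := !![z ^ k, 0; 0, z ^ (-k)]

/-- `Γ` solves the Riemann--Hilbert problem with jump `Γ₊ = Γ₋ [[1, w], [0, 1]]` on the unit circle
(`₊` is the limit from the outside, `₋` the limit from the inside), with
`Γ(z) = (1 + O(1/z)) z ^ (n σ₃)` at infinity and `Γ(z) = O(ln (z - β_j))` at the separating
points. -/
structure IsRHSolution {m : ℕ} (n : ℕ) (θ : Fin (m + 1) → ℝ) (w : Fin (m + 1) → ℂ → ℂ)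
    (Γ : ℂ → Matrix (Fin 2) (Fin 2) ℂ) : Prop where
  holomorphic : ∀ i k, DifferentiableOn ℂ (fun z => Γ z i k) {z | ‖z‖ ≠ 1}
  jump : ∀ j, ∀ t ∈ Set.Ioo (θ j) (nextAngle θ j), ∃ Γp Γm : Matrix (Fin 2) (Fin 2) ℂ,
    Tendsto Γ (𝓝[(Metric.closedBall (0 : ℂ) 1)ᶜ] (pt t)) (𝓝 Γp) ∧
    Tendsto Γ (𝓝[Metric.ball (0 : ℂ) 1] (pt t)) (𝓝 Γm) ∧
    Γp = Γm * upper (w j (pt t))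
  infinity : ∀ i k, (fun z => (Γ z * sigmaPow (-(n : ℤ)) z - 1) i k)
    =O[Bornology.cobounded ℂ] (fun z : ℂ => z⁻¹)
  log_growth : ∀ j, ∀ i k, (fun z => Γ z i k)
    =O[𝓝[{z : ℂ | ‖z‖ ≠ 1}] (pt (θ j))] (fun z : ℂ => Real.log ‖z - pt (θ j)‖)

/-- The entry `K₂₁(z, w) = [Γ(z)⁻¹ Γ(w)]₂₁ / (z - w)`, for `z ≠ w`. -/
def kernel21 (Γ : ℂ → Matrix (Fin 2) (Fin 2) ℂ) (z w : ℂ) : ℂ :=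
  ((Γ z)⁻¹ * Γ w) 1 0 / (z - w)

/-- The polynomial `∑ c_{jk} z ^ j w ^ k`, of degree at most `n - 1` in each variable. -/
def polyKernel {n : ℕ} (c : Matrix (Fin n) (Fin n) ℂ) (z w : ℂ) : ℂ :=
  ∑ j, ∑ k, c j k * z ^ (j : ℕ) * w ^ (k : ℕ)

section Malgrange

variable {E : Type*} [NormedAddCommGroup E] [NormedSpace ℝ E]

/-- A piece of the contour of a Riemann--Hilbert problem: the part of the counterclockwise circle
with given centre and radius that belongs to a set of angles, with a parameter dependent jump
matrix `M(z; s)`. The outside of the circle is the `₊` side, the inside the `₋` side. -/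
structure JumpArc (E : Type*) where
  center : ℂ
  radius : ℝ
  angles : Set ℝ
  jump : E → ℂ → Matrix (Fin 2) (Fin 2) ℂ

/-- The entrywise boundary value of `F` at `x` from the inside of a circle. -/
def innerLim (c : ℂ) (r : ℝ) (F : ℂ → Matrix (Fin 2) (Fin 2) ℂ) (x : ℂ) :
    Matrix (Fin 2) (Fin 2) ℂ :=
  Matrix.of fun i k => limUnder (𝓝[Metric.ball c r] x) (fun z => F z i k)

/-- Entrywise derivative in `z`. -/
def derivZ (F : ℂ → Matrix (Fin 2) (Fin 2) ℂ) (z : ℂ) : Matrix (Fin 2) (Fin 2) ℂ :=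
  Matrix.of fun i k => deriv (fun y => F y i k) z

/-- Entrywise derivative in the parameter, at `s` in the direction `v`. -/
def derivPar (M : E → ℂ → Matrix (Fin 2) (Fin 2) ℂ) (s v : E) (z : ℂ) :
    Matrix (Fin 2) (Fin 2) ℂ :=
  Matrix.of fun i k => fderiv ℝ (fun s' => M s' z i k) s v

/-- `∫ f(x) dx / (2πi)` along a piece of the contour. -/
def JumpArc.integral (A : JumpArc E) (f : ℂ → ℂ) : ℂ :=
  ∫ t in A.angles, f (circleMap A.center A.radius t) *
    (circleMap 0 A.radius t * I) / (2 * Real.pi * I)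

/-- The Malgrange form `ω_M(∂) = - ∫ Tr (Γ₋⁻¹ Γ₋' ∂M M⁻¹) dx / (2πi)`. -/
def malgrange {ι : Type*} [Fintype ι] (A : ι → JumpArc E)
    (Γ : ℂ → Matrix (Fin 2) (Fin 2) ℂ) (s v : E) : ℂ :=
  - ∑ i, (A i).integral fun x => Matrix.trace
    ((innerLim (A i).center (A i).radius Γ x)⁻¹ *
      innerLim (A i).center (A i).radius (derivZ Γ) x *
      (derivPar (A i).jump s v x * ((A i).jump s x)⁻¹))

/-- The correction `ϑ(∂) = - 1/2 ∫ Tr (M' M⁻¹ ∂M M⁻¹) dx / (2πi)`. -/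
def varthetaForm {ι : Type*} [Fintype ι] (A : ι → JumpArc E) (s v : E) : ℂ :=
  - (1 / 2) * ∑ i, (A i).integral fun x => Matrix.trace
    (derivZ ((A i).jump s) x * ((A i).jump s x)⁻¹ *
      (derivPar (A i).jump s v x * ((A i).jump s x)⁻¹))

/-- The modified Malgrange form `Ω = ω_M + ϑ`. -/
def modifiedMalgrange {ι : Type*} [Fintype ι] (A : ι → JumpArc E)
    (Γ : ℂ → Matrix (Fin 2) (Fin 2) ℂ) (s v : E) : ℂ :=
  malgrange A Γ s v + varthetaForm A s v

/-- `L` is the differential of `ln T` at `s`: some local branch of the logarithm of `T` near `s`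
has differential `L` at `s` (in particular `T s ≠ 0`). -/
def IsLogDifferential (T : E → ℂ) (s : E) (L : E →L[ℝ] ℂ) : Prop :=
  ∃ l : E → ℂ, (∀ᶠ s' in 𝓝 s, Complex.exp (l s') = T s') ∧ HasFDerivAt l L s

end Malgrange

/-- A deformation, with parameters in an open subset `U` of a real normed space, of a piecewise
analytic symbol on the unit circle together with its separating points. The points have angles
`θ 0 < ... < θ m < θ 0 + 2π`, and `a j` is analytic near the closed arc that starts at `θ j`. -/
structure SymbolFamily (E : Type*) [NormedAddCommGroup E] [NormedSpace ℝ E] (m : ℕ) where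
  U : Set E
  isOpen_U : IsOpen U
  θ : E → Fin (m + 1) → ℝ
  θ_contDiff : ∀ j, ContDiffOn ℝ 1 (fun s => θ s j) U
  θ_strictMono : ∀ s ∈ U, StrictMono (θ s)
  θ_lt : ∀ s ∈ U, θ s (Fin.last m) < θ s 0 + 2 * Real.pi
  a : E → Fin (m + 1) → ℂ → ℂ
  D : Fin (m + 1) → Set (E × ℂ)
  isOpen_D : ∀ j, IsOpen (D j)
  arc_subset : ∀ j, ∀ s ∈ U, ∀ t ∈ Set.Icc (θ s j) (nextAngle (θ s) j), (s, pt t) ∈ D j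
  a_contDiff : ∀ j, ContDiffOn ℝ 1 (fun p : E × ℂ => a p.1 j p.2) (D j)
  a_analytic : ∀ j, ∀ s ∈ U, DifferentiableOn ℂ (a s j) {z | (s, z) ∈ D j}

namespace SymbolFamily

variable {E : Type*} [NormedAddCommGroup E] [NormedSpace ℝ E] {m : ℕ}

/-- The separating point `β_j`. -/
def β (F : SymbolFamily E m) (s : E) (j : Fin (m + 1)) : ℂ := pt (F.θ s j)

/-- The weight `w(z) = z ^ (-n) a(z)`. -/
def weight (F : SymbolFamily E m) (n : ℕ) (s : E) (j : Fin (m + 1)) (z : ℂ) : ℂ :=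
  z ^ (-(n : ℤ)) * F.a s j z

/-- `T_n[a]` as a function of the parameters. -/
def T (F : SymbolFamily E m) (n : ℕ) (s : E) : ℂ := toeplitz n (F.θ s) (F.a s)

/-- The jump `Δ_j` of the weight at `β_j`: the value from the arc that ends at `β_j` minus the
value from the arc that starts there (in the counterclockwise orientation). -/
def Δ (F : SymbolFamily E m) (n : ℕ) (s : E) (j : Fin (m + 1)) : ℂ :=
  F.weight n s (j - 1) (F.β s j) - F.weight n s j (F.β s j)

/-- The radii `ε` of the small circles around the `β_j` and `R` of the big circle are admissible:
the closed discs around the `β_j` are disjoint and lie in `|z| < R`. -/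
def Admissible (F : SymbolFamily E m) (s : E) (ε R : ℝ) : Prop :=
  0 < ε ∧ ε < 1 ∧ 1 + ε < R ∧ ∀ j k, j ≠ k → 2 * ε < ‖F.β s j - F.β s k‖

/-- The equivalent Riemann--Hilbert problem with bounded solution, at the parameter value `s₀`:
jump `[[1, w], [0, 1]]` on the parts of the arcs at distance more than `ε` from the `β_j`, jump
`[[1, -C[w]], [0, 1]]` on the circles `|z - β_j| = ε`, and a jump on `|z| = R` that does not depend
on the parameters and normalizes the solution to `1` at infinity. The contours are fixed by `s₀`;
the jump matrices depend on the parameters. -/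
def contour (F : SymbolFamily E m) (n : ℕ) (s₀ : E) (ε R : ℝ) :
    Fin (m + 1) ⊕ Fin (m + 1) ⊕ Unit → JumpArc E
  | Sum.inl j =>
    { center := 0
      radius := 1
      angles := {t | t ∈ Set.Ioo (F.θ s₀ j) (nextAngle (F.θ s₀) j) ∧
        ∀ k, ε < ‖pt t - F.β s₀ k‖}
      jump := fun s z => upper (F.weight n s j z) }
  | Sum.inr (Sum.inl j) =>
    { center := F.β s₀ j
      radius := ε
      angles := Set.Ioc 0 (2 * Real.pi)
      jump := fun s z => upper (- cauchy (F.θ s) (F.weight n s) z) }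
  | Sum.inr (Sum.inr _) =>
    { center := 0
      radius := R
      angles := Set.Ioc 0 (2 * Real.pi)
      jump := fun _ z => sigmaPow (-(n : ℤ)) z }

open Classical in
/-- The solution of the equivalent problem built from `Γ`: it is `Γ z ^ (-n σ₃)` for `|z| > R`,
`Γ [[1, C[w]], [0, 1]]` in the discs `|z - β_j| < ε`, and `Γ` elsewhere. -/
def cloak (F : SymbolFamily E m) (n : ℕ) (s₀ : E) (ε R : ℝ)
    (Γ : ℂ → Matrix (Fin 2) (Fin 2) ℂ) (z : ℂ) : Matrix (Fin 2) (Fin 2) ℂ :=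
  if R < ‖z‖ then Γ z * sigmaPow (-(n : ℤ)) z
  else if ∃ j, ‖z - F.β s₀ j‖ < ε then Γ z * upper (cauchy (F.θ s₀) (F.weight n s₀) z)
  else Γ z

/-- The differential `Ω_n(∂) = Ω(∂; [Γ_n])` at `s`, in the direction `v`. -/
def Omega (F : SymbolFamily E m) (n : ℕ) (ε R : ℝ) (Γ : ℂ → Matrix (Fin 2) (Fin 2) ℂ)
    (s v : E) : ℂ :=
  modifiedMalgrange (F.contour n s ε R) (F.cloak n s ε R Γ) s v

end SymbolFamily

end ToeplitzRHP

end

/-! Let `M` be the functional `f ↦ ∮ f w dx / (2πi)` on polynomials. Because `w = z ^ (-n) a`, the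
matrix `A` with entries `M (X ^ (j + n - 1 - i))` is the Toeplitz matrix `[μ_{j-i}]`, so that `T_n =
det A`.

The jump is upper triangular, hence the first column of a solution does not jump across the arcs.
Its logarithmic singularities are removable, and by Liouville it consists of polynomials `p` (monic
of degree `n`) and `q` (of degree less than `n`). The second column is minus the Cauchy transform of
`p w` and `q w`, up to a constant for `n = 0`. Expanding it at infinity turns the normalization into
orthogonality: `M (X ^ k p) = 0` and `M (X ^ k q) = δ_{k,n-1}` for `k < n`. Conversely such a pair,
which exists when `det A ≠ 0`, gives a solution.

The algebraic core is `exists_bezoutian`: `B_z = (q(z) p - p(z) q) / (X - z)` reproduces powers, `M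
(X ^ k B_z) = z ^ k`. Hence `A` is nonsingular, and the coefficients of the Bezoutian are the
entries of `A⁻¹` (`polyKernel_eq`). Since `det Γ = 1`, the kernel `K₂₁` is this Bezoutian.

Jacobi's formula gives `∂ ln T_n = Tr (A⁻¹ ∂A)`. Each moment is differentiated under the integral
sign with moving end points, and linearity assembles the result into `variation` applied to
`K₂₁(x,x) x ^ (-n)`, which is the explicit formula of the theorem.

For the Malgrange form, triangularity kills the correction term and reduces the other integrand to
`K₂₁(x,x)` times the derivative of the triangular entry. The arcs outside the discs contribute
directly. On a small circle that entry is `-C[w]`; Fubini and Cauchy's formula turn its contribution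
into the missing parts of the arcs and the term at `β_j`. Fubini is delicate where the small circle
crosses the unit circle: there the Cauchy kernel is dominated by a product of inverse square roots
(`inv_norm_pt_sub_circleMap_le`). -/

noncomputable section
namespace ToeplitzRHP

/-! ### Removable singularities on the circle and Liouville's theorem. -/

/-- The complement of the unit circle. -/
def offCircle : Set ℂ := {z | ‖z‖ ≠ 1}

lemma isOpen_offCircle : IsOpen offCircle :=
  isOpen_ne_fun continuous_norm continuous_const

lemma neBot_inner {c z : ℂ} {r : ℝ} (hr : 0 < r) (hz : ‖z - c‖ = r) :
    (𝓝[Metric.ball c r] z).NeBot := by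
  rw [← mem_closure_iff_nhdsWithin_neBot, closure_ball _ hr.ne']
  simp [dist_eq_norm, hz]

lemma ball_subset_offCircle : Metric.ball (0 : ℂ) 1 ⊆ offCircle := fun z hz => by
  have : ‖z‖ < 1 := by simpa using hz
  exact this.ne

lemma compl_closedBall_subset_offCircle : (Metric.closedBall (0 : ℂ) 1)ᶜ ⊆ offCircle :=
  fun z hz => by
  have : 1 < ‖z‖ := by simpa using hz
  exact this.ne'

lemma offCircle_eq_union :
    offCircle = Metric.ball (0 : ℂ) 1 ∪ (Metric.closedBall (0 : ℂ) 1)ᶜ := by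
  ext z
  simp [offCircle, lt_or_lt_iff_ne]

lemma dense_offCircle : Dense offCircle := by
  intro z
  by_cases hz : ‖z‖ = 1
  · have := neBot_inner (c := 0) (z := z) one_pos (by simpa using hz)
    exact closure_mono ball_subset_offCircle (mem_closure_iff_nhdsWithin_neBot.2 this)
  · exact subset_closure hz

lemma tendsto_offCircle {f : ℂ → ℂ} {z L : ℂ}
    (hi : Tendsto f (𝓝[Metric.ball (0 : ℂ) 1] z) (𝓝 L))
    (ho : Tendsto f (𝓝[(Metric.closedBall (0 : ℂ) 1)ᶜ] z) (𝓝 L)) :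
    Tendsto f (𝓝[offCircle] z) (𝓝 L) := by
  rw [offCircle_eq_union, nhdsWithin_union]
  exact hi.sup ho

lemma eventually_cobounded_offCircle : ∀ᶠ z in Bornology.cobounded ℂ, z ∈ offCircle := by
  filter_upwards [eventually_cobounded_le_norm (2 : ℝ)] with z hz
  intro h
  rw [h] at hz
  norm_num at hz

/-- A continuous function that is holomorphic off the unit circle is entire. -/
theorem differentiable_of_continuous_of_differentiableOn_offCircle {G : ℂ → ℂ}
    (hc : Continuous G) (hd : DifferentiableOn ℂ G offCircle) : Differentiable ℂ G := by
  have hda : ∀ z ∈ offCircle, DifferentiableAt ℂ G z := fun z hz =>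
    (hd z hz).differentiableAt (isOpen_offCircle.mem_nhds hz)
  intro z₀
  by_cases hz₀ : ‖z₀‖ ≠ 1
  · exact hda z₀ hz₀
  push Not at hz₀
  -- Cauchy's formula on `|x| = 2` for `z` off the unit circle. The difference quotient `dslope G z`
  -- is continuous, and holomorphic off the circle except possibly at `z`. Cauchy's theorem in the
  -- disc `|x| < 1` and in the annulus `1 < |x| < 2` separately makes its integral vanish.
  have key : ∀ z, ‖z‖ < 2 → z ∈ offCircle →
      (2 * Real.pi * I : ℂ)⁻¹ • (∮ x in C(0, 2), (x - z)⁻¹ • G x) = G z := by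
    intro z hz hzo
    have hcont : Continuous (dslope G z) := by
      rw [← continuousOn_univ, continuousOn_dslope univ_mem]
      exact ⟨hc.continuousOn, hda z hzo⟩
    have hdiff : ∀ x, x ≠ z → x ∈ offCircle → DifferentiableAt ℂ (dslope G z) x := by
      intro x hx hxo
      exact (differentiableAt_dslope_of_ne hx).2 (hda x hxo)
    have h1 : (∮ x in C(0, 1), dslope G z x) = 0 := by
      refine circleIntegral_eq_zero_of_differentiable_on_off_countable zero_le_one
        (Set.countable_singleton z) hcont.continuousOn ?_
      rintro x ⟨hx, hxz⟩
      exact hdiff x hxz (ball_subset_offCircle hx)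
    have h2 : (∮ x in C(0, 2), dslope G z x) = ∮ x in C(0, 1), dslope G z x := by
      refine circleIntegral_eq_of_differentiable_on_annulus_off_countable one_pos one_le_two
        (Set.countable_singleton z) hcont.continuousOn ?_
      rintro x ⟨⟨-, hx⟩, hxz⟩
      exact hdiff x hxz (compl_closedBall_subset_offCircle hx)
    rw [h1] at h2
    have hne : ∀ x ∈ Metric.sphere (0 : ℂ) 2, x ≠ z := by
      rintro x hx rfl
      simp at hx
      linarith
    have h3 : (∮ x in C(0, 2), dslope G z x) =
        ∮ x in C(0, 2), ((x - z)⁻¹ • G x - (x - z)⁻¹ • G z) := by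
      refine circleIntegral.integral_congr (by norm_num) fun x hx => ?_
      rw [dslope_of_ne _ (hne x hx), slope_def_module, smul_sub]
    have hci : ContinuousOn (fun x => (x - z)⁻¹) (Metric.sphere (0 : ℂ) 2) :=
      ContinuousOn.inv₀ (by fun_prop) fun x hx => sub_ne_zero.2 (hne x hx)
    rw [h3, circleIntegral.integral_sub, circleIntegral.integral_smul_const,
      circleIntegral.integral_sub_inv_of_mem_ball (by simpa using hz), sub_eq_zero] at h2
    · rw [h2, smul_smul, inv_mul_cancel₀ two_pi_I_ne_zero, one_smul]
    · exact (hci.smul hc.continuousOn).circleIntegrable (by norm_num)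
    · exact (hci.smul continuousOn_const).circleIntegrable (by norm_num)
  set g : ℂ → ℂ := fun z => (2 * Real.pi * I : ℂ)⁻¹ • (∮ x in C(0, 2), (x - z)⁻¹ • G x) with hg
  have hgd : DifferentiableOn ℂ g (Metric.ball 0 2) := by
    have := (hasFPowerSeriesOn_cauchy_integral (f := G) (c := 0) (R := 2)
      (hc.continuousOn.circleIntegrable (by norm_num)) (by norm_num)).differentiableOn
    rw [← ENNReal.ofReal_coe_nnreal, Metric.eball_ofReal] at this
    exact this
  -- The formula extends to the points of the circle by density, both sides being continuous.
  have hEq : ∀ z ∈ Metric.ball (0 : ℂ) 2, G z = g z := by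
    intro z hz
    have : (𝓝[offCircle] z).NeBot := mem_closure_iff_nhdsWithin_neBot.1 (dense_offCircle z)
    have hga : ContinuousAt g z :=
      (hgd.differentiableAt (Metric.isOpen_ball.mem_nhds hz)).continuousAt
    refine tendsto_nhds_unique (l := 𝓝[offCircle] z) (f := G)
      (hc.continuousAt.tendsto.mono_left nhdsWithin_le_nhds) ?_
    refine (hga.tendsto.mono_left nhdsWithin_le_nhds).congr' ?_
    filter_upwards [self_mem_nhdsWithin,
      mem_nhdsWithin_of_mem_nhds (Metric.isOpen_ball.mem_nhds hz)] with x hx hx2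
    exact key x (by simpa using hx2) hx
  have hz2 : Metric.ball (0 : ℂ) 2 ∈ 𝓝 z₀ := Metric.isOpen_ball.mem_nhds (by simp [hz₀])
  refine (hgd.differentiableAt hz2).congr_of_eventuallyEq ?_
  filter_upwards [hz2] with z hz using hEq z hz

/-- An entire function of polynomial growth is a polynomial. -/
theorem exists_polynomial_of_isBigO (n : ℕ) : ∀ {f : ℂ → ℂ}, Differentiable ℂ f →
    f =O[Bornology.cobounded ℂ] (fun z => z ^ n) → ∃ q : Polynomial ℂ, ∀ z, f z = q.eval z := by
  induction n with
  | zero =>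
    intro f hf ho
    simp only [pow_zero] at ho
    obtain ⟨C, hC⟩ := ho.bound
    obtain ⟨r, hr⟩ := (Metric.hasBasis_cobounded_compl_closedBall (0 : ℂ)).eventually_iff.1 hC
    have hb : Bornology.IsBounded (Set.range f) := by
      obtain ⟨C', hC'⟩ := (isCompact_closedBall (0 : ℂ) r).exists_bound_of_continuousOn
        hf.continuous.continuousOn
      refine (Metric.isBounded_closedBall (x := (0 : ℂ)) (r := max C C')).subset ?_
      rintro _ ⟨z, rfl⟩
      by_cases hz : z ∈ Metric.closedBall (0 : ℂ) r
      · simpa using Or.inr (hC' z hz)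
      · have := hr.2 hz
        simp only [norm_one, mul_one] at this
        simpa using Or.inl this
    obtain ⟨c, hc⟩ := hf.exists_const_forall_eq_of_bounded hb
    exact ⟨Polynomial.C c, fun z => by simp [hc z]⟩
  | succ n ih =>
    intro f hf ho
    -- Write `f(z) = f(0) + z g(z)`: the quotient `g` is entire and grows one power slower.
    have hd : Differentiable ℂ (dslope f 0) := by
      rw [← differentiableOn_univ, differentiableOn_dslope univ_mem]
      exact hf.differentiableOn
    have hf0 : ∀ z, f z = f 0 + z * dslope f 0 z := by
      intro z
      have := sub_smul_dslope f 0 z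
      simp only [sub_zero, smul_eq_mul] at this
      rw [this]; ring
    have ho' : (dslope f 0) =O[Bornology.cobounded ℂ] (fun z => z ^ n) := by
      have h1 : (fun z => f z - f 0) =O[Bornology.cobounded ℂ] (fun z : ℂ => z ^ (n + 1)) := by
        refine ho.sub ?_
        refine Asymptotics.IsBigO.of_bound ‖f 0‖ ?_
        filter_upwards [eventually_cobounded_le_norm (1 : ℝ)] with z hz
        rw [norm_pow]
        exact le_mul_of_one_le_right (norm_nonneg _) (one_le_pow₀ hz)
      have h2 := h1.mul (Asymptotics.isBigO_refl (fun z : ℂ => z⁻¹) (Bornology.cobounded ℂ))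
      refine (h2.congr' ?_ ?_)
      · filter_upwards [eventually_cobounded_le_norm (1 : ℝ)] with z hz
        have hz0 : z ≠ 0 := norm_pos_iff.1 (by linarith)
        rw [hf0 z]; field_simp; ring
      · filter_upwards [eventually_cobounded_le_norm (1 : ℝ)] with z hz
        have hz0 : z ≠ 0 := norm_pos_iff.1 (by linarith)
        rw [pow_succ, mul_assoc, mul_inv_cancel₀ hz0, mul_one]
    obtain ⟨q, hq⟩ := ih hd ho'
    exact ⟨Polynomial.C (f 0) + Polynomial.X * q, fun z => by simp [hf0 z, hq z]⟩

/-- The leading behaviour of a polynomial at infinity. -/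
lemma tendsto_eval_div_pow (q : Polynomial ℂ) :
    Tendsto (fun z => q.eval z * (z⁻¹) ^ q.natDegree) (Bornology.cobounded ℂ)
      (𝓝 q.leadingCoeff) := by
  -- `q(z) z ^ (-deg q)` is the reversed polynomial at `1/z`, and its constant coefficient is the
  -- leading coefficient of `q`.
  have h1 : Tendsto (fun z : ℂ => q.reverse.eval z⁻¹) (Bornology.cobounded ℂ)
      (𝓝 (q.reverse.eval 0)) :=
    (q.reverse.continuous.tendsto 0).comp tendsto_inv₀_cobounded
  rw [← Polynomial.coeff_zero_eq_eval_zero, Polynomial.coeff_zero_reverse] at h1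
  refine h1.congr' ?_
  filter_upwards [eventually_cobounded_le_norm (1 : ℝ)] with z hz
  have hz0 : z ≠ 0 := norm_pos_iff.1 (by linarith)
  have : Invertible z := invertibleOfNonzero hz0
  have h2 := Polynomial.eval₂_reverse_mul_pow (RingHom.id ℂ) z q
  simp only [Polynomial.eval₂_id, invOf_eq_inv] at h2
  rw [← h2, mul_assoc, ← mul_pow, mul_inv_cancel₀ hz0, one_pow, mul_one]

/-- A nonzero polynomial that is `O(z ^ k)` at infinity has degree at most `k`. -/
lemma natDegree_le_of_isBigO {q : Polynomial ℂ} (hq : q ≠ 0) {k : ℤ}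
    (h : (fun z => q.eval z) =O[Bornology.cobounded ℂ] (fun z => z ^ k)) :
    (q.natDegree : ℤ) ≤ k := by
  by_contra! hlt
  obtain ⟨C, hC⟩ := h.bound
  -- If the degree exceeded `k`, this quotient would tend to `0` as well as to the nonzero leading
  -- coefficient.
  have h0 : Tendsto (fun z => q.eval z * (z⁻¹) ^ q.natDegree) (Bornology.cobounded ℂ) (𝓝 0) := by
    rw [tendsto_zero_iff_norm_tendsto_zero]
    have h3 : Tendsto (fun z : ℂ => C * ‖z⁻¹‖) (Bornology.cobounded ℂ) (𝓝 0) := by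
      have := (tendsto_inv₀_cobounded (α := ℂ)).norm.const_mul C
      simpa using this
    refine squeeze_zero' (Eventually.of_forall fun _ => norm_nonneg _) ?_ h3
    filter_upwards [hC, eventually_cobounded_le_norm (1 : ℝ)] with z hz hz1
    have hz0 : z ≠ 0 := norm_pos_iff.1 (by linarith)
    have hzp : 0 < ‖z‖ := by linarith
    have hzk : (0 : ℝ) < ‖z‖ ^ k := zpow_pos hzp k
    have hC0 : 0 ≤ C := by
      by_contra! hn
      have := norm_nonneg (q.eval z)
      rw [norm_zpow] at hz
      nlinarith
    rw [norm_mul, norm_pow, norm_inv]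
    calc ‖q.eval z‖ * ‖z‖⁻¹ ^ q.natDegree ≤ (C * ‖z‖ ^ k) * ‖z‖⁻¹ ^ q.natDegree := by
          rw [← norm_zpow]; gcongr
      _ = C * ‖z‖ ^ (k - q.natDegree) := by
          rw [zpow_sub₀ hzp.ne', zpow_natCast, inv_pow, div_eq_mul_inv, mul_assoc]
      _ ≤ C * ‖z‖ ^ (-1 : ℤ) := by
          refine mul_le_mul_of_nonneg_left (zpow_le_zpow_right₀ hz1 (by lia)) hC0
      _ = C * ‖z‖⁻¹ := by rw [zpow_neg_one]
  have := tendsto_nhds_unique h0 (tendsto_eval_div_pow q)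
  exact hq (Polynomial.leadingCoeff_eq_zero.1 this.symm)

lemma tendsto_sub_mul_log (b : ℂ) :
    Tendsto (fun z => ‖z - b‖ * Real.log ‖z - b‖) (𝓝 b) (𝓝 0) := by
  have h1 : Continuous fun x : ℝ => x * Real.log x := Real.continuous_mul_log
  have h2 : Tendsto (fun z => ‖z - b‖) (𝓝 b) (𝓝 0) := by
    have : Continuous fun z => ‖z - b‖ := by fun_prop
    simpa using this.tendsto b
  have h3 := (h1.tendsto 0).comp h2
  rw [zero_mul] at h3
  exact h3

/-- A function that is holomorphic off the unit circle, extends continuously to all but finitely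
many points of the circle, has at most logarithmic singularities there and polynomial growth is a
polynomial. -/
theorem exists_polynomial_of_offCircle {F : ℂ → ℂ} {n : ℕ} (S : Finset ℂ)
    (hF : DifferentiableOn ℂ F offCircle) (hS : ∀ b ∈ S, ‖b‖ = 1)
    (hlim : ∀ z, ‖z‖ = 1 → z ∉ S → ∃ L, Tendsto F (𝓝[offCircle] z) (𝓝 L))
    (hlog : ∀ b ∈ S, F =O[𝓝[offCircle] b] (fun z => Real.log ‖z - b‖))
    (hinf : F =O[Bornology.cobounded ℂ] (fun z => z ^ n)) :
    ∃ q : Polynomial ℂ, ∀ z ∈ offCircle, F z = q.eval z := by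
  -- The factor `P` vanishes to first order at the points of `S`, which beats the logarithm. So `P
  -- F` extends to an entire function with zeros on `S`, hence to a polynomial divisible by `P`; the
  -- quotient is `F`.
  set P : Polynomial ℂ := ∏ b ∈ S, (Polynomial.X - Polynomial.C b) with hP
  have hPS : ∀ b ∈ S, P.eval b = 0 := fun b hb => by
    rw [hP, Polynomial.eval_prod]
    exact Finset.prod_eq_zero hb (by simp)
  have hP0 : ∀ z ∈ offCircle, P.eval z ≠ 0 := by
    intro z hz h
    rw [hP, Polynomial.eval_prod, Finset.prod_eq_zero_iff] at h
    obtain ⟨b, hb, h⟩ := h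
    simp only [Polynomial.eval_sub, Polynomial.eval_X, Polynomial.eval_C, sub_eq_zero] at h
    exact hz (h ▸ hS b hb)
  set G₀ : ℂ → ℂ := fun z => P.eval z * F z with hG₀
  have hG₀d : DifferentiableOn ℂ G₀ offCircle := P.differentiable.differentiableOn.mul hF
  have hzero : ∀ b ∈ S, Tendsto G₀ (𝓝[offCircle] b) (𝓝 0) := by
    intro b hb
    have hb2 := hlog b hb
    have h1 : (fun z => P.eval z) =O[𝓝[offCircle] b] (fun z => ‖z - b‖) := by
      have := (P.differentiable b).isBigO_sub
      simp only [hPS b hb, sub_zero] at this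
      exact (this.mono nhdsWithin_le_nhds).norm_right
    exact (h1.mul hb2).trans_tendsto ((tendsto_sub_mul_log b).mono_left nhdsWithin_le_nhds)
  set G : ℂ → ℂ := extendFrom offCircle G₀ with hG
  have hGoff : ∀ z ∈ offCircle, G z = G₀ z := by
    intro z hz
    exact extendFrom_eq (subset_closure hz) (hG₀d.continuousOn z hz)
  have hGc : Continuous G := by
    refine continuous_extendFrom dense_offCircle fun z => ?_
    by_cases hz : z ∈ offCircle
    · exact ⟨_, hG₀d.continuousOn z hz⟩
    by_cases hzS : z ∈ S
    · exact ⟨0, hzero z hzS⟩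
    · obtain ⟨L, hL⟩ := hlim z (by simpa [offCircle] using hz) hzS
      exact ⟨_, (P.continuous.continuousAt.tendsto.mono_left nhdsWithin_le_nhds).mul hL⟩
  have hGd : Differentiable ℂ G :=
    differentiable_of_continuous_of_differentiableOn_offCircle hGc (hG₀d.congr hGoff)
  have hGS : ∀ b ∈ S, G b = 0 := fun b hb =>
    extendFrom_eq (dense_offCircle b) (hzero b hb)
  have hGinf : G =O[Bornology.cobounded ℂ] (fun z => z ^ (P.natDegree + n)) := by
    have h1 : (fun z => P.eval z) =O[Bornology.cobounded ℂ] (fun z => z ^ P.natDegree) := by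
      have h2 := (tendsto_eval_div_pow P).isBigO_one ℂ
      have h3 := h2.mul (Asymptotics.isBigO_refl (fun z : ℂ => z ^ P.natDegree) _)
      refine h3.congr' ?_ ?_
      · filter_upwards [eventually_cobounded_le_norm (1 : ℝ)] with z hz
        have hz0 : z ≠ 0 := norm_pos_iff.1 (by linarith)
        rw [mul_assoc, ← mul_pow, inv_mul_cancel₀ hz0, one_pow, mul_one]
      · exact Eventually.of_forall fun z => one_mul _
    refine (h1.mul hinf).congr' ?_ ?_
    · filter_upwards [eventually_cobounded_offCircle] with z hz
      rw [hGoff z hz]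
    · exact Eventually.of_forall fun z => (pow_add _ _ _).symm
  obtain ⟨g, hg⟩ := exists_polynomial_of_isBigO _ hGd hGinf
  have hdvd : P ∣ g := by
    refine Finset.prod_dvd_of_coprime ?_ ?_
    · intro a _ b _ hab
      exact Polynomial.pairwise_coprime_X_sub_C (s := fun x : ℂ => x) (fun _ _ h => h) hab
    · intro b hb
      rw [Polynomial.dvd_iff_isRoot, Polynomial.IsRoot, ← hg, hGS b hb]
  obtain ⟨q, rfl⟩ := hdvd
  refine ⟨q, fun z hz => ?_⟩
  have := (hGoff z hz).symm.trans (hg z)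
  rw [Polynomial.eval_mul] at this
  exact mul_left_cancel₀ (hP0 z hz) this

/-! ### Integrals and Cauchy transforms along a single arc. -/

/-- `∫ f(x) dx / (2πi)` along the arc of the unit circle with angles in `[α, β]`. -/
def arcIntegral (α β : ℝ) (f : ℂ → ℂ) : ℂ :=
  ∫ t in α..β, f (pt t) * (pt t * I) / (2 * Real.pi * I)

lemma arcInt_eq_sum {m : ℕ} (θ : Fin (m + 1) → ℝ) (f : Fin (m + 1) → ℂ → ℂ) :
    arcInt θ f = ∑ j, arcIntegral (θ j) (nextAngle θ j) (f j) := rfl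

lemma norm_pt (t : ℝ) : ‖pt t‖ = 1 := by simp [pt]

lemma pt_ne_zero (t : ℝ) : pt t ≠ 0 := by
  rw [← norm_pos_iff, norm_pt]; exact one_pos

lemma continuous_pt : Continuous pt := continuous_circleMap 0 1

lemma hasDerivAt_pt (t : ℝ) : HasDerivAt pt (pt t * I) t := by
  exact hasDerivAt_circleMap 0 1 t |>.congr_deriv (by simp [pt])

lemma pt_ne_of_mem_offCircle {z : ℂ} (hz : z ∈ offCircle) (t : ℝ) : pt t ≠ z := by
  rintro rfl
  exact hz (norm_pt t)

/-- `f` is continuous along the arc with angles in `[α, β]`. -/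
def ContArc (α β : ℝ) (f : ℂ → ℂ) : Prop := ContinuousOn (fun t => f (pt t)) (Set.Icc α β)

/-- `f` is holomorphic in a neighbourhood of the arc with angles in `[α, β]`. -/
def HolArc (α β : ℝ) (f : ℂ → ℂ) : Prop :=
  ∃ N : Set ℂ, IsOpen N ∧ (∀ t ∈ Set.Icc α β, pt t ∈ N) ∧ DifferentiableOn ℂ f N

lemma HolArc.contArc {α β : ℝ} {f : ℂ → ℂ} (h : HolArc α β f) : ContArc α β f := by
  obtain ⟨N, -, hN, hf⟩ := h
  exact hf.continuousOn.comp continuous_pt.continuousOn hN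

lemma HolArc.mul {α β : ℝ} {f g : ℂ → ℂ} (hf : HolArc α β f) (hg : HolArc α β g) :
    HolArc α β (fun x => f x * g x) := by
  obtain ⟨N, hN, hN1, hN2⟩ := hf
  obtain ⟨M, hM, hM1, hM2⟩ := hg
  exact ⟨N ∩ M, hN.inter hM, fun t ht => ⟨hN1 t ht, hM1 t ht⟩,
    (hN2.mono Set.inter_subset_left).mul (hM2.mono Set.inter_subset_right)⟩

lemma Differentiable.holArc {α β : ℝ} {f : ℂ → ℂ} (hf : Differentiable ℂ f) : HolArc α β f :=
  ⟨Set.univ, isOpen_univ, fun _ _ => trivial, hf.differentiableOn⟩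

lemma ContArc.mul {α β : ℝ} {f g : ℂ → ℂ} (hf : ContArc α β f) (hg : ContArc α β g) :
    ContArc α β (fun x => f x * g x) := ContinuousOn.mul hf hg

lemma Continuous.contArc {α β : ℝ} {f : ℂ → ℂ} (hf : Continuous f) : ContArc α β f :=
  (hf.comp continuous_pt).continuousOn

lemma ContArc.div_sub {α β : ℝ} {f : ℂ → ℂ} (hf : ContArc α β f) {z : ℂ}
    (hz : ∀ t ∈ Set.Icc α β, pt t ≠ z) : ContArc α β (fun x => f x / (x - z)) :=
  ContinuousOn.div hf (continuous_pt.sub continuous_const).continuousOn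
    fun t ht => sub_ne_zero.2 (hz t ht)

lemma ContArc.intervalIntegrable {α β : ℝ} (hab : α ≤ β) {f : ℂ → ℂ} (hf : ContArc α β f) :
    IntervalIntegrable (fun t => f (pt t) * (pt t * I) / (2 * Real.pi * I)) volume α β := by
  refine ContinuousOn.intervalIntegrable ?_
  rw [Set.uIcc_of_le hab]
  refine ContinuousOn.div_const (ContinuousOn.mul hf ?_) _
  exact (continuous_pt.mul continuous_const).continuousOn

lemma arcIntegral_congr {α β : ℝ} (hab : α ≤ β) {f g : ℂ → ℂ}
    (h : ∀ t ∈ Set.Icc α β, f (pt t) = g (pt t)) :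
    arcIntegral α β f = arcIntegral α β g := by
  refine intervalIntegral.integral_congr fun t ht => ?_
  rw [Set.uIcc_of_le hab] at ht
  simp only [h t ht]

lemma arcIntegral_add {α β : ℝ} (hab : α ≤ β) {f g : ℂ → ℂ} (hf : ContArc α β f)
    (hg : ContArc α β g) :
    arcIntegral α β (fun x => f x + g x) = arcIntegral α β f + arcIntegral α β g := by
  unfold arcIntegral
  rw [← intervalIntegral.integral_add (hf.intervalIntegrable hab) (hg.intervalIntegrable hab)]
  congr 1; ext t; ring

lemma arcIntegral_sub {α β : ℝ} (hab : α ≤ β) {f g : ℂ → ℂ} (hf : ContArc α β f)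
    (hg : ContArc α β g) :
    arcIntegral α β (fun x => f x - g x) = arcIntegral α β f - arcIntegral α β g := by
  unfold arcIntegral
  rw [← intervalIntegral.integral_sub (hf.intervalIntegrable hab) (hg.intervalIntegrable hab)]
  congr 1; ext t; ring

lemma arcIntegral_const_mul {α β : ℝ} (c : ℂ) (f : ℂ → ℂ) :
    arcIntegral α β (fun x => c * f x) = c * arcIntegral α β f := by
  unfold arcIntegral
  rw [← intervalIntegral.integral_const_mul]
  congr 1; ext t; ring

lemma arcIntegral_sum {α β : ℝ} (hab : α ≤ β) {ι : Type*} (s : Finset ι) {f : ι → ℂ → ℂ}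
    (hf : ∀ i ∈ s, ContArc α β (f i)) :
    arcIntegral α β (fun x => ∑ i ∈ s, f i x) = ∑ i ∈ s, arcIntegral α β (f i) := by
  unfold arcIntegral
  rw [← intervalIntegral.integral_finsetSum fun i hi => (hf i hi).intervalIntegrable hab]
  congr 1; ext t; rw [Finset.sum_mul, Finset.sum_div]

lemma norm_arcIntegral_le {α β : ℝ} (hab : α ≤ β) {f : ℂ → ℂ} {C : ℝ}
    (h : ∀ t ∈ Set.Icc α β, ‖f (pt t)‖ ≤ C) :
    ‖arcIntegral α β f‖ ≤ C * (β - α) := by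
  have hC : 0 ≤ C := (norm_nonneg _).trans (h α ⟨le_rfl, hab⟩)
  have := intervalIntegral.norm_integral_le_of_norm_le_const (a := α) (b := β) (C := C)
    (f := fun t => f (pt t) * (pt t * I) / (2 * Real.pi * I)) (fun t ht => by
      rw [Set.uIoc_of_le hab] at ht
      have h1 := h t ⟨ht.1.le, ht.2⟩
      have hpi := Real.pi_gt_three
      simp only [norm_mul, norm_div, norm_pt, norm_I, Complex.norm_real, Real.norm_eq_abs,
        abs_of_pos Real.pi_pos, Complex.norm_ofNat, mul_one]
      rw [div_le_iff₀ (by linarith)]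
      nlinarith)
  rwa [abs_of_nonneg (by linarith)] at this

/-- The distance from a point off the arc to the arc is positive. -/
lemma exists_le_norm_sub {α β : ℝ} {z₀ : ℂ} (hz : ∀ t ∈ Set.Icc α β, pt t ≠ z₀) :
    ∃ δ > 0, ∀ t ∈ Set.Icc α β, δ ≤ ‖pt t - z₀‖ := by
  obtain ⟨δ, hδ, h⟩ := isCompact_Icc.exists_forall_le' (f := fun t => ‖pt t - z₀‖) (a := 0)
    (continuous_pt.sub continuous_const).norm.continuousOn
    fun t ht => norm_pos_iff.2 (sub_ne_zero.2 (hz t ht))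
  exact ⟨δ, hδ, h⟩

lemma ContArc.exists_bound {α β : ℝ} (hab : α ≤ β) {f : ℂ → ℂ} (hf : ContArc α β f) :
    ∃ C ≥ 0, ∀ t ∈ Set.Icc α β, ‖f (pt t)‖ ≤ C := by
  obtain ⟨C, hC⟩ := isCompact_Icc.exists_bound_of_continuousOn hf
  exact ⟨C, (norm_nonneg _).trans (hC α ⟨le_rfl, hab⟩), hC⟩

lemma ContArc.aestronglyMeasurable {α β : ℝ} (hab : α ≤ β) {f : ℂ → ℂ} (hf : ContArc α β f) :
    AEStronglyMeasurable (fun t => f (pt t)) (volume.restrict (Set.uIoc α β)) := by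
  rw [Set.uIoc_of_le hab]
  exact (ContinuousOn.mono hf Set.Ioc_subset_Icc_self).aestronglyMeasurable measurableSet_Ioc

lemma measurable_pt_sub_inv (z : ℂ) : Measurable fun t => (pt t - z)⁻¹ :=
  (continuous_pt.sub continuous_const).measurable.inv

lemma ContArc.aestronglyMeasurable_integrand {α β : ℝ} (hab : α ≤ β) {f : ℂ → ℂ}
    (hf : ContArc α β f) (c z : ℂ) :
    AEStronglyMeasurable (fun t => (f (pt t) - c) / (pt t - z) * (pt t * I) / (2 * Real.pi * I))
      (volume.restrict (Set.uIoc α β)) := by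
  simp only [div_eq_mul_inv]
  exact ((((hf.aestronglyMeasurable hab).sub aestronglyMeasurable_const).mul
    (measurable_pt_sub_inv z).aestronglyMeasurable).mul
    (continuous_pt.mul continuous_const).aestronglyMeasurable).mul aestronglyMeasurable_const

/-- The Cauchy transform is holomorphic off the arc. -/
lemma differentiableAt_cauchyArc {α β : ℝ} (hab : α ≤ β) {f : ℂ → ℂ} (hf : ContArc α β f) {z₀ : ℂ}
    (hz : ∀ t ∈ Set.Icc α β, pt t ≠ z₀) :
    DifferentiableAt ℂ (fun z => arcIntegral α β (fun x => f x / (x - z))) z₀ := by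
  obtain ⟨δ, hδ, hd⟩ := exists_le_norm_sub hz
  obtain ⟨C, hC0, hC⟩ := hf.exists_bound hab
  have hpi := Real.pi_gt_three
  have hball : ∀ z ∈ Metric.ball z₀ (δ / 2), ∀ t ∈ Set.Icc α β, δ / 2 ≤ ‖pt t - z‖ := by
    intro z hz t ht
    have h1 := hd t ht
    have h2 : ‖z - z₀‖ < δ / 2 := by simpa [dist_eq_norm] using hz
    have h3 : ‖pt t - z₀‖ ≤ ‖pt t - z‖ + ‖z - z₀‖ := by
      simpa using norm_add_le (pt t - z) (z - z₀)
    linarith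
  have hmeas : ∀ z, AEStronglyMeasurable
      (fun t => f (pt t) / (pt t - z) * (pt t * I) / (2 * Real.pi * I))
      (volume.restrict (Set.uIoc α β)) := fun z => by
    simpa using hf.aestronglyMeasurable_integrand hab 0 z
  refine (intervalIntegral.hasDerivAt_integral_of_dominated_loc_of_deriv_le (𝕜 := ℂ)
    (F := fun z t => f (pt t) / (pt t - z) * (pt t * I) / (2 * Real.pi * I))
    (F' := fun z t => f (pt t) / (pt t - z) ^ 2 * (pt t * I) / (2 * Real.pi * I))
    (bound := fun _ => C / (δ / 2) ^ 2) (Metric.ball_mem_nhds z₀ (half_pos hδ))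
    (Eventually.of_forall hmeas) ((hf.div_sub hz).intervalIntegrable hab) ?_ ?_
    intervalIntegrable_const ?_).2.differentiableAt
  · have := (hmeas z₀).mul (measurable_pt_sub_inv z₀).aestronglyMeasurable
    refine this.congr (ae_of_all _ fun t => ?_)
    simp only [Pi.mul_apply, div_eq_mul_inv, sq, mul_inv]
    ring
  · refine ae_of_all _ fun t ht z hz => ?_
    rw [Set.uIoc_of_le hab] at ht
    have ht' : t ∈ Set.Icc α β := ⟨ht.1.le, ht.2⟩
    have h1 := hball z hz t ht'
    simp only [norm_mul, norm_div, norm_pt, norm_I, Complex.norm_real, Real.norm_eq_abs,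
      abs_of_pos Real.pi_pos, Complex.norm_ofNat, mul_one, norm_pow]
    refine (div_le_self (by positivity) (by linarith)).trans ?_
    gcongr
    exact hC t ht'
  · refine ae_of_all _ fun t ht z hz => ?_
    rw [Set.uIoc_of_le hab] at ht
    have ht' : t ∈ Set.Icc α β := ⟨ht.1.le, ht.2⟩
    have h1 := hball z hz t ht'
    have hne : pt t - z ≠ 0 := by
      rw [← norm_pos_iff]; linarith
    have h2 : HasDerivAt (fun z => pt t - z) (-1) z := by
      simpa using (hasDerivAt_id z).const_sub (pt t)
    have h3 := (((hasDerivAt_const z (f (pt t))).div h2 hne).mul_const (pt t * I)).div_const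
      (2 * Real.pi * I : ℂ)
    refine h3.congr_deriv ?_
    ring

/-- The Cauchy transform of a bounded density is `O(1 / z)` at infinity. -/
lemma cauchyArc_isBigO_inv {α β : ℝ} (hab : α ≤ β) {f : ℂ → ℂ} (hf : ContArc α β f) :
    (fun z => arcIntegral α β (fun x => f x / (x - z))) =O[Bornology.cobounded ℂ]
      (fun z : ℂ => z⁻¹) := by
  obtain ⟨C, hC0, hC⟩ := hf.exists_bound hab
  refine Asymptotics.IsBigO.of_bound (2 * C * (β - α)) ?_
  filter_upwards [eventually_cobounded_le_norm (2 : ℝ)] with z hz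
  have h1 : ∀ t ∈ Set.Icc α β, ‖f (pt t) / (pt t - z)‖ ≤ 2 * C * ‖z‖⁻¹ := by
    intro t ht
    have h2 : ‖z‖ / 2 ≤ ‖pt t - z‖ := by
      have : ‖z‖ ≤ ‖pt t‖ + ‖pt t - z‖ := by simpa using norm_sub_le (pt t) (pt t - z)
      rw [norm_pt] at this; linarith
    rw [norm_div, div_le_iff₀ (by linarith)]
    have h3 : ‖z‖⁻¹ * ‖z‖ = 1 := inv_mul_cancel₀ (by linarith)
    have h4 : 0 < ‖z‖⁻¹ := inv_pos.2 (by linarith)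
    calc ‖f (pt t)‖ ≤ C := hC t ht
      _ = 2 * C * ‖z‖⁻¹ * (‖z‖ / 2) := by linear_combination (-C) * h3
      _ ≤ _ := by gcongr
  refine (norm_arcIntegral_le hab h1).trans (le_of_eq ?_)
  rw [norm_inv]; ring

/-- The expansion of the Cauchy transform at infinity. -/
lemma pow_mul_cauchyArc {α β : ℝ} (hab : α ≤ β) (N : ℕ) {f : ℂ → ℂ} (hf : ContArc α β f) {z : ℂ}
    (hz : ∀ t ∈ Set.Icc α β, pt t ≠ z) :
    z ^ N * arcIntegral α β (fun x => f x / (x - z)) =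
      arcIntegral α β (fun x => x ^ N * f x / (x - z)) -
        ∑ i ∈ Finset.range N, z ^ i * arcIntegral α β (fun x => x ^ (N - 1 - i) * f x) := by
  have hp : ∀ k : ℕ, ContArc α β (fun x => x ^ k * f x) := fun k =>
    (Continuous.contArc (continuous_pow k)).mul hf
  have hs : ∀ i ∈ Finset.range N, ContArc α β (fun x => z ^ i * (x ^ (N - 1 - i) * f x)) :=
    fun i _ => (Continuous.contArc continuous_const).mul (hp _)
  simp only [← arcIntegral_const_mul]
  rw [← arcIntegral_sum hab _ hs, ← arcIntegral_sub hab ((hp N).div_sub hz)]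
  · refine arcIntegral_congr hab fun t ht => ?_
    have hne : pt t - z ≠ 0 := sub_ne_zero.2 (hz t ht)
    -- The expansion comes from `(x ^ N - z ^ N) / (x - z) = ∑ z ^ i x ^ (N - 1 - i)`.
    have hg := (Commute.all z (pt t)).geom_sum₂_mul N
    simp only [← mul_assoc, ← Finset.sum_mul]
    field_simp
    linear_combination -(f (pt t)) * hg
  · simpa [ContArc] using continuousOn_finsetSum _ hs

/-! ### Boundary values of the Cauchy transform on an arc. -/

lemma pt_inj {t u : ℝ} (h : |t - u| < 2 * Real.pi) (he : pt t = pt u) : t = u := by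
  simp only [pt, circleMap, ofReal_one, one_mul, zero_add] at he
  obtain ⟨k, hk⟩ := exp_eq_exp_iff_exists_int.1 he
  have h1 : (t : ℂ) = u + k * (2 * Real.pi) := by
    have : (t : ℂ) * I = (u + k * (2 * Real.pi)) * I := by rw [hk]; ring
    exact mul_right_cancel₀ I_ne_zero this
  have h2 : t = u + k * (2 * Real.pi) := by exact_mod_cast h1
  have hpi := Real.pi_pos
  have h3 : |(k : ℝ)| < 1 := by
    rw [h2, add_sub_cancel_left, abs_mul, abs_of_pos (by positivity : 0 < 2 * Real.pi)] at h
    by_contra! h4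
    nlinarith
  have h5 : k = 0 := by
    rw [← Int.abs_lt_one_iff]
    exact_mod_cast h3
  simpa [h5] using h2

lemma ae_pt_ne (z : ℂ) : ∀ᵐ t : ℝ, pt t ≠ z := by
  have h : (circleMap 0 1 ⁻¹' {z}).Countable :=
    (Set.countable_singleton z).preimage_circleMap 0 one_ne_zero
  filter_upwards [h.ae_notMem volume] with t ht using ht

/-- Near a point of an arc, difference quotients of a function holomorphic near the arc are
bounded, uniformly along the arc. -/
lemma HolArc.eventually_norm_sub_le {α β : ℝ} (hab : α ≤ β) {f : ℂ → ℂ} (hf : HolArc α β f)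
    {t₀ : ℝ} (ht₀ : t₀ ∈ Set.Icc α β) :
    ∃ C : ℝ, ∀ᶠ z in 𝓝 (pt t₀), ∀ t ∈ Set.Icc α β, ‖f (pt t) - f z‖ ≤ C * ‖pt t - z‖ := by
  obtain ⟨M, hM0, hM⟩ := hf.contArc.exists_bound hab
  obtain ⟨N, hN, hN1, hN2⟩ := hf
  have han : ContDiffAt ℂ 1 f (pt t₀) :=
    (hN2.analyticAt (hN.mem_nhds (hN1 t₀ ht₀))).contDiffAt
  obtain ⟨K, U, hU, hK⟩ := han.exists_lipschitzOnWith
  obtain ⟨r, hr, hrU⟩ := Metric.mem_nhds_iff.1 hU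
  have hM' : 0 ≤ M + (M + K * r) := by positivity
  refine ⟨max K ((M + (M + K * r)) * (2 / r)), ?_⟩
  filter_upwards [Metric.ball_mem_nhds (pt t₀) (half_pos hr)] with z hz t ht
  have hz' : ‖z - pt t₀‖ < r / 2 := by simpa [dist_eq_norm] using hz
  have hzr : z ∈ Metric.ball (pt t₀) r := Metric.ball_subset_ball (by linarith) hz
  have hlip : ∀ x ∈ Metric.ball (pt t₀) r, ‖f x - f z‖ ≤ K * ‖x - z‖ := fun x hx => by
    simpa [dist_eq_norm] using hK.dist_le_mul x (hrU hx) z (hrU hzr)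
  -- Points near `pt t₀` are covered by the local Lipschitz constant. For the others the denominator
  -- is at least `r / 2`, and it is enough that `M + (M + K * r)` bounds the numerator.
  by_cases hx : pt t ∈ Metric.ball (pt t₀) r
  · exact (hlip _ hx).trans (by gcongr; exact le_max_left _ _)
  · have h1 : r ≤ ‖pt t - pt t₀‖ := by simpa [dist_eq_norm] using hx
    have h2 : ‖pt t - pt t₀‖ ≤ ‖pt t - z‖ + ‖z - pt t₀‖ := by
      simpa using norm_add_le (pt t - z) (z - pt t₀)
    have h3 : r / 2 ≤ ‖pt t - z‖ := by linarith
    have h4 : ‖f z‖ ≤ M + K * r := by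
      have h5 := hlip _ (Metric.mem_ball_self hr)
      have h6 : ‖f z‖ ≤ ‖f (pt t₀)‖ + ‖f (pt t₀) - f z‖ := by
        simpa using norm_sub_le (f (pt t₀)) (f (pt t₀) - f z)
      have h7 : ‖pt t₀ - z‖ ≤ r := by rw [norm_sub_rev]; linarith
      have h8 : (K : ℝ) * ‖pt t₀ - z‖ ≤ K * r := by gcongr
      linarith [hM t₀ ht₀]
    calc ‖f (pt t) - f z‖ ≤ M + (M + K * r) := (norm_sub_le _ _).trans (add_le_add (hM t ht) h4)
      _ = ((M + (M + K * r)) * (2 / r)) * (r / 2) := by field_simp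
      _ ≤ _ := by
        gcongr
        exact le_max_right _ _

/-- This is the regular part of the Cauchy transform. Once `f z` is subtracted from the density, the
integrand is bounded uniformly in `z`, so dominated convergence gives continuity at every point of
the arc, end points included. -/
lemma tendsto_arcIntegral_quotient {α β : ℝ} (hab : α ≤ β) {f : ℂ → ℂ} (hf : HolArc α β f)
    {t₀ : ℝ} (ht₀ : t₀ ∈ Set.Icc α β) :
    Tendsto (fun z => arcIntegral α β (fun x => (f x - f z) / (x - z))) (𝓝 (pt t₀))
      (𝓝 (arcIntegral α β (fun x => (f x - f (pt t₀)) / (x - pt t₀)))) := by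
  obtain ⟨C, hC⟩ := hf.eventually_norm_sub_le hab ht₀
  have hcont : ContinuousAt f (pt t₀) := by
    obtain ⟨N, hN, hN1, hN2⟩ := hf
    exact (hN2.differentiableAt (hN.mem_nhds (hN1 t₀ ht₀))).continuousAt
  have hpi := Real.pi_gt_three
  refine intervalIntegral.tendsto_integral_filter_of_dominated_convergence (fun _ => max C 0)
    (Eventually.of_forall fun z => hf.contArc.aestronglyMeasurable_integrand hab _ _) ?_
    intervalIntegrable_const ?_
  · filter_upwards [hC] with z hz
    refine ae_of_all _ fun t ht => ?_
    rw [Set.uIoc_of_le hab] at ht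
    simp only [norm_mul, norm_div, norm_pt, norm_I, Complex.norm_real, Real.norm_eq_abs,
      abs_of_pos Real.pi_pos, Complex.norm_ofNat, mul_one]
    refine (div_le_self (by positivity) (by linarith)).trans ?_
    refine div_le_of_le_mul₀ (norm_nonneg _) (le_max_right _ _) ?_
    refine (hz t ⟨ht.1.le, ht.2⟩).trans ?_
    gcongr
    exact le_max_left _ _
  · filter_upwards [ae_pt_ne (pt t₀)] with t ht _
    have h1 : Tendsto (fun z => (f (pt t) - f z) / (pt t - z)) (𝓝 (pt t₀))
        (𝓝 ((f (pt t) - f (pt t₀)) / (pt t - pt t₀))) :=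
      (tendsto_const_nhds.sub hcont.tendsto).div (tendsto_const_nhds.sub tendsto_id)
        (sub_ne_zero.2 ht)
    exact (h1.mul_const _).div_const _

/-- Reduces the jump and the logarithmic bound to the density `1`: the first summand is continuous
across the arc, and the singular behaviour sits in the second. -/
lemma cauchyArc_eq_quotient_add {α β : ℝ} (hab : α ≤ β) {f : ℂ → ℂ} (hf : ContArc α β f) {z : ℂ}
    (hz : ∀ t ∈ Set.Icc α β, pt t ≠ z) :
    arcIntegral α β (fun x => f x / (x - z)) =
      arcIntegral α β (fun x => (f x - f z) / (x - z)) +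
        f z * arcIntegral α β (fun x => 1 / (x - z)) := by
  have h1 : ContArc α β (fun x => f x - f z) := ContinuousOn.sub hf continuousOn_const
  have h2 : ContArc α β (fun x => f z * (1 / (x - z))) :=
    (Continuous.contArc continuous_const).mul
      ((Continuous.contArc continuous_const).div_sub hz)
  rw [← arcIntegral_const_mul, ← arcIntegral_add hab (h1.div_sub hz) h2]
  refine arcIntegral_congr hab fun t ht => ?_
  have hne : pt t - z ≠ 0 := sub_ne_zero.2 (hz t ht)
  field_simp
  ring

lemma arcIntegral_full (α : ℝ) (f : ℂ → ℂ) :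
    arcIntegral α (α + 2 * Real.pi) f = (2 * Real.pi * I)⁻¹ * ∮ x in C(0, 1), f x := by
  have hper : Function.Periodic (fun t => f (pt t) * (pt t * I) / (2 * Real.pi * I))
      (2 * Real.pi) := fun t => by
    have : pt (t + 2 * Real.pi) = pt t := periodic_circleMap 0 1 t
    simp only [this]
  unfold arcIntegral
  rw [hper.intervalIntegral_add_eq α 0, zero_add, circleIntegral,
    ← intervalIntegral.integral_const_mul]
  congr 1; ext t
  simp only [deriv_circleMap, smul_eq_mul, pt]
  rw [circleMap_zero]
  ring

lemma arcIntegral_full_inside (α : ℝ) {z : ℂ} (hz : ‖z‖ < 1) :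
    arcIntegral α (α + 2 * Real.pi) (fun x => 1 / (x - z)) = 1 := by
  simp only [arcIntegral_full, one_div]
  rw [circleIntegral.integral_sub_inv_of_mem_ball (by simpa using hz),
    inv_mul_cancel₀ two_pi_I_ne_zero]

lemma arcIntegral_full_outside (α : ℝ) {z : ℂ} (hz : 1 < ‖z‖) :
    arcIntegral α (α + 2 * Real.pi) (fun x => 1 / (x - z)) = 0 := by
  have hne : ∀ x ∈ Metric.closedBall (0 : ℂ) 1, x - z ≠ 0 := by
    intro x hx
    rw [sub_ne_zero]
    rintro rfl
    simp at hx
    linarith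
  rw [arcIntegral_full, circleIntegral_eq_zero_of_differentiable_on_off_countable zero_le_one
    Set.countable_empty, mul_zero]
  · exact continuousOn_const.div (by fun_prop) hne
  · rintro x ⟨hx, -⟩
    exact (differentiableAt_const _).div (by fun_prop) (hne x (Metric.ball_subset_closedBall hx))

lemma arcIntegral_add_adjacent {α β γ : ℝ} (hab : α ≤ β) (hbc : β ≤ γ) {f : ℂ → ℂ}
    (h1 : ContArc α β f) (h2 : ContArc β γ f) :
    arcIntegral α β f + arcIntegral β γ f = arcIntegral α γ f :=
  intervalIntegral.integral_add_adjacent_intervals (h1.intervalIntegrable hab)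
    (h2.intervalIntegrable hbc)

/-- The jump of the Cauchy transform across an arc. -/
lemma cauchyArc_jump {α β : ℝ} (hβ : β ≤ α + 2 * Real.pi) {f : ℂ → ℂ} (hf : HolArc α β f)
    {t₀ : ℝ} (ht₀ : t₀ ∈ Set.Ioo α β) :
    ∃ L : ℂ, Tendsto (fun z => arcIntegral α β (fun x => f x / (x - z)))
        (𝓝[Metric.ball (0 : ℂ) 1] (pt t₀)) (𝓝 (L + f (pt t₀))) ∧
      Tendsto (fun z => arcIntegral α β (fun x => f x / (x - z)))
        (𝓝[(Metric.closedBall (0 : ℂ) 1)ᶜ] (pt t₀)) (𝓝 L) := by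
  have hab : α ≤ β := (ht₀.1.trans ht₀.2).le
  have ht₀' : t₀ ∈ Set.Icc α β := ⟨ht₀.1.le, ht₀.2.le⟩
  have hcont : ContinuousAt f (pt t₀) := by
    obtain ⟨N, hN, hN1, hN2⟩ := hf
    exact (hN2.differentiableAt (hN.mem_nhds (hN1 t₀ ht₀'))).continuousAt
  set D := fun z => arcIntegral α β (fun x => (f x - f z) / (x - z)) with hD
  -- The transform of `1` over the arc is that over the full circle, which is `1` inside and `0`
  -- outside, minus that over the complementary arc. The latter is continuous at `pt t₀`, an
  -- interior point of the original arc.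
  set J := fun z => arcIntegral β (α + 2 * Real.pi) (fun x => 1 / (x - z)) with hJ
  have hDt : Tendsto D (𝓝 (pt t₀)) (𝓝 (D (pt t₀))) := tendsto_arcIntegral_quotient hab hf ht₀'
  have hone : ∀ a b, ContArc a b (fun _ => (1 : ℂ)) := fun a b =>
    Continuous.contArc continuous_const
  have hJt : Tendsto J (𝓝 (pt t₀)) (𝓝 (J (pt t₀))) := by
    refine (differentiableAt_cauchyArc hβ (hone _ _) fun t ht he => ?_).continuousAt
    have := pt_inj (by rw [abs_lt]; constructor <;> linarith [ht.1, ht.2, ht₀.1, ht₀.2]) he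
    linarith [ht.1, ht₀.2]
  have hsplit : ∀ z ∈ offCircle, arcIntegral α β (fun x => f x / (x - z)) =
      D z + f z * (arcIntegral α (α + 2 * Real.pi) (fun x => 1 / (x - z)) - J z) := by
    intro z hz
    have hne : ∀ a b : ℝ, ∀ t ∈ Set.Icc a b, pt t ≠ z := fun _ _ t _ => pt_ne_of_mem_offCircle hz t
    rw [cauchyArc_eq_quotient_add hab hf.contArc (hne _ _), ← arcIntegral_add_adjacent hab hβ
      ((hone _ _).div_sub (hne _ _)) ((hone _ _).div_sub (hne _ _)), add_sub_cancel_right]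
  refine ⟨D (pt t₀) + f (pt t₀) * (0 - J (pt t₀)), ?_, ?_⟩
  · have h1 : Tendsto (fun z => D z + f z * (1 - J z)) (𝓝 (pt t₀))
        (𝓝 (D (pt t₀) + f (pt t₀) * (1 - J (pt t₀)))) :=
      hDt.add (hcont.tendsto.mul (tendsto_const_nhds.sub hJt))
    have h2 : D (pt t₀) + f (pt t₀) * (0 - J (pt t₀)) + f (pt t₀) =
      D (pt t₀) + f (pt t₀) * (1 - J (pt t₀)) := by ring
    rw [h2]
    refine (h1.mono_left nhdsWithin_le_nhds).congr' ?_
    filter_upwards [self_mem_nhdsWithin] with z hz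
    rw [hsplit z (ball_subset_offCircle hz), arcIntegral_full_inside α (by simpa using hz)]
  · have h1 : Tendsto (fun z => D z + f z * (0 - J z)) (𝓝 (pt t₀))
        (𝓝 (D (pt t₀) + f (pt t₀) * (0 - J (pt t₀)))) :=
      hDt.add (hcont.tendsto.mul (tendsto_const_nhds.sub hJt))
    refine (h1.mono_left nhdsWithin_le_nhds).congr' ?_
    filter_upwards [self_mem_nhdsWithin] with z hz
    rw [hsplit z (compl_closedBall_subset_offCircle hz),
      arcIntegral_full_outside α (by simpa using hz)]

/-! ### Logarithmic bounds for the Cauchy transform. -/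

lemma norm_log_le (w : ℂ) : ‖Complex.log w‖ ≤ |Real.log ‖w‖| + Real.pi := by
  refine (norm_le_abs_re_add_abs_im _).trans ?_
  rw [log_re, log_im]
  gcongr
  exact abs_arg_le_pi w

lemma norm_one_sub_div_pt (z : ℂ) (t : ℝ) : ‖1 - z / pt t‖ = ‖z - pt t‖ := by
  have h : 1 - z / pt t = (pt t - z) / pt t := by
    field_simp [pt_ne_zero t]
  rw [h, norm_div, norm_pt, div_one, norm_sub_rev]

/-- The Cauchy transform of the constant function, inside the circle. -/
lemma norm_cauchyArc_one_inside {α β : ℝ} (hab : α ≤ β) {z : ℂ} (hz : ‖z‖ < 1) :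
    ‖arcIntegral α β (fun x => 1 / (x - z))‖ ≤ (β - α) + (|Real.log ‖z - pt β‖| + Real.pi) +
      (|Real.log ‖z - pt α‖| + Real.pi) := by
  have hzo : z ∈ offCircle := hz.ne
  -- Inside the circle `|z / x| < 1`, so the principal logarithm of `1 - z / x` is smooth along the
  -- whole arc. The summand `t * I` plays the role of `log x`, so that together they form a branch
  -- of `log (x - z)`.
  have hd : ∀ t ∈ Set.uIcc α β, HasDerivAt (fun t : ℝ => (t * I + Complex.log (1 - z / pt t)) /
      (2 * Real.pi * I)) (1 / (pt t - z) * (pt t * I) / (2 * Real.pi * I)) t := by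
    intro t _
    have hne : pt t - z ≠ 0 := sub_ne_zero.2 (pt_ne_of_mem_offCircle hzo t)
    have hp := pt_ne_zero t
    have h1 : HasDerivAt (fun t : ℝ => 1 - z / pt t) (z * I / pt t) t := by
      have := ((hasDerivAt_const t z).div (hasDerivAt_pt t) hp).const_sub 1
      refine this.congr_deriv ?_
      field_simp; ring
    have hs : 1 - z / pt t ∈ slitPlane := by
      rw [sub_eq_add_neg]
      refine mem_slitPlane_of_norm_lt_one ?_
      rw [norm_neg, norm_div, norm_pt, div_one]; exact hz
    have h2 := h1.clog_real hs
    have h3 : HasDerivAt (fun t : ℝ => (t : ℂ) * I) I t := by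
      simpa using (Complex.ofRealCLM.hasDerivAt (x := t)).mul_const I
    refine ((h3.add h2).div_const _).congr_deriv ?_
    have h4 : 1 - z / pt t ≠ 0 := slitPlane_ne_zero hs
    congr 1
    have h5 : 1 - z / pt t = (pt t - z) / pt t := by field_simp
    rw [h5]
    field_simp
    ring
  have hone : ContArc α β (fun _ => (1 : ℂ)) := Continuous.contArc continuous_const
  have hint := (hone.div_sub fun t _ => pt_ne_of_mem_offCircle hzo t).intervalIntegrable hab
  have hI := intervalIntegral.integral_eq_sub_of_hasDerivAt hd hint
  rw [arcIntegral, hI, ← sub_div, norm_div]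
  have hpi := Real.pi_gt_three
  refine (div_le_self (norm_nonneg _) ?_).trans ?_
  · simp only [norm_mul, norm_I, Complex.norm_real, Real.norm_eq_abs,
      abs_of_pos Real.pi_pos, Complex.norm_ofNat, mul_one]
    linarith
  · have h1 := norm_log_le (1 - z / pt β)
    have h2 := norm_log_le (1 - z / pt α)
    rw [norm_one_sub_div_pt] at h1 h2
    have h3 : ‖((β - α : ℝ) : ℂ) * I‖ = β - α := by
      rw [norm_mul, norm_I, mul_one, Complex.norm_real, Real.norm_of_nonneg (by linarith)]
    calc _ = ‖((β - α : ℝ) : ℂ) * I + Complex.log (1 - z / pt β) - Complex.log (1 - z / pt α)‖ := by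
          congr 1; push_cast; ring
      _ ≤ _ := by
          refine (norm_sub_le _ _).trans (add_le_add ((norm_add_le _ _).trans ?_) h2)
          rw [h3]
          gcongr

/-- The Cauchy transform of the constant function, outside the circle. -/
lemma norm_cauchyArc_one_outside {α β : ℝ} (hab : α ≤ β) {z : ℂ} (hz : 1 < ‖z‖) :
    ‖arcIntegral α β (fun x => 1 / (x - z))‖ ≤
      (|Real.log ‖z - pt β‖| + |Real.log ‖z‖| + Real.pi) +
      (|Real.log ‖z - pt α‖| + |Real.log ‖z‖| + Real.pi) := by
  have hzo : z ∈ offCircle := hz.ne'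
  have hz0 : z ≠ 0 := norm_pos_iff.1 (by linarith)
  -- Outside the circle it is `x / z` that has modulus below `1`; the missing constant `log (-z)` is
  -- irrelevant for an antiderivative.
  have hd : ∀ t ∈ Set.uIcc α β, HasDerivAt (fun t : ℝ => Complex.log (1 - pt t / z) /
      (2 * Real.pi * I)) (1 / (pt t - z) * (pt t * I) / (2 * Real.pi * I)) t := by
    intro t _
    have hne : pt t - z ≠ 0 := sub_ne_zero.2 (pt_ne_of_mem_offCircle hzo t)
    have h1 : HasDerivAt (fun t : ℝ => 1 - pt t / z) (-(pt t * I / z)) t :=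
      ((hasDerivAt_pt t).div_const z).const_sub 1
    have hs : 1 - pt t / z ∈ slitPlane := by
      rw [sub_eq_add_neg]
      refine mem_slitPlane_of_norm_lt_one ?_
      rw [norm_neg, norm_div, norm_pt, div_lt_one (by linarith)]; exact hz
    refine ((h1.clog_real hs).div_const _).congr_deriv ?_
    congr 1
    have h4 : 1 - pt t / z ≠ 0 := slitPlane_ne_zero hs
    have h5 : 1 - pt t / z = -(pt t - z) / z := by field_simp; ring
    rw [h5]
    field_simp
  have hone : ContArc α β (fun _ => (1 : ℂ)) := Continuous.contArc continuous_const
  have hint := (hone.div_sub fun t _ => pt_ne_of_mem_offCircle hzo t).intervalIntegrable hab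
  have hI := intervalIntegral.integral_eq_sub_of_hasDerivAt hd hint
  rw [arcIntegral, hI, ← sub_div, norm_div]
  have hpi := Real.pi_gt_three
  refine (div_le_self (norm_nonneg _) ?_).trans ?_
  · simp only [norm_mul, norm_I, Complex.norm_real, Real.norm_eq_abs,
      abs_of_pos Real.pi_pos, Complex.norm_ofNat, mul_one]
    linarith
  · have key : ∀ t, ‖Complex.log (1 - pt t / z)‖ ≤
        |Real.log ‖z - pt t‖| + |Real.log ‖z‖| + Real.pi := by
      intro t
      refine (norm_log_le _).trans ?_
      have h5 : 1 - pt t / z = (z - pt t) / z := by field_simp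
      rw [h5, norm_div, Real.log_div]
      · gcongr
        exact abs_sub _ _
      · exact norm_ne_zero_iff.2 (sub_ne_zero.2 (pt_ne_of_mem_offCircle hzo t).symm)
      · exact norm_ne_zero_iff.2 hz0
    exact (norm_sub_le _ _).trans (add_le_add (key _) (key _))

/-- The logarithm tends to `-∞` in modulus of the argument tending to `0`, and `z = z₀` is excluded
off the circle. Bounded terms are thus absorbed by the logarithmic growth condition. -/
lemma one_isBigO_log {V : Type*} [NormedAddCommGroup V] {z₀ : ℂ} (hz₀ : ‖z₀‖ = 1) (c : V) :
    (fun _ : ℂ => c) =O[𝓝[offCircle] z₀] (fun z => Real.log ‖z - z₀‖) := by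
  have h1 : Tendsto (fun z => ‖z - z₀‖) (𝓝[offCircle] z₀) (𝓝[≠] 0) := by
    refine tendsto_nhdsWithin_iff.2 ⟨?_, ?_⟩
    · have : Continuous fun z => ‖z - z₀‖ := by fun_prop
      simpa using (this.tendsto z₀).mono_left nhdsWithin_le_nhds
    · filter_upwards [self_mem_nhdsWithin] with z hz
      simp only [Set.mem_compl_iff, Set.mem_singleton_iff, norm_eq_zero, sub_eq_zero]
      rintro rfl
      exact hz hz₀
  have h2 := Real.tendsto_log_nhdsNE_zero.comp h1
  exact (Asymptotics.isLittleO_const_left.2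
    (Or.inr (tendsto_abs_atBot_atTop.comp h2))).isBigO

/-- Here `a` is an end point of an arc, which may or may not be the point `z₀` under study; both
cases obey the same bound. -/
lemma log_isBigO_log {z₀ a : ℂ} (hz₀ : ‖z₀‖ = 1) :
    (fun z => Real.log ‖z - a‖) =O[𝓝[offCircle] z₀] (fun z => Real.log ‖z - z₀‖) := by
  by_cases h : z₀ = a
  · rw [h]
  · have h1 : ContinuousAt (fun z => Real.log ‖z - a‖) z₀ := by
      refine ContinuousAt.log (by fun_prop) ?_
      exact norm_ne_zero_iff.2 (sub_ne_zero.2 h)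
    exact ((h1.tendsto.mono_left nhdsWithin_le_nhds).isBigO_one ℂ).trans (one_isBigO_log hz₀ (1 : ℂ))

/-- The Cauchy transform has at most logarithmic singularities on the circle. -/
lemma cauchyArc_isBigO_log {α β : ℝ} (hab : α ≤ β) {f : ℂ → ℂ} (hf : HolArc α β f)
    {z₀ : ℂ} (hz₀ : ‖z₀‖ = 1) :
    (fun z => arcIntegral α β (fun x => f x / (x - z))) =O[𝓝[offCircle] z₀]
      (fun z => Real.log ‖z - z₀‖) := by
  by_cases h : ∀ t ∈ Set.Icc α β, pt t ≠ z₀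
  · have h1 := (differentiableAt_cauchyArc hab hf.contArc h).continuousAt
    exact ((h1.tendsto.mono_left nhdsWithin_le_nhds).isBigO_one ℂ).trans (one_isBigO_log hz₀ (1 : ℂ))
  push Not at h
  obtain ⟨t₀, ht₀, rfl⟩ := h
  have hcont : ContinuousAt f (pt t₀) := by
    obtain ⟨N, hN, hN1, hN2⟩ := hf
    exact (hN2.differentiableAt (hN.mem_nhds (hN1 t₀ ht₀))).continuousAt
  have h1 := (((tendsto_arcIntegral_quotient hab hf ht₀).mono_left
    nhdsWithin_le_nhds).isBigO_one ℂ).trans (one_isBigO_log hz₀ (1 : ℂ))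
  have h2 : (fun z => arcIntegral α β (fun x => 1 / (x - z))) =O[𝓝[offCircle] (pt t₀)]
      (fun z => Real.log ‖z - pt t₀‖) := by
    -- A common majorant for both sides of the circle: `β - α` comes from the inside estimate, `2 *
    -- |Real.log ‖z‖|` from the outside one.
    have hB : (fun z => ((β - α) + Real.pi + Real.pi) + |Real.log ‖z - pt β‖| +
        |Real.log ‖z - pt α‖| + 2 * |Real.log ‖z‖|) =O[𝓝[offCircle] (pt t₀)]
        (fun z => Real.log ‖z - pt t₀‖) := by
      have hl0 := log_isBigO_log hz₀ (a := 0)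
      simp only [sub_zero] at hl0
      refine (((?_ : _ =O[_] _).add ?_).add ?_).add ?_
      · exact one_isBigO_log hz₀ (β - α + Real.pi + Real.pi)
      · exact (log_isBigO_log hz₀).norm_left
      · exact (log_isBigO_log hz₀).norm_left
      · exact hl0.norm_left.const_mul_left 2
    refine (Asymptotics.IsBigO.of_bound 1 ?_).trans hB
    filter_upwards [self_mem_nhdsWithin] with z hz
    rw [one_mul, Real.norm_eq_abs]
    refine le_trans ?_ (le_abs_self _)
    rcases lt_or_gt_of_ne hz with h | h
    · have := norm_cauchyArc_one_inside hab h
      have := abs_nonneg (Real.log ‖z‖)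
      linarith
    · have := norm_cauchyArc_one_outside hab h
      linarith
  have h3 : f =O[𝓝[offCircle] (pt t₀)] (fun _ => (1 : ℝ)) :=
    (hcont.tendsto.mono_left nhdsWithin_le_nhds).isBigO_one ℝ
  have h4 := h3.mul h2
  simp only [one_mul] at h4
  refine (h1.add h4).congr' ?_ EventuallyEq.rfl
  filter_upwards [self_mem_nhdsWithin] with z hz
  exact (cauchyArc_eq_quotient_add hab hf.contArc fun t _ => pt_ne_of_mem_offCircle hz t).symm

/-! ### Cauchy transforms of piecewise holomorphic weights. -/

lemma cauchy_eq_sum {m : ℕ} (θ : Fin (m + 1) → ℝ) (w : Fin (m + 1) → ℂ → ℂ) :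
    cauchy θ w = fun z =>
      ∑ j, arcIntegral (θ j) (nextAngle θ j) (fun x => w j x / (x - z)) := rfl

/-- The angles are those of consecutive separating points, and each `w j` is holomorphic near the
closed `j`-th arc. -/
structure PiecewiseHol {m : ℕ} (θ : Fin (m + 1) → ℝ) (w : Fin (m + 1) → ℂ → ℂ) : Prop where
  strictMono : StrictMono θ
  lt : θ (Fin.last m) < θ 0 + 2 * Real.pi
  hol : ∀ j, HolArc (θ j) (nextAngle θ j) (w j)

namespace PiecewiseHol

variable {m : ℕ} {θ : Fin (m + 1) → ℝ} {w : Fin (m + 1) → ℂ → ℂ}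

lemma lt_nextAngle (h : PiecewiseHol θ w) (j : Fin (m + 1)) : θ j < nextAngle θ j := by
  unfold nextAngle
  split_ifs with hj
  · exact h.strictMono (by simp [Fin.lt_def])
  · exact (h.strictMono.monotone (Fin.le_last j)).trans_lt h.lt

lemma nextAngle_le (h : PiecewiseHol θ w) (j : Fin (m + 1)) :
    nextAngle θ j ≤ θ 0 + 2 * Real.pi := by
  unfold nextAngle
  split_ifs with hj
  · exact ((h.strictMono.monotone (Fin.le_last _)).trans_lt h.lt).le
  · exact le_rfl

lemma zero_le (h : PiecewiseHol θ w) (j : Fin (m + 1)) : θ 0 ≤ θ j :=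
  h.strictMono.monotone (Fin.zero_le j)

lemma nextAngle_le_add (h : PiecewiseHol θ w) (j : Fin (m + 1)) :
    nextAngle θ j ≤ θ j + 2 * Real.pi :=
  (h.nextAngle_le j).trans (by linarith [h.zero_le j])

lemma nextAngle_le_of_lt (h : PiecewiseHol θ w) {j k : Fin (m + 1)} (hjk : j < k) :
    nextAngle θ j ≤ θ k := by
  unfold nextAngle
  have hlt : j.val < k.val := hjk
  rw [dif_pos (by omega)]
  exact h.strictMono.monotone (Fin.mk_le_of_le_val (by omega))

/-- All angles lie in `[θ 0, θ 0 + 2π]` and `t₀` is in the interior of its arc, so the angles differ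
by less than `2π`; equal points would force equal angles, against the ordering of the arcs. -/
lemma pt_ne_of_ne (h : PiecewiseHol θ w) {j k : Fin (m + 1)} (hjk : k ≠ j) {t₀ t : ℝ}
    (ht₀ : t₀ ∈ Set.Ioo (θ j) (nextAngle θ j)) (ht : t ∈ Set.Icc (θ k) (nextAngle θ k)) :
    pt t ≠ pt t₀ := by
  intro he
  have h1 := h.zero_le j
  have h2 := h.zero_le k
  have h3 := h.nextAngle_le j
  have h4 := h.nextAngle_le k
  have h5 := pt_inj (by rw [abs_lt]; constructor <;> linarith [ht.1, ht.2, ht₀.1, ht₀.2]) he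
  subst h5
  rcases lt_or_gt_of_ne hjk with hlt | hlt
  · linarith [h.nextAngle_le_of_lt hlt, ht.2, ht₀.1]
  · linarith [h.nextAngle_le_of_lt hlt, ht.1, ht₀.2]

/-- The arcs cover the circle. -/
lemma _root_.ToeplitzRHP.exists_arc {m : ℕ} (θ : Fin (m + 1) → ℝ) {z : ℂ} (hz : ‖z‖ = 1) :
    (∃ j, z = pt (θ j)) ∨ ∃ j, ∃ t ∈ Set.Ioo (θ j) (nextAngle θ j), z = pt t := by
  obtain ⟨t, ht, rfl⟩ : ∃ t ∈ Set.Ico (θ 0) (θ 0 + 2 * Real.pi), z = pt t := by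
    refine ⟨toIcoMod Real.two_pi_pos (θ 0) (arg z), toIcoMod_mem_Ico _ _ _, ?_⟩
    have hper : Function.Periodic pt (2 * Real.pi) := periodic_circleMap 0 1
    rw [← self_sub_toIcoDiv_zsmul, hper.sub_zsmul_eq]
    have := norm_mul_exp_arg_mul_I z
    rw [hz] at this
    simpa [pt, circleMap] using this.symm
  have hne : (Finset.univ.filter fun j => θ j ≤ t).Nonempty := ⟨0, by simpa using ht.1⟩
  set j := Finset.max' _ hne with hj
  have hjt : θ j ≤ t := by
    have := Finset.max'_mem _ hne
    simpa using this
  have hnext : t < nextAngle θ j := by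
    unfold nextAngle
    split_ifs with h1
    · by_contra! h2
      have := Finset.le_max' (Finset.univ.filter fun j => θ j ≤ t) ⟨j.val + 1, h1⟩ (by simpa using h2)
      rw [← hj, Fin.le_def] at this
      simp at this
    · exact ht.2
  rcases hjt.eq_or_lt with h1 | h1
  · exact Or.inl ⟨j, by rw [h1]⟩
  · exact Or.inr ⟨j, t, ⟨h1, hnext⟩, rfl⟩

lemma le_nextAngle (h : PiecewiseHol θ w) (j : Fin (m + 1)) : θ j ≤ nextAngle θ j :=
  (h.lt_nextAngle j).le

lemma contArc (h : PiecewiseHol θ w) (j : Fin (m + 1)) : ContArc (θ j) (nextAngle θ j) (w j) :=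
  (h.hol j).contArc

lemma mul (h : PiecewiseHol θ w) {f : ℂ → ℂ} (hf : Differentiable ℂ f) :
    PiecewiseHol θ (fun j x => f x * w j x) :=
  ⟨h.strictMono, h.lt, fun j => (Differentiable.holArc hf).mul (h.hol j)⟩

lemma cauchy_differentiableOn (h : PiecewiseHol θ w) :
    DifferentiableOn ℂ (cauchy θ w) offCircle := by
  intro z hz
  refine DifferentiableAt.differentiableWithinAt ?_
  rw [cauchy_eq_sum]
  exact DifferentiableAt.fun_sum fun j _ =>
    differentiableAt_cauchyArc (h.le_nextAngle j) (h.contArc j)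
      fun t _ => pt_ne_of_mem_offCircle hz t

lemma cauchy_jump (h : PiecewiseHol θ w) {j : Fin (m + 1)} {t₀ : ℝ}
    (ht₀ : t₀ ∈ Set.Ioo (θ j) (nextAngle θ j)) :
    ∃ L : ℂ, Tendsto (cauchy θ w) (𝓝[Metric.ball (0 : ℂ) 1] (pt t₀)) (𝓝 (L + w j (pt t₀))) ∧
      Tendsto (cauchy θ w) (𝓝[(Metric.closedBall (0 : ℂ) 1)ᶜ] (pt t₀)) (𝓝 L) := by
  obtain ⟨L, h1, h2⟩ := cauchyArc_jump (h.nextAngle_le_add j) (h.hol j) ht₀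
  set R : ℂ → ℂ := fun z => ∑ k ∈ Finset.univ.erase j,
    arcIntegral (θ k) (nextAngle θ k) (fun x => w k x / (x - z)) with hR
  have hRc : Tendsto R (𝓝 (pt t₀)) (𝓝 (R (pt t₀))) := by
    refine tendsto_finsetSum _ fun k hk => ?_
    exact (differentiableAt_cauchyArc (h.le_nextAngle k) (h.contArc k)
      fun t ht => h.pt_ne_of_ne (Finset.ne_of_mem_erase hk) ht₀ ht).continuousAt
  have hsplit : cauchy θ w =
      fun z => arcIntegral (θ j) (nextAngle θ j) (fun x => w j x / (x - z)) + R z := by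
    ext z
    exact (Finset.add_sum_erase _ _ (Finset.mem_univ j)).symm
  refine ⟨L + R (pt t₀), ?_, ?_⟩
  · rw [hsplit, add_right_comm]
    exact h1.add (hRc.mono_left nhdsWithin_le_nhds)
  · rw [hsplit]
    exact h2.add (hRc.mono_left nhdsWithin_le_nhds)

lemma cauchy_isBigO_log (h : PiecewiseHol θ w) {z₀ : ℂ} (hz₀ : ‖z₀‖ = 1) :
    cauchy θ w =O[𝓝[offCircle] z₀] (fun z => Real.log ‖z - z₀‖) := by
  rw [cauchy_eq_sum]
  exact Asymptotics.IsBigO.fun_sum fun j _ => cauchyArc_isBigO_log (h.le_nextAngle j) (h.hol j) hz₀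

lemma cauchy_isBigO_inv (h : PiecewiseHol θ w) :
    cauchy θ w =O[Bornology.cobounded ℂ] (fun z : ℂ => z⁻¹) := by
  rw [cauchy_eq_sum]
  exact Asymptotics.IsBigO.fun_sum fun j _ => cauchyArc_isBigO_inv (h.le_nextAngle j) (h.contArc j)

lemma pow_mul_cauchy (h : PiecewiseHol θ w) (N : ℕ) {z : ℂ} (hz : z ∈ offCircle) :
    z ^ N * cauchy θ w z = cauchy θ (fun j x => x ^ N * w j x) z -
      ∑ i ∈ Finset.range N, z ^ i * arcInt θ (fun j x => x ^ (N - 1 - i) * w j x) := by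
  simp only [cauchy_eq_sum, arcInt_eq_sum, Finset.mul_sum]
  rw [Finset.sum_comm, ← Finset.sum_sub_distrib]
  refine Finset.sum_congr rfl fun j _ => ?_
  exact pow_mul_cauchyArc (h.le_nextAngle j) N (h.contArc j)
    fun t _ => pt_ne_of_mem_offCircle hz t

/-- The functional `f ↦ ∮ f(x) w(x) dx / (2πi)` on polynomials. -/
def functional (h : PiecewiseHol θ w) : Polynomial ℂ →ₗ[ℂ] ℂ where
  toFun f := arcInt θ (fun j x => f.eval x * w j x)
  map_add' f g := by
    simp only [arcInt_eq_sum, ← Finset.sum_add_distrib]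
    refine Finset.sum_congr rfl fun j _ => ?_
    rw [← arcIntegral_add (h.le_nextAngle j)
      ((Continuous.contArc f.continuous).mul (h.contArc j))
      ((Continuous.contArc g.continuous).mul (h.contArc j))]
    simp only [Polynomial.eval_add, add_mul]
  map_smul' c f := by
    simp only [arcInt_eq_sum, Polynomial.eval_smul, smul_eq_mul, RingHom.id_apply,
      Finset.mul_sum, ← arcIntegral_const_mul, mul_assoc]

lemma functional_apply (h : PiecewiseHol θ w) (f : Polynomial ℂ) :
    h.functional f = arcInt θ (fun j x => f.eval x * w j x) := rfl

end PiecewiseHol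

end ToeplitzRHP

/-! ### Algebra of orthogonal polynomials: Bezoutian and inverse moment matrix. -/

namespace ToeplitzRHP

open Polynomial in
/-- `p` is monic of degree `n`, `q` has degree less than `n`, `p` is orthogonal to all polynomials
of degree less than `n` and `q` represents the coefficient of degree `n - 1`. -/
structure IsOrthPair (M : ℂ[X] →ₗ[ℂ] ℂ) (n : ℕ) (p q : ℂ[X]) : Prop where
  degree_sub_lt : (p - X ^ n).degree < (n : WithBot ℕ)
  degree_lt : q.degree < (n : WithBot ℕ)
  orth_left : ∀ k < n, M (X ^ k * p) = 0
  orth_right : ∀ k < n, M (X ^ k * q) = if k + 1 = n then 1 else 0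

/-- The Toeplitz matrix of a functional on polynomials (the Hankel matrix with the rows in reverse
order). -/
def momentMatrix (M : Polynomial ℂ →ₗ[ℂ] ℂ) (n : ℕ) : Matrix (Fin n) (Fin n) ℂ :=
  Matrix.of fun i j => M (Polynomial.X ^ ((j : ℕ) + (n - 1 - i)))

/-- The coefficients of the reproducing kernel of a functional on polynomials. -/
def kernelMatrix (M : Polynomial ℂ →ₗ[ℂ] ℂ) (n : ℕ) : Matrix (Fin n) (Fin n) ℂ :=
  Matrix.of fun j k => (momentMatrix M n)⁻¹ k j.rev

lemma kernelMatrix_apply (M : Polynomial ℂ →ₗ[ℂ] ℂ) {n : ℕ} (j k : Fin n) :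
    kernelMatrix M n j k = (momentMatrix M n)⁻¹ k j.rev := rfl

open Polynomial

lemma eq_sum_fin_of_degree_lt {n : ℕ} {f : ℂ[X]} (hf : f.degree < n) :
    f = ∑ k : Fin n, C (f.coeff k) * X ^ (k : ℕ) := by
  rw [Fin.sum_univ_eq_sum_range (fun k => C (f.coeff k) * X ^ k)]
  ext i
  simp only [finsetSum_coeff, coeff_C_mul, coeff_X_pow, mul_ite, mul_one, mul_zero,
    Finset.sum_ite_eq, Finset.mem_range]
  split_ifs with h
  · rfl
  · exact coeff_eq_zero_of_degree_lt (hf.trans_le (by exact_mod_cast not_lt.1 h))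

/-- Translates linear algebra into pairings: applying the matrix to coefficients lists the values of
`M` on `X ^ k * f`, with `k` descending from `n - 1` to `0`. -/
lemma momentMatrix_mulVec {n : ℕ} (M : ℂ[X] →ₗ[ℂ] ℂ) {f : ℂ[X]} (hf : f.degree < n) (i : Fin n) :
    (momentMatrix M n).mulVec (fun k => f.coeff k) i = M (X ^ (n - 1 - (i : ℕ)) * f) := by
  conv_rhs => rw [eq_sum_fin_of_degree_lt hf]
  rw [Finset.mul_sum, map_sum, Matrix.mulVec, dotProduct]
  refine Finset.sum_congr rfl fun k _ => ?_
  rw [momentMatrix, Matrix.of_apply]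
  have : (X ^ (n - 1 - (i : ℕ)) * (C (f.coeff k) * X ^ (k : ℕ)) : ℂ[X]) =
      f.coeff k • X ^ ((k : ℕ) + (n - 1 - i)) := by
    rw [smul_eq_C_mul, pow_add]; ring
  rw [this, map_smul, smul_eq_mul, mul_comm]

namespace IsOrthPair

variable {M : ℂ[X] →ₗ[ℂ] ℂ} {n : ℕ} {p q : ℂ[X]}

lemma map_mul_left (h : IsOrthPair M n p q) {f : ℂ[X]} (hf : f.degree < n) : M (f * p) = 0 := by
  rw [eq_sum_fin_of_degree_lt hf, Finset.sum_mul, map_sum]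
  refine Finset.sum_eq_zero fun k _ => ?_
  rw [← smul_eq_C_mul, smul_mul_assoc, map_smul, h.orth_left k k.isLt, smul_zero]

lemma map_mul_right (h : IsOrthPair M n p q) {f : ℂ[X]} (hf : f.degree < n) :
    M (f * q) = if n = 0 then 0 else f.coeff (n - 1) := by
  conv_lhs => rw [eq_sum_fin_of_degree_lt hf]
  rw [Finset.sum_mul, map_sum]
  have h1 : ∀ k : Fin n, M (C (f.coeff k) * X ^ (k : ℕ) * q) =
      if (k : ℕ) + 1 = n then f.coeff k else 0 := by
    intro k
    rw [← smul_eq_C_mul, smul_mul_assoc, map_smul, h.orth_right k k.2]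
    simp
  simp only [h1]
  split_ifs with hn
  · subst hn; simp
  · rw [Finset.sum_eq_single ⟨n - 1, by omega⟩]
    · rw [if_pos (by simp only; omega)]
    · intro k _ hk
      rw [if_neg]
      intro h2
      exact hk (Fin.ext (by simp only; omega))
    · simp

lemma _root_.ToeplitzRHP.degree_C_mul_le' (c : ℂ) (f : ℂ[X]) : (C c * f).degree ≤ f.degree := by
  rw [← smul_eq_C_mul]; exact degree_smul_le c f

/-- Divided differences. -/
lemma _root_.ToeplitzRHP.exists_divided_difference (f : ℂ[X]) (z : ℂ) :
    ∃ g : ℂ[X], (X - C z) * g = f - C (f.eval z) ∧ g = f /ₘ (X - C z) :=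
  ⟨f /ₘ (X - C z), by
    have := modByMonic_add_div f (X - C z)
    rw [modByMonic_X_sub_C_eq_C_eval] at this
    rw [eq_sub_iff_add_eq, add_comm]; exact this, rfl⟩

lemma _root_.ToeplitzRHP.degree_divided_difference_lt {f : ℂ[X]} {n : ℕ}
    (hf : f.degree ≤ n) (z : ℂ) :
    (f /ₘ (X - C z)).degree < n := by
  by_cases h0 : f = 0
  · rw [h0, zero_divByMonic, degree_zero]
    exact WithBot.bot_lt_coe _
  by_cases h1 : f.degree ≤ 0
  · rw [eq_C_of_degree_le_zero h1]
    rw [(divByMonic_eq_zero_iff (monic_X_sub_C z)).2 ?_, degree_zero]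
    · exact WithBot.bot_lt_coe _
    · rw [degree_X_sub_C]
      exact degree_C_le.trans_lt (by norm_num)
  · exact (degree_divByMonic_lt _ _ h0 (by rw [degree_X_sub_C]; norm_num)).trans_le hf

lemma monic (h : IsOrthPair M n p q) : p.Monic ∧ p.natDegree = n := by
  have h1 : p = X ^ n + (p - X ^ n) := by ring
  have h2 : (p - X ^ n).degree < ((X : ℂ[X]) ^ n).degree := by
    rw [degree_X_pow]; exact h.degree_sub_lt
  constructor
  · rw [h1]
    exact (monic_X_pow n).add_of_left h2
  · rw [h1, natDegree_add_eq_left_of_degree_lt h2, natDegree_X_pow]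

/-- The Bezoutian of `p` and `q` is the reproducing kernel. -/
lemma exists_bezoutian (h : IsOrthPair M n p q) (z : ℂ) :
    ∃ B : ℂ[X], (X - C z) * B = C (q.eval z) * p - C (p.eval z) * q ∧ B.degree < n ∧
      ∀ k < n, M (X ^ k * B) = z ^ k := by
  rcases Nat.eq_zero_or_pos n with rfl | hn
  · refine ⟨0, ?_, by simp, by simp⟩
    have hq : q = 0 := by
      rw [← degree_eq_bot]
      exact Nat.WithBot.lt_zero_iff.1 (by simpa using h.degree_lt)
    simp [hq]
  obtain ⟨p₁, hp, hp'⟩ := exists_divided_difference p z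
  obtain ⟨q₁, hq, hq'⟩ := exists_divided_difference q z
  have hX : (X - C z : ℂ[X]) ≠ 0 := X_sub_C_ne_zero z
  -- Two forms of the Bezoutian. The left one shows the degree; on the right one `M` can be
  -- evaluated: `q₁ * p` is killed and `p₁ * q` contributes the leading coefficient of `p₁`, which
  -- is `1`.
  have hB : C (q.eval z) * p₁ - C (p.eval z) * q₁ = p₁ * q - q₁ * p := by
    apply mul_left_cancel₀ hX
    linear_combination (C (q.eval z) - q) * hp + (p - C (p.eval z)) * hq
  have hpd : p₁.degree < n := hp' ▸ degree_divided_difference_lt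
    (by rw [degree_eq_natDegree h.monic.1.ne_zero, h.monic.2]) z
  have hqd : q₁.degree < n := hq' ▸ degree_divided_difference_lt h.degree_lt.le z
  have hdeg : (C (q.eval z) * p₁ - C (p.eval z) * q₁).degree < n :=
    (degree_sub_le _ _).trans_lt (max_lt
      ((degree_C_mul_le' _ _).trans_lt hpd) ((degree_C_mul_le' _ _).trans_lt hqd))
  have hXB : (X - C z) * (C (q.eval z) * p₁ - C (p.eval z) * q₁) =
      C (q.eval z) * p - C (p.eval z) * q := by
    linear_combination C (q.eval z) * hp - C (p.eval z) * hq
  refine ⟨C (q.eval z) * p₁ - C (p.eval z) * q₁, hXB, hdeg, ?_⟩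
  have hone : M (C (q.eval z) * p₁ - C (p.eval z) * q₁) = 1 := by
    rw [hB, map_sub, h.map_mul_left hqd, h.map_mul_right hpd, if_neg hn.ne', sub_zero]
    have h1 : p₁.leadingCoeff = 1 := by
      rw [hp', leadingCoeff_divByMonic_X_sub_C]
      · exact h.monic.1
      · rw [degree_eq_natDegree h.monic.1.ne_zero, h.monic.2]
        exact_mod_cast hn.ne'
    have h2 : p₁.natDegree = n - 1 := by
      rw [hp', natDegree_divByMonic _ (monic_X_sub_C z), h.monic.2, natDegree_X_sub_C]
    rw [← h2]; exact h1
  intro k hk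
  -- With `X ^ k = z ^ k + (X - z) g`, the correction is `g` times a combination of `p` and `q`.
  -- Since `g` has no coefficient in degree `n - 1`, `M` annihilates it.
  obtain ⟨g, hg, hg'⟩ := exists_divided_difference (X ^ k : ℂ[X]) z
  have hgd : g.degree < n ∧ g.coeff (n - 1) = 0 := by
    rcases Nat.eq_zero_or_pos k with rfl | hk0
    · have : g = 0 := by
        apply mul_left_cancel₀ hX
        rw [hg]; simp
      rw [this]
      exact ⟨by simp, by simp⟩
    · have : g.degree < k := hg' ▸ degree_divided_difference_lt (degree_X_pow_le k) z
      exact ⟨this.trans (by exact_mod_cast hk), coeff_eq_zero_of_degree_lt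
        (this.trans_le (by exact_mod_cast (by omega : k ≤ n - 1)))⟩
  have hsplit : X ^ k * (C (q.eval z) * p₁ - C (p.eval z) * q₁) =
      z ^ k • (C (q.eval z) * p₁ - C (p.eval z) * q₁) +
        (q.eval z • (g * p) - p.eval z • (g * q)) := by
    simp only [smul_eq_C_mul]
    have h3 : (X ^ k : ℂ[X]) = C (z ^ k) + (X - C z) * g := by
      rw [hg]; simp
    linear_combination (C (q.eval z) * p₁ - C (p.eval z) * q₁) * h3 + g * hXB
  rw [hsplit, map_add, map_sub, map_smul, map_smul, map_smul, hone, h.map_mul_left hgd.1,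
    h.map_mul_right hgd.1, hgd.2]
  simp [smul_eq_mul]

/-- A left null vector `v`, paired with the image of the coefficients of `B_z`, gives `∑ v_i z ^ (n
- 1 - i) = 0` for every `z` by the reproducing property; a polynomial vanishing identically has zero
coefficients. -/
lemma det_ne_zero (h : IsOrthPair M n p q) : (momentMatrix M n).det ≠ 0 := by
  intro h0
  obtain ⟨v, hv, hv0⟩ := Matrix.exists_vecMul_eq_zero_iff.2 h0
  apply hv
  have hsum : (∑ i : Fin n, C (v i) * X ^ (n - 1 - (i : ℕ)) : ℂ[X]) = 0 := by
    refine Polynomial.funext fun z => ?_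
    obtain ⟨B, -, hBd, hB⟩ := h.exists_bezoutian z
    have h1 := Matrix.dotProduct_mulVec v (momentMatrix M n) (fun k => B.coeff k)
    rw [hv0, zero_dotProduct] at h1
    rw [eval_finsetSum, eval_zero, ← h1, dotProduct]
    refine Finset.sum_congr rfl fun i _ => ?_
    rw [momentMatrix_mulVec M hBd, hB _ (by omega)]
    simp
  ext i
  have h2 := congrArg (fun f : ℂ[X] => f.coeff (n - 1 - (i : ℕ))) hsum
  simp only [finsetSum_coeff, coeff_C_mul, coeff_X_pow, coeff_zero] at h2
  rw [Finset.sum_eq_single i] at h2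
  · simpa using h2
  · intro j _ hj
    rw [if_neg, mul_zero]
    intro h3
    exact hj (Fin.ext (by omega))
  · simp

/-- The Bezoutian in terms of the inverse of the Toeplitz matrix. -/
lemma polyKernel_eq (h : IsOrthPair M n p q) (z w : ℂ) :
    (w - z) * polyKernel (kernelMatrix M n) z w =
      q.eval z * p.eval w - p.eval z * q.eval w := by
  obtain ⟨B, hXB, hBd, hB⟩ := h.exists_bezoutian z
  have hT : (momentMatrix M n).mulVec (fun k => B.coeff k) =
      fun i : Fin n => z ^ (n - 1 - (i : ℕ)) := by
    ext i
    rw [momentMatrix_mulVec M hBd, hB _ (by omega)]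
  have hu : IsUnit (momentMatrix M n).det := isUnit_iff_ne_zero.2 h.det_ne_zero
  -- The reproducing property says that the moment matrix sends the coefficients of `B` to the
  -- powers of `z`. Inverting it exhibits them as entries of the inverse matrix; the descending
  -- powers account for the `rev` in `kernelMatrix`.
  have hco : (fun k : Fin n => B.coeff k) =
      (momentMatrix M n)⁻¹.mulVec (fun i : Fin n => z ^ (n - 1 - (i : ℕ))) := by
    rw [← hT, Matrix.mulVec_mulVec, Matrix.nonsing_inv_mul _ hu, Matrix.one_mulVec]
  have hBe : B.eval w = polyKernel (kernelMatrix M n) z w := by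
    rw [eq_sum_fin_of_degree_lt hBd, eval_finsetSum, polyKernel, Finset.sum_comm]
    refine Finset.sum_congr rfl fun k _ => ?_
    have h1 := congrFun hco k
    rw [eval_mul, eval_C, eval_pow, eval_X, h1, Matrix.mulVec, dotProduct, Finset.sum_mul]
    refine Finset.sum_bij' (fun i _ => i.rev) (fun i _ => i.rev) (by simp) (by simp) (by simp)
      (by simp) fun j _ => ?_
    rw [kernelMatrix_apply, Fin.rev_rev, Fin.val_rev, Nat.sub_sub, add_comm 1]
  have := congrArg (eval w) hXB
  simpa [hBe] using this

/-- The derivative in `w` of the Bezoutian identity at `w = z`; the factor `w - z` vanishes there,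
so only the value of the kernel survives on the left. -/
lemma polyKernel_diag (h : IsOrthPair M n p q) (z : ℂ) :
    polyKernel (kernelMatrix M n) z z =
      q.eval z * p.derivative.eval z - p.eval z * q.derivative.eval z := by
  have hK : HasDerivAt (fun w => polyKernel (kernelMatrix M n) z w)
      (deriv (fun w => polyKernel (kernelMatrix M n) z w) z) z := by
    refine DifferentiableAt.hasDerivAt ?_
    unfold polyKernel
    fun_prop
  have h1 := ((hasDerivAt_id z).sub_const z).mul hK
  have h2 := ((p.hasDerivAt z).const_mul (q.eval z)).sub ((q.hasDerivAt z).const_mul (p.eval z))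
  have h3 : (fun w => id w - z) * (fun w => polyKernel (kernelMatrix M n) z w) =
      (fun w => q.eval z * p.eval w) - fun w => p.eval z * q.eval w := by
    ext w
    exact h.polyKernel_eq z w
  rw [h3] at h1
  simpa using h1.unique h2

end IsOrthPair

/-- If the Toeplitz determinant does not vanish, the orthogonal polynomials exist. -/
lemma exists_isOrthPair {M : ℂ[X] →ₗ[ℂ] ℂ} {n : ℕ} (h : (momentMatrix M n).det ≠ 0) :
    ∃ p q : ℂ[X], IsOrthPair M n p q := by
  have hu : IsUnit (momentMatrix M n).det := isUnit_iff_ne_zero.2 h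
  have hsolve : ∀ b : ℕ → ℂ, ∃ f : ℂ[X], f.degree < n ∧ ∀ k < n, M (X ^ k * f) = b k := by
    intro b
    set v := (momentMatrix M n)⁻¹.mulVec (fun i : Fin n => b (n - 1 - i)) with hv
    set f : ℂ[X] := ∑ k : Fin n, C (v k) * X ^ (k : ℕ) with hf
    have hfd : f.degree < n := degree_sum_fin_lt v
    have hcoeff : (fun k : Fin n => f.coeff k) = v := by
      ext k
      simp only [hf, finsetSum_coeff, coeff_C_mul, coeff_X_pow, Fin.val_inj]
      simp
    refine ⟨f, hfd, fun k hk => ?_⟩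
    have h1 := momentMatrix_mulVec M hfd (⟨k, hk⟩ : Fin n).rev
    rw [hcoeff, hv, Matrix.mulVec_mulVec, Matrix.mul_nonsing_inv _ hu, Matrix.one_mulVec] at h1
    have h2 : n - 1 - ((⟨k, hk⟩ : Fin n).rev : ℕ) = k := by
      simp only [Fin.val_rev]; omega
    rw [h2] at h1
    exact h1.symm
  -- The first right-hand side makes `f` cancel the moments of `X ^ n`, so that `p = X ^ n + f`.
  obtain ⟨f, hf, hf'⟩ := hsolve fun k => -M (X ^ k * X ^ n)
  obtain ⟨q, hq, hq'⟩ := hsolve fun k => if k + 1 = n then 1 else 0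
  refine ⟨X ^ n + f, q, ⟨by simpa using hf, hq, fun k hk => ?_, hq'⟩⟩
  rw [mul_add, map_add, hf' k hk, add_neg_cancel]

/-! ### From a solution of the Riemann--Hilbert problem to orthogonal polynomials. -/

/-- A function that is holomorphic off the unit circle, has no jump across the open arcs, at most
logarithmic singularities at the separating points and polynomial growth is a polynomial. -/
lemma exists_polynomial_of_no_jump {m : ℕ} (θ : Fin (m + 1) → ℝ) {F : ℂ → ℂ} {n : ℕ}
    (hF : DifferentiableOn ℂ F offCircle)
    (hlim : ∀ j, ∀ t ∈ Set.Ioo (θ j) (nextAngle θ j), ∃ L,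
      Tendsto F (𝓝[Metric.ball (0 : ℂ) 1] (pt t)) (𝓝 L) ∧
      Tendsto F (𝓝[(Metric.closedBall (0 : ℂ) 1)ᶜ] (pt t)) (𝓝 L))
    (hlog : ∀ j, F =O[𝓝[offCircle] (pt (θ j))] (fun z => Real.log ‖z - pt (θ j)‖))
    (hinf : F =O[Bornology.cobounded ℂ] (fun z => z ^ n)) :
    ∃ q : ℂ[X], ∀ z ∈ offCircle, F z = q.eval z := by
  refine exists_polynomial_of_offCircle (Finset.univ.image fun j => pt (θ j)) hF ?_ ?_ ?_ hinf
  · intro b hb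
    obtain ⟨j, -, rfl⟩ := Finset.mem_image.1 hb
    exact norm_pt _
  · intro z hz hzS
    rcases exists_arc θ hz with ⟨j, rfl⟩ | ⟨j, t, ht, rfl⟩
    · exact absurd (Finset.mem_image_of_mem _ (Finset.mem_univ j)) hzS
    · obtain ⟨L, h1, h2⟩ := hlim j t ht
      exact ⟨L, tendsto_offCircle h1 h2⟩
  · intro b hb
    obtain ⟨j, -, rfl⟩ := Finset.mem_image.1 hb
    exact hlog j

/-- The exponent is an integer so that `n = 0` is covered: decay like `1 / z` then forces `r = 0`.
-/
lemma degree_lt_of_isBigO {r : ℂ[X]} {n : ℕ}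
    (h : (fun z => r.eval z) =O[Bornology.cobounded ℂ] (fun z => z ^ ((n : ℤ) - 1))) :
    r.degree < n := by
  by_cases hr : r = 0
  · rw [hr, degree_zero]; exact WithBot.bot_lt_coe n
  · have := natDegree_le_of_isBigO hr h
    rw [degree_eq_natDegree hr]
    exact_mod_cast (by omega : r.natDegree < n)

lemma isBigO_of_degree_lt {r : ℂ[X]} {n : ℕ} (h : r.degree < n) :
    (fun z => r.eval z * z ^ (-(n : ℤ))) =O[Bornology.cobounded ℂ] (fun z : ℂ => z⁻¹) := by
  have h1 : (fun z => r.eval z * z ^ (-(n : ℤ))) =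
      fun z => ∑ k : Fin n, r.coeff k * (z ^ (k : ℕ) * z ^ (-(n : ℤ))) := by
    ext z
    conv_lhs => rw [eq_sum_fin_of_degree_lt h]
    simp [eval_finsetSum, Finset.sum_mul, mul_assoc]
  rw [h1]
  refine Asymptotics.IsBigO.fun_sum fun k _ => Asymptotics.IsBigO.const_mul_left ?_ _
  refine Asymptotics.IsBigO.of_bound 1 ?_
  filter_upwards [eventually_cobounded_le_norm (1 : ℝ)] with z hz
  have hz0 : z ≠ 0 := norm_pos_iff.1 (by linarith)
  rw [one_mul, ← zpow_natCast, ← zpow_add₀ hz0, norm_zpow, norm_inv, ← zpow_neg_one]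
  exact zpow_le_zpow_right₀ hz (by omega)

lemma inv_isBigO_one : (fun z : ℂ => z⁻¹) =O[Bornology.cobounded ℂ] (fun _ => (1 : ℂ)) :=
  (tendsto_inv₀_cobounded (α := ℂ)).isBigO_one ℂ

lemma mul_zpow_isBigO {f : ℂ → ℂ} {k : ℤ} {g : ℂ → ℂ}
    (h : (fun z => f z * z ^ (-k)) =O[Bornology.cobounded ℂ] g) :
    f =O[Bornology.cobounded ℂ] (fun z => g z * z ^ k) := by
  refine (h.mul (Asymptotics.isBigO_refl (fun z : ℂ => z ^ k) _)).congr' ?_ EventuallyEq.rfl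
  filter_upwards [eventually_cobounded_le_norm (1 : ℝ)] with z hz
  have hz0 : z ≠ 0 := norm_pos_iff.1 (by linarith)
  rw [mul_assoc, ← zpow_add₀ hz0, neg_add_cancel, zpow_zero, mul_one]

lemma eq_zero_of_eval_isBigO_inv {r : ℂ[X]}
    (h : (fun z => r.eval z) =O[Bornology.cobounded ℂ] (fun z : ℂ => z⁻¹)) : r = 0 := by
  have : r.degree < (0 : ℕ) := degree_lt_of_isBigO (by simpa using h)
  rw [← degree_eq_bot]
  exact Nat.WithBot.lt_zero_iff.1 (by simpa using this)

lemma fin_two_eq (i : Fin 2) : i = 0 ∨ i = 1 := by omega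

namespace IsRHSolution

variable {m n : ℕ} {θ : Fin (m + 1) → ℝ} {w : Fin (m + 1) → ℂ → ℂ}
  {Γ : ℂ → Matrix (Fin 2) (Fin 2) ℂ}

lemma infinity_left (h : IsRHSolution n θ w Γ) (i : Fin 2) :
    (fun z => Γ z i 0 * z ^ (-(n : ℤ)) - (1 : Matrix (Fin 2) (Fin 2) ℂ) i 0)
      =O[Bornology.cobounded ℂ] (fun z : ℂ => z⁻¹) := by
  simpa [Matrix.mul_apply, sigmaPow, Fin.sum_univ_two] using h.infinity i 0

lemma infinity_right (h : IsRHSolution n θ w Γ) (i : Fin 2) :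
    (fun z => Γ z i 1 * z ^ (n : ℤ) - (1 : Matrix (Fin 2) (Fin 2) ℂ) i 1)
      =O[Bornology.cobounded ℂ] (fun z : ℂ => z⁻¹) := by
  simpa [Matrix.mul_apply, sigmaPow, Fin.sum_univ_two] using h.infinity i 1

lemma exists_limits (h : IsRHSolution n θ w Γ) {j : Fin (m + 1)} {t : ℝ}
    (ht : t ∈ Set.Ioo (θ j) (nextAngle θ j)) : ∃ Γm : Matrix (Fin 2) (Fin 2) ℂ,
      (∀ i k, Tendsto (fun z => Γ z i k) (𝓝[Metric.ball (0 : ℂ) 1] (pt t)) (𝓝 (Γm i k))) ∧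
      (∀ i, Tendsto (fun z => Γ z i 0) (𝓝[(Metric.closedBall (0 : ℂ) 1)ᶜ] (pt t))
        (𝓝 (Γm i 0))) ∧
      (∀ i, Tendsto (fun z => Γ z i 1) (𝓝[(Metric.closedBall (0 : ℂ) 1)ᶜ] (pt t))
        (𝓝 (Γm i 1 + Γm i 0 * w j (pt t)))) := by
  obtain ⟨Γp, Γm, h1, h2, h3⟩ := h.jump j t ht
  have hel : ∀ (l : Filter ℂ) (A : Matrix (Fin 2) (Fin 2) ℂ), Tendsto Γ l (𝓝 A) →
      ∀ i k, Tendsto (fun z => Γ z i k) l (𝓝 (A i k)) := fun l A hA i k =>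
    ((continuous_id.matrix_elem i k).tendsto A).comp hA
  refine ⟨Γm, hel _ _ h2, fun i => ?_, fun i => ?_⟩
  · have := hel _ _ h1 i 0
    rw [h3] at this
    simpa [Matrix.mul_apply, upper, Fin.sum_univ_two] using this
  · have := hel _ _ h1 i 1
    rw [h3] at this
    simpa [Matrix.mul_apply, upper, Fin.sum_univ_two, add_comm] using this

/-- The first column of a solution is polynomial. -/
lemma exists_left (h : IsRHSolution n θ w Γ) (i : Fin 2) :
    ∃ p : ℂ[X], ∀ z ∈ offCircle, Γ z i 0 = p.eval z := by
  -- The triangular jump adds a multiple of the first column to the second and leaves the first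
  -- unchanged.
  refine exists_polynomial_of_no_jump θ (n := n) (h.holomorphic i 0) (fun j t ht => ?_)
    (fun j => h.log_growth j i 0) ?_
  · obtain ⟨Γm, h1, h2, -⟩ := h.exists_limits ht
    exact ⟨_, h1 i 0, h2 i⟩
  · have h1 := ((h.infinity_left i).trans inv_isBigO_one).add
      (Asymptotics.isBigO_const_const ((1 : Matrix (Fin 2) (Fin 2) ℂ) i 0) one_ne_zero _)
    simp only [sub_add_cancel] at h1
    simpa using mul_zpow_isBigO h1

/-- A solution has determinant `1`. -/
lemma det_eq_one (h : IsRHSolution n θ w Γ) {z : ℂ} (hz : z ∈ offCircle) :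
    Γ z 0 0 * Γ z 1 1 - Γ z 0 1 * Γ z 1 0 = 1 := by
  have hlim : Tendsto (fun z => Γ z 0 0 * Γ z 1 1 - Γ z 0 1 * Γ z 1 0)
      (Bornology.cobounded ℂ) (𝓝 1) := by
    have hl : ∀ i, Tendsto (fun z => Γ z i 0 * z ^ (-(n : ℤ))) (Bornology.cobounded ℂ)
        (𝓝 ((1 : Matrix (Fin 2) (Fin 2) ℂ) i 0)) := fun i => by
      simpa using ((h.infinity_left i).trans_tendsto tendsto_inv₀_cobounded).add_const
        ((1 : Matrix (Fin 2) (Fin 2) ℂ) i 0)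
    have hr : ∀ i, Tendsto (fun z => Γ z i 1 * z ^ (n : ℤ)) (Bornology.cobounded ℂ)
        (𝓝 ((1 : Matrix (Fin 2) (Fin 2) ℂ) i 1)) := fun i => by
      simpa using ((h.infinity_right i).trans_tendsto tendsto_inv₀_cobounded).add_const
        ((1 : Matrix (Fin 2) (Fin 2) ℂ) i 1)
    have h1 := ((hl 0).mul (hr 1)).sub ((hr 0).mul (hl 1))
    simp only [Matrix.one_apply_eq, mul_one, ne_eq, zero_ne_one, not_false_eq_true,
      Matrix.one_apply_ne, one_ne_zero, mul_zero, sub_zero] at h1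
    refine h1.congr' ?_
    filter_upwards [eventually_cobounded_le_norm (1 : ℝ)] with z hz
    have hz0 : z ≠ 0 := norm_pos_iff.1 (by linarith)
    have h2 : z ^ (-(n : ℤ)) * z ^ (n : ℤ) = 1 := by
      rw [← zpow_add₀ hz0, neg_add_cancel, zpow_zero]
    linear_combination (Γ z 0 0 * Γ z 1 1 - Γ z 0 1 * Γ z 1 0) * h2
  have hd := h.holomorphic
  obtain ⟨d, hd⟩ := exists_polynomial_of_no_jump θ (n := 0)
    (F := fun z => Γ z 0 0 * Γ z 1 1 - Γ z 0 1 * Γ z 1 0)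
    (((hd 0 0).mul (hd 1 1)).sub ((hd 0 1).mul (hd 1 0))) (fun j t ht => by
      obtain ⟨Γm, h1, h2, h3⟩ := h.exists_limits ht
      refine ⟨_, ((h1 0 0).mul (h1 1 1)).sub ((h1 0 1).mul (h1 1 0)), ?_⟩
      have := ((h2 0).mul (h3 1)).sub ((h3 0).mul (h2 1))
      convert this using 2
      ring) (fun j => by
      -- The determinant is `O(log)` rather than `O(log²)`: each product contains one entry of the
      -- polynomial first column, which stays bounded.
      have hpoly : ∀ i, (fun z => Γ z i 0) =O[𝓝[offCircle] (pt (θ j))] (fun _ => (1 : ℝ)) := by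
        intro i
        obtain ⟨p, hp⟩ := h.exists_left i
        have h1 : (fun z => p.eval z) =O[𝓝[offCircle] (pt (θ j))] (fun _ => (1 : ℝ)) :=
          (p.continuous.continuousAt.tendsto.mono_left nhdsWithin_le_nhds).isBigO_one ℝ
        refine h1.congr' ?_ EventuallyEq.rfl
        filter_upwards [self_mem_nhdsWithin] with z hz using (hp z hz).symm
      have h1 := (hpoly 0).mul (h.log_growth j 1 1)
      have h2 := (h.log_growth j 0 1).mul (hpoly 1)
      simp only [one_mul, mul_one] at h1 h2
      exact h1.sub h2) (by simpa using hlim.isBigO_one ℂ)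
  have hd1 : Tendsto (fun z => (d - C 1).eval z) (Bornology.cobounded ℂ) (𝓝 0) := by
    have := hlim.sub_const 1
    rw [sub_self] at this
    refine this.congr' ?_
    filter_upwards [eventually_cobounded_offCircle] with z hz
    rw [hd z hz]; simp
  have hdz : d - C 1 = 0 := by
    by_contra hne
    have h1 := natDegree_le_of_isBigO hne (k := 0) (by simpa using hd1.isBigO_one ℂ)
    obtain ⟨a, ha⟩ : ∃ a, d - C 1 = C a :=
      ⟨_, eq_C_of_natDegree_le_zero (by exact_mod_cast h1)⟩
    rw [ha] at hd1 hne
    simp only [eval_C] at hd1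
    have := tendsto_nhds_unique hd1 tendsto_const_nhds
    rw [← this] at hne
    simp at hne
  have := hd z hz
  rw [sub_eq_zero.1 hdz, eval_C] at this
  exact this

/-- The orthogonality relations for the first column of a solution. -/
lemma functional_left (hP : PiecewiseHol θ w) (h : IsRHSolution n θ w Γ) (i : Fin 2) {p : ℂ[X]}
    (hp : ∀ z ∈ offCircle, Γ z i 0 = p.eval z) {k : ℕ} (hk : k < n) :
    hP.functional (X ^ k * p) =
      if k + 1 = n then (1 : Matrix (Fin 2) (Fin 2) ℂ) i 1 else 0 := by
  set e := (1 : Matrix (Fin 2) (Fin 2) ℂ) i 1 with he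
  have hPp : PiecewiseHol θ (fun j x => p.eval x * w j x) := hP.mul p.differentiable
  have hn : n ≠ 0 := by omega
  have hR : (fun z => Γ z i 1) =O[Bornology.cobounded ℂ] (fun z : ℂ => z⁻¹) := by
    have h1 := ((h.infinity_right i).trans inv_isBigO_one).add
      (Asymptotics.isBigO_const_const e one_ne_zero _)
    simp only [he, sub_add_cancel] at h1
    have h2 := mul_zpow_isBigO (f := fun z => Γ z i 1) (k := -(n : ℤ)) (by simpa only [neg_neg] using h1)
    refine h2.trans (Asymptotics.IsBigO.of_bound 1 ?_)
    filter_upwards [eventually_cobounded_le_norm (1 : ℝ)] with z hz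
    rw [one_mul, one_mul, norm_zpow, norm_inv, ← zpow_neg_one]
    exact zpow_le_zpow_right₀ hz (by omega)
  -- The Cauchy transform of `p w` has the jump opposite to that of the second column. Their sum is
  -- therefore a polynomial, and its decay at infinity forces it to vanish.
  obtain ⟨r, hr⟩ := exists_polynomial_of_no_jump θ (n := 0)
    (F := fun z => Γ z i 1 + cauchy θ (fun j x => p.eval x * w j x) z)
    ((h.holomorphic i 1).add hPp.cauchy_differentiableOn) (fun j t ht => by
      obtain ⟨Γm, h1, h2, h3⟩ := h.exists_limits ht
      obtain ⟨L, h4, h5⟩ := hPp.cauchy_jump ht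
      have hpv : Γm i 0 = p.eval (pt t) := by
        have := neBot_inner (c := 0) (z := pt t) one_pos (by simp [norm_pt])
        refine tendsto_nhds_unique ((h1 i 0).congr' ?_)
          (p.continuous.continuousAt.tendsto.mono_left nhdsWithin_le_nhds)
        filter_upwards [self_mem_nhdsWithin] with z hz using hp z (ball_subset_offCircle hz)
      refine ⟨_, (h1 i 1).add h4, ?_⟩
      convert (h3 i).add h5 using 2
      rw [hpv]; ring)
    (fun j => (h.log_growth j i 1).add (hPp.cauchy_isBigO_log (norm_pt _)))
    (by simpa using (hR.add hPp.cauchy_isBigO_inv).trans inv_isBigO_one)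
  have hr0 : r = 0 := by
    refine eq_zero_of_eval_isBigO_inv ((hR.add hPp.cauchy_isBigO_inv).congr' ?_ EventuallyEq.rfl)
    filter_upwards [eventually_cobounded_offCircle] with z hz using hr z hz
  have hΓ : ∀ z ∈ offCircle, cauchy θ (fun j x => p.eval x * w j x) z = -Γ z i 1 := by
    intro z hz
    have := hr z hz
    rw [hr0, eval_zero] at this
    linear_combination this
  -- Multiplying the Cauchy transform by `z ^ n` splits off a polynomial whose coefficients are the
  -- values of `M`. As `z ^ n` times the second column tends to `e`, the polynomial part must equal
  -- the constant `e`.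
  set s : ℂ[X] := (∑ l ∈ Finset.range n, C (hP.functional (X ^ (n - 1 - l) * p)) * X ^ l) - C e
    with hs
  have hs0 : s = 0 := by
    refine eq_zero_of_eval_isBigO_inv ?_
    have h1 := (hPp.mul (differentiable_pow n)).cauchy_isBigO_inv
    refine (h1.add (h.infinity_right i)).congr' ?_ EventuallyEq.rfl
    filter_upwards [eventually_cobounded_offCircle] with z hz
    have h2 := hPp.pow_mul_cauchy n hz
    rw [hΓ z hz] at h2
    simp only [hs, eval_sub, eval_finsetSum, eval_mul, eval_C, eval_pow, eval_X,
      PiecewiseHol.functional_apply, zpow_natCast, ← he]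
    have h3 : ∑ l ∈ Finset.range n, arcInt θ (fun j x => x ^ (n - 1 - l) * p.eval x * w j x) *
        z ^ l = ∑ l ∈ Finset.range n,
          z ^ l * arcInt θ (fun j x => x ^ (n - 1 - l) * (p.eval x * w j x)) := by
      refine Finset.sum_congr rfl fun l _ => ?_
      simp only [mul_assoc]; ring
    rw [h3]
    linear_combination -h2
  -- The moment against `X ^ k` is the coefficient of degree `n - 1 - k`, which is the constant one
  -- exactly for `k + 1 = n`.
  have h4 := congrArg (fun f : ℂ[X] => f.coeff (n - 1 - k)) hs0
  simp only [hs, coeff_sub, finsetSum_coeff, coeff_C_mul, coeff_X_pow, coeff_zero, mul_ite,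
    mul_one, mul_zero, Finset.sum_ite_eq, Finset.mem_range, coeff_C] at h4
  rw [if_pos (by omega), sub_eq_zero, show n - 1 - (n - 1 - k) = k by omega] at h4
  rw [h4]
  split_ifs <;> first | rfl | omega

/-- The degree conditions come from the normalization of the first column at infinity, the
orthogonality from that of the second. -/
lemma exists_isOrthPair (hP : PiecewiseHol θ w) (h : IsRHSolution n θ w Γ) :
    ∃ p q : ℂ[X], IsOrthPair hP.functional n p q ∧ (∀ z ∈ offCircle, Γ z 0 0 = p.eval z) ∧
      ∀ z ∈ offCircle, Γ z 1 0 = q.eval z := by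
  obtain ⟨p, hp⟩ := h.exists_left 0
  obtain ⟨q, hq⟩ := h.exists_left 1
  have hdeg : ∀ (r : ℂ[X]) (i : Fin 2), (∀ z ∈ offCircle, Γ z i 0 = r.eval z) →
      (r - C ((1 : Matrix (Fin 2) (Fin 2) ℂ) i 0) * X ^ n).degree < (n : WithBot ℕ) := by
    intro r i hr
    refine degree_lt_of_isBigO ?_
    have h1 : (fun z => (r - C ((1 : Matrix (Fin 2) (Fin 2) ℂ) i 0) * X ^ n).eval z *
        z ^ (-(n : ℤ))) =O[Bornology.cobounded ℂ] (fun z : ℂ => z⁻¹) := by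
      refine (h.infinity_left i).congr' ?_ EventuallyEq.rfl
      filter_upwards [eventually_cobounded_offCircle, eventually_cobounded_le_norm (1 : ℝ)]
        with z hz hz1
      have hz0 : z ≠ 0 := norm_pos_iff.1 (by linarith)
      have h2 : z ^ n * z ^ (-(n : ℤ)) = 1 := by
        rw [← zpow_natCast, ← zpow_add₀ hz0, add_neg_cancel, zpow_zero]
      rw [hr z hz]
      simp only [eval_sub, eval_mul, eval_C, eval_pow, eval_X]
      linear_combination (1 : Matrix (Fin 2) (Fin 2) ℂ) i 0 * h2
    refine (mul_zpow_isBigO h1).congr' EventuallyEq.rfl ?_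
    filter_upwards [eventually_cobounded_le_norm (1 : ℝ)] with z hz1
    have hz0 : z ≠ 0 := norm_pos_iff.1 (by linarith)
    rw [zpow_sub_one₀ hz0, mul_comm]
  refine ⟨p, q, ⟨by simpa using hdeg p 0 hp, by simpa using hdeg q 1 hq, fun k hk => ?_,
    fun k hk => ?_⟩, hp, hq⟩
  · simpa using h.functional_left hP 0 hp hk
  · simpa using h.functional_left hP 1 hq hk

/-- The kernel `K₂₁` of a solution is given by the Bezoutian of its first column. -/
lemma kernel21_eq (hP : PiecewiseHol θ w) (h : IsRHSolution n θ w Γ) {p q : ℂ[X]}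
    (ho : IsOrthPair hP.functional n p q) (hp : ∀ z ∈ offCircle, Γ z 0 0 = p.eval z)
    (hq : ∀ z ∈ offCircle, Γ z 1 0 = q.eval z) {z y : ℂ} (hz : z ∈ offCircle)
    (hy : y ∈ offCircle) (hzy : z ≠ y) :
    kernel21 Γ z y = polyKernel (kernelMatrix hP.functional n) z y := by
  have h1 := ho.polyKernel_eq z y
  have hdet := h.det_eq_one hz
  -- With determinant `1` the inverse is the adjugate, whose second row is made of the first column
  -- of `Γ`. Hence the entry involves `p` and `q` only.
  have h2 : (Γ z).det = 1 := by rw [Matrix.det_fin_two, hdet]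
  have h3 : ((Γ z)⁻¹ * Γ y) 1 0 = p.eval z * q.eval y - q.eval z * p.eval y := by
    rw [Matrix.inv_def, h2, Ring.inverse_one, one_smul, Matrix.adjugate_fin_two]
    simp [Matrix.mul_apply, Fin.sum_univ_two, hp z hz, hq z hz, hp y hy, hq y hy]
    ring
  rw [kernel21, h3, div_eq_iff (sub_ne_zero.2 hzy)]
  linear_combination h1

end IsRHSolution

/-! ### From orthogonal polynomials to a solution of the Riemann--Hilbert problem. -/

/-- If the Toeplitz determinant does not vanish, the Riemann--Hilbert problem has a solution. -/
lemma exists_isRHSolution {m n : ℕ} {θ : Fin (m + 1) → ℝ} {w : Fin (m + 1) → ℂ → ℂ}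
    (hP : PiecewiseHol θ w) (hT : (momentMatrix hP.functional n).det ≠ 0) :
    ∃ Γ, IsRHSolution n θ w Γ := by
  obtain ⟨p, q, ho⟩ := exists_isOrthPair hT
  set P : Fin 2 → ℂ[X] := ![p, q] with hPdef
  -- The constant matters for `n = 0` only: then `q = 0`, its Cauchy transform is `0`, and the
  -- normalization still requires the lower right entry `1`.
  set c : Fin 2 → ℂ := ![0, if n = 0 then 1 else 0] with hc
  have hw : ∀ i, PiecewiseHol θ (fun j x => (P i).eval x * w j x) :=
    fun i => hP.mul (P i).differentiable
  set Γ : ℂ → Matrix (Fin 2) (Fin 2) ℂ := fun z => Matrix.of fun i k =>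
    if k = 0 then (P i).eval z else c i - cauchy θ (fun j x => (P i).eval x * w j x) z with hΓ
  have hl : ∀ i, (fun z => Γ z i 0) = fun z => (P i).eval z := fun i => by ext z; simp [hΓ]
  have hr : ∀ i, (fun z => Γ z i 1) =
      fun z => c i - cauchy θ (fun j x => (P i).eval x * w j x) z := fun i => by ext z; simp [hΓ]
  refine ⟨Γ, ⟨?_, ?_, ?_, ?_⟩⟩
  · intro i k
    fin_cases k
    · exact (congrArg (fun f => DifferentiableOn ℂ f _) (hl i)).mpr
        (P i).differentiable.differentiableOn
    · exact (congrArg (fun f => DifferentiableOn ℂ f _) (hr i)).mpr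
        ((hw i).cauchy_differentiableOn.const_sub _)
  · intro j t ht
    choose L hL1 hL2 using fun i => (hw i).cauchy_jump ht
    refine ⟨Matrix.of fun i k => if k = 0 then (P i).eval (pt t) else c i - L i,
      Matrix.of fun i k => if k = 0 then (P i).eval (pt t) else
        c i - (L i + (P i).eval (pt t) * w j (pt t)), ?_, ?_, ?_⟩
    · refine tendsto_pi_nhds.2 fun i => tendsto_pi_nhds.2 fun k => ?_
      fin_cases k
      · exact (P i).continuous.continuousAt.tendsto.mono_left nhdsWithin_le_nhds
      · exact (hL2 i).const_sub _
    · refine tendsto_pi_nhds.2 fun i => tendsto_pi_nhds.2 fun k => ?_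
      fin_cases k
      · exact (P i).continuous.continuousAt.tendsto.mono_left nhdsWithin_le_nhds
      · exact (hL1 i).const_sub _
    · ext i k
      fin_cases k <;> simp [Matrix.mul_apply, Fin.sum_univ_two, upper]
      ring
  · have hinfl : ∀ i, (fun z => (P i).eval z * z ^ (-(n : ℤ)) -
        (1 : Matrix (Fin 2) (Fin 2) ℂ) i 0) =O[Bornology.cobounded ℂ] (fun z : ℂ => z⁻¹) := by
      intro i
      have hd : (P i - C ((1 : Matrix (Fin 2) (Fin 2) ℂ) i 0) * X ^ n).degree < (n : WithBot ℕ) := by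
        rcases fin_two_eq i with rfl | rfl
        · simpa [hPdef] using ho.degree_sub_lt
        · simpa [hPdef] using ho.degree_lt
      refine (isBigO_of_degree_lt hd).congr' ?_ EventuallyEq.rfl
      filter_upwards [eventually_cobounded_le_norm (1 : ℝ)] with z hz1
      have hz0 : z ≠ 0 := norm_pos_iff.1 (by linarith)
      have h2 : z ^ n * z ^ (-(n : ℤ)) = 1 := by
        rw [← zpow_natCast, ← zpow_add₀ hz0, add_neg_cancel, zpow_zero]
      simp only [eval_sub, eval_mul, eval_C, eval_pow, eval_X]
      linear_combination -(1 : Matrix (Fin 2) (Fin 2) ℂ) i 0 * h2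
    have hinfr : ∀ i, (fun z => (c i - cauchy θ (fun j x => (P i).eval x * w j x) z) *
        z ^ (n : ℤ) - (1 : Matrix (Fin 2) (Fin 2) ℂ) i 1)
        =O[Bornology.cobounded ℂ] (fun z : ℂ => z⁻¹) := by
      intro i
      refine ((hw i).mul (differentiable_pow n)).cauchy_isBigO_inv.neg_left.congr' ?_
        EventuallyEq.rfl
      filter_upwards [eventually_cobounded_offCircle] with z hz
      have h2 := (hw i).pow_mul_cauchy n hz
      -- Orthogonality removes all terms of the expansion except `l = 0`, which is the required
      -- entry of the identity. For `n = 0` the sum is empty and `c` supplies the entry.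
      have hsum : ∑ l ∈ Finset.range n,
          z ^ l * arcInt θ (fun j x => x ^ (n - 1 - l) * ((P i).eval x * w j x)) =
          (1 : Matrix (Fin 2) (Fin 2) ℂ) i 1 - c i * z ^ n := by
        have h3 : ∀ l ∈ Finset.range n,
            z ^ l * arcInt θ (fun j x => x ^ (n - 1 - l) * ((P i).eval x * w j x)) =
              if l = 0 then (1 : Matrix (Fin 2) (Fin 2) ℂ) i 1 else 0 := by
          intro l hl
          have hln := Finset.mem_range.1 hl
          have h4 : arcInt θ (fun j x => x ^ (n - 1 - l) * ((P i).eval x * w j x)) =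
              hP.functional (X ^ (n - 1 - l) * P i) := by
            simp [PiecewiseHol.functional_apply, mul_assoc]
          have h5 : hP.functional (X ^ (n - 1 - l) * P i) =
              if l = 0 then (1 : Matrix (Fin 2) (Fin 2) ℂ) i 1 else 0 := by
            have h6 : (n - 1 - l + 1 = n) ↔ l = 0 := by omega
            rcases fin_two_eq i with rfl | rfl
            · simpa [hPdef] using ho.orth_left (n - 1 - l) (by omega)
            · simpa [hPdef, h6] using ho.orth_right (n - 1 - l) (by omega)
          rw [h4, h5]
          split_ifs with h0
          · rw [h0]; simp
          · simp
        rw [Finset.sum_congr rfl h3, Finset.sum_ite_eq']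
        by_cases hn : n = 0
        · subst hn
          rcases fin_two_eq i with rfl | rfl <;> simp [hc]
        · rw [if_pos (Finset.mem_range.2 (Nat.pos_of_ne_zero hn))]
          rcases fin_two_eq i with rfl | rfl <;> simp [hc, hn]
      rw [hsum] at h2
      rw [zpow_natCast]
      linear_combination h2
    intro i k
    fin_cases k
    · refine (hinfl i).congr_left fun z => ?_
      simp [hΓ, Matrix.mul_apply, Fin.sum_univ_two, sigmaPow]
    · refine (hinfr i).congr_left fun z => ?_
      simp [hΓ, Matrix.mul_apply, Fin.sum_univ_two, sigmaPow]
  · intro j i k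
    fin_cases k
    · exact ((P i).continuous.continuousAt.tendsto.mono_left nhdsWithin_le_nhds).isBigO_one ℝ
        |>.trans (one_isBigO_log (norm_pt _) (1 : ℝ))
    · exact (one_isBigO_log (norm_pt _) (c i)).sub ((hw i).cauchy_isBigO_log (norm_pt _))

end ToeplitzRHP

/-! ### Differentiation of integrals with moving end points and of determinants. -/

namespace ToeplitzRHP

section Leibniz

variable {E : Type*} [NormedAddCommGroup E] [NormedSpace ℝ E]

/-- Derivative of an integral over a short interval with a moving end point. -/
lemma hasFDerivAt_integral_moving_end {h : E → ℝ → ℂ} {U : Set E} {V : Set ℝ} {s : E}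
    {g : E → ℝ} {g' : E →L[ℝ] ℝ} (hU : U ∈ 𝓝 s) (hV : V ∈ 𝓝 (g s))
    (hc : ContinuousOn (fun p : E × ℝ => h p.1 p.2) (U ×ˢ V)) (hg : HasFDerivAt g g' s) :
    HasFDerivAt (fun s' => ∫ t in g s..g s', h s' t) (g'.smulRight (h s (g s))) s := by
  have hca : ContinuousAt (fun p : E × ℝ => h p.1 p.2) (s, g s) :=
    hc.continuousAt (prod_mem_nhds hU hV)
  rw [hasFDerivAt_iff_isLittleO]
  have hlin : (fun s' => ((g s' - g s : ℝ) : ℂ) * h s (g s) - g' (s' - s) * h s (g s))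
      =o[𝓝 s] fun s' => s' - s := by
    have h1 := hg.isLittleO
    have h2 : (fun s' => ((g s' - g s - g' (s' - s) : ℝ) : ℂ)) =o[𝓝 s] fun s' => s' - s := by
      refine (Asymptotics.isLittleO_norm_left).1 ?_
      simpa only [Complex.norm_real] using h1.norm_left
    have h3 := h2.const_mul_left (h s (g s))
    refine h3.congr_left fun s' => ?_
    push_cast; ring
  -- By joint continuity the integrand over the short interval is close to its value at `(s, g s)`,
  -- so the error is small compared with the length `|g s' - g s|`, which is `O(s' - s)`.
  have hrem : (fun s' => (∫ t in g s..g s', h s' t) - ((g s' - g s : ℝ) : ℂ) * h s (g s))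
      =o[𝓝 s] fun s' => s' - s := by
    have h1 : (fun s' => g s' - g s) =O[𝓝 s] fun s' => s' - s := hg.isBigO_sub
    refine Asymptotics.IsLittleO.trans_isBigO ?_ h1
    refine Asymptotics.isLittleO_iff.2 fun η hη => ?_
    have h2 := Metric.tendsto_nhds.1 hca.tendsto η hη
    rw [nhds_prod_eq] at h2
    obtain ⟨P, hP, Q, hQ, hPQ⟩ := eventually_prod_iff.1 h2
    obtain ⟨r, hr, hrV⟩ := Metric.mem_nhds_iff.1 (inter_mem hV hQ)
    filter_upwards [hU, hP, hg.continuousAt.eventually (Metric.ball_mem_nhds _ hr)]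
      with s' hsU hsP hsr
    have hsub : Set.uIcc (g s) (g s') ⊆ Metric.ball (g s) r :=
      (convex_ball (g s) r).ordConnected.uIcc_subset (Metric.mem_ball_self hr) hsr
    have hint : IntervalIntegrable (h s') volume (g s) (g s') := by
      refine ContinuousOn.intervalIntegrable ?_
      have hcs : ContinuousOn (fun t => h s' t) V :=
        hc.comp (Continuous.prodMk_right s').continuousOn fun t ht => ⟨hsU, ht⟩
      exact hcs.mono fun t ht => (hrV (hsub ht)).1
    have heq : (∫ t in g s..g s', h s' t) - ((g s' - g s : ℝ) : ℂ) * h s (g s) =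
        ∫ t in g s..g s', (h s' t - h s (g s)) := by
      rw [intervalIntegral.integral_sub hint intervalIntegrable_const,
        intervalIntegral.integral_const]
      rfl
    rw [heq, Real.norm_eq_abs]
    refine intervalIntegral.norm_integral_le_of_norm_le_const fun t ht => ?_
    have := hPQ hsP (hrV (hsub (Set.uIoc_subset_uIcc ht))).2
    rw [dist_eq_norm] at this
    exact this.le
  refine (hrem.add hlin).congr_left fun s' => ?_
  simp only [intervalIntegral.integral_same, ContinuousLinearMap.smulRight_apply, real_smul]
  ring

/-- Differentiation under the integral sign with moving end points. -/
lemma hasFDerivAt_integral_moving {h : E → ℝ → ℂ} {H : E → ℝ → E →L[ℝ] ℂ} {W : Set (E × ℝ)}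
    {s : E} {α β : E → ℝ} {α' β' : E →L[ℝ] ℝ} (hab : α s ≤ β s) (hW : IsOpen W)
    (hsub : ∀ t ∈ Set.Icc (α s) (β s), (s, t) ∈ W)
    (hc : ContinuousOn (fun p : E × ℝ => h p.1 p.2) W)
    (hH : ContinuousOn (fun p : E × ℝ => H p.1 p.2) W)
    (hd : ∀ p ∈ W, HasFDerivAt (fun s' => h s' p.2) (H p.1 p.2) p.1)
    (hα : HasFDerivAt α α' s) (hβ : HasFDerivAt β β' s) :
    HasFDerivAt (fun s' => ∫ t in α s'..β s', h s' t)
      ((∫ t in α s..β s, H s t) + β'.smulRight (h s (β s)) - α'.smulRight (h s (α s))) s := by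
  have hcH : ContinuousOn (fun t => H s t) (Set.Icc (α s) (β s)) :=
    hH.comp (Continuous.prodMk_right s).continuousOn hsub
  obtain ⟨C, hC⟩ := isCompact_Icc.exists_bound_of_continuousOn hcH
  set W' : Set (E × ℝ) := W ∩ (fun p : E × ℝ => ‖H p.1 p.2‖) ⁻¹' Set.Iio (C + 1) with hW'
  have hW'o : IsOpen W' := hH.norm.isOpen_inter_preimage hW isOpen_Iio
  have hKW : ({s} : Set E) ×ˢ Set.Icc (α s) (β s) ⊆ W' := by
    rintro ⟨s', t⟩ ⟨rfl, ht⟩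
    exact ⟨hsub t ht, by simpa using (hC t ht).trans_lt (lt_add_one C)⟩
  -- The tube lemma gives a product neighbourhood of `{s} × [α s, β s]` on which `H` is bounded by
  -- `C + 1`. It serves both for the domination and for the displaced end points.
  obtain ⟨U, V, hU, hV, hsU, hIV, hUV⟩ :=
    generalized_tube_lemma isCompact_singleton isCompact_Icc hW'o hKW
  have hUs : U ∈ 𝓝 s := hU.mem_nhds (hsU rfl)
  have hUVW : U ×ˢ V ⊆ W := hUV.trans Set.inter_subset_left
  have hcUV : ContinuousOn (fun p : E × ℝ => h p.1 p.2) (U ×ˢ V) := hc.mono hUVW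
  have hVα : V ∈ 𝓝 (α s) := hV.mem_nhds (hIV ⟨le_rfl, hab⟩)
  have hVβ : V ∈ 𝓝 (β s) := hV.mem_nhds (hIV ⟨hab, le_rfl⟩)
  have hcs : ∀ s' ∈ U, ContinuousOn (fun t => h s' t) V := fun s' hs' =>
    hcUV.comp (Continuous.prodMk_right s').continuousOn fun t ht => ⟨hs', ht⟩
  have hIcc : Set.uIcc (α s) (β s) ⊆ V := by rwa [Set.uIcc_of_le hab]
  have hIoc : Set.uIoc (α s) (β s) ⊆ V := Set.uIoc_subset_uIcc.trans hIcc
  have hfix : HasFDerivAt (fun s' => ∫ t in α s..β s, h s' t) (∫ t in α s..β s, H s t) s := by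
    refine intervalIntegral.hasFDerivAt_integral_of_dominated_of_fderiv_le
      (bound := fun _ => C + 1) hUs ?_ ((hcs s (hsU rfl)).mono hIcc).intervalIntegrable ?_ ?_
      intervalIntegrable_const ?_
    · filter_upwards [hUs] with s' hs'
      exact ((hcs s' hs').mono hIoc).aestronglyMeasurable measurableSet_uIoc
    · rw [Set.uIoc_of_le hab]
      exact (hcH.mono Set.Ioc_subset_Icc_self).aestronglyMeasurable measurableSet_Ioc
    · refine ae_of_all _ fun t ht s' hs' => ?_
      have := (hUV (⟨hs', hIoc ht⟩ : (s', t) ∈ U ×ˢ V)).2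
      exact (le_of_lt (by simpa using this))
    · exact ae_of_all _ fun t ht s' hs' => hd (s', t) (hUVW ⟨hs', hIoc ht⟩)
  have hA := hasFDerivAt_integral_moving_end hUs hVα hcUV hα
  have hB := hasFDerivAt_integral_moving_end hUs hVβ hcUV hβ
  -- The integral splits into the one over the fixed interval, plus the short one at the upper end,
  -- minus the short one at the lower end.
  refine ((hfix.add hB).sub hA).congr_of_eventuallyEq ?_
  have hint : ∀ {g : E → ℝ} {g' : E →L[ℝ] ℝ}, HasFDerivAt g g' s → V ∈ 𝓝 (g s) →
      ∀ᶠ s' in 𝓝 s, IntervalIntegrable (h s') volume (g s) (g s') := by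
    intro g g' hg hVg
    obtain ⟨r, hr, hrV⟩ := Metric.mem_nhds_iff.1 hVg
    filter_upwards [hUs, hg.continuousAt.eventually (Metric.ball_mem_nhds _ hr)] with s' hs' hsr
    refine ((hcs s' hs').mono fun t ht => hrV ?_).intervalIntegrable
    exact (convex_ball (g s) r).ordConnected.uIcc_subset (Metric.mem_ball_self hr) hsr ht
  filter_upwards [hUs, hint hα hVα, hint hβ hVβ] with s' hs' h1 h2
  have h3 : IntervalIntegrable (h s') volume (α s) (β s) :=
    ((hcs s' hs').mono hIcc).intervalIntegrable
  simp only [Pi.sub_apply, Pi.add_apply]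
  rw [← intervalIntegral.integral_add_adjacent_intervals (h1.symm) (h3.trans h2),
    ← intervalIntegral.integral_add_adjacent_intervals h3 h2,
    intervalIntegral.integral_symm (α s) (α s')]
  ring

end Leibniz

/-- The derivative of a determinant (Jacobi's formula). -/
lemma hasFDerivAt_det {E : Type*} [NormedAddCommGroup E] [NormedSpace ℝ E] {ι : Type*} [Fintype ι]
    [DecidableEq ι] {A : E → Matrix ι ι ℂ} {A' : ι → ι → E →L[ℝ] ℂ} {s : E}
    (h : ∀ i j, HasFDerivAt (fun s' => A s' i j) (A' i j) s) :
    ∃ L : E →L[ℝ] ℂ, HasFDerivAt (fun s' => (A s').det) L s ∧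
      ∀ v, L v = ∑ i, ∑ j, (A s).adjugate i j * A' j i v := by
  refine ⟨∑ σ : Equiv.Perm ι, (Equiv.Perm.sign σ : ℤ) •
    ∑ i, (∏ j ∈ Finset.univ.erase i, A s (σ j) j) • A' (σ i) i, ?_, fun v => ?_⟩
  · have : (fun s' => (A s').det) = fun s' => ∑ σ : Equiv.Perm ι,
        (Equiv.Perm.sign σ : ℤ) • ∏ i, A s' (σ i) i := by
      ext s'
      rw [Matrix.det_apply]
      rfl
    rw [this]
    refine HasFDerivAt.fun_sum fun σ _ => ?_
    exact (HasFDerivAt.finsetProd fun i _ => h (σ i) i).const_smul _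
  -- Cramer's rule: a row of the adjugate paired with the derivative of the corresponding column is
  -- the determinant with that column replaced by its derivative.
  · have hcol : ∀ i, ∑ j, (A s).adjugate i j * A' j i v =
        ((A s).updateCol i fun k => A' k i v).det := by
      intro i
      rw [← Matrix.cramer_apply, Matrix.cramer_eq_adjugate_mulVec]
      rfl
    simp only [hcol]
    simp only [Matrix.det_apply]
    rw [Finset.sum_comm]
    simp only [sum_apply, smul_apply]
    refine Finset.sum_congr rfl fun σ _ => ?_
    rw [← Finset.smul_sum]
    congr 1
    refine Finset.sum_congr rfl fun i _ => ?_
    rw [← Finset.mul_prod_erase _ _ (Finset.mem_univ i), Matrix.updateCol_self, smul_eq_mul,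
      mul_comm]
    congr 1
    refine Finset.prod_congr rfl fun j hj => ?_
    rw [Matrix.updateCol_ne (Finset.ne_of_mem_erase hj)]

/-- The branch is `log T(s) + log (T(s') / T(s))`. The quotient is `1` at `s`, so the principal
logarithm is differentiable there even when `T s` lies on its cut. -/
lemma isLogDifferential_of_hasFDerivAt {E : Type*} [NormedAddCommGroup E] [NormedSpace ℝ E]
    {T : E → ℂ} {s : E} {L : E →L[ℝ] ℂ} (h : HasFDerivAt T L s) (h0 : T s ≠ 0) :
    IsLogDifferential T s ((T s)⁻¹ • L) := by
  have h1 : HasFDerivAt (fun s' => (T s)⁻¹ * T s') ((T s)⁻¹ • L) s := h.const_mul _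
  have h2 : (T s)⁻¹ * T s = 1 := inv_mul_cancel₀ h0
  have h3 : HasFDerivAt (fun s' => Complex.log (T s) + Complex.log ((T s)⁻¹ * T s'))
      ((T s)⁻¹ • L) s := by
    have hl : HasDerivAt Complex.log 1 ((T s)⁻¹ * T s) := by
      rw [h2]
      simpa using hasDerivAt_log one_mem_slitPlane
    have h4 := ((hl.comp_hasFDerivAt_of_eq s h1 rfl)).const_add (Complex.log (T s))
    rw [one_smul] at h4
    exact h4
  refine ⟨_, ?_, h3⟩
  filter_upwards [h.continuousAt.eventually_ne h0] with s' hs'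
  rw [exp_add, exp_log h0, exp_log (mul_ne_zero (inv_ne_zero h0) hs'), mul_inv_cancel_left₀ h0]

lemma arcInt_congr {m : ℕ} (θ : Fin (m + 1) → ℝ) {f g : Fin (m + 1) → ℂ → ℂ}
    (h : ∀ j t, f j (pt t) = g j (pt t)) : arcInt θ f = arcInt θ g := by
  simp only [arcInt_eq_sum, arcIntegral, h]

/-- For the last arc the sum `j + 1` wraps around to `0`, and the angles differ by the period `2π`.
-/
lemma pt_nextAngle {m : ℕ} (θ : Fin (m + 1) → ℝ) (j : Fin (m + 1)) :
    pt (nextAngle θ j) = pt (θ (j + 1)) := by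
  unfold nextAngle
  split_ifs with h
  · congr 2
    exact Fin.ext (by simp [Fin.val_add_one_of_lt (i := j) (by
      rw [Fin.lt_def]; simpa using h)])
  · have hj : j = Fin.last m := Fin.ext (by simp; omega)
    rw [hj, Fin.last_add_one]
    exact periodic_circleMap 0 1 _

/-! ### Variation of the moments and of the Toeplitz determinant. -/

namespace SymbolFamily

variable {E : Type*} [NormedAddCommGroup E] [NormedSpace ℝ E] {m : ℕ}

section
variable (F : SymbolFamily E m) {s : E}

lemma hasFDerivAt_θ (hs : s ∈ F.U) (j : Fin (m + 1)) :
    HasFDerivAt (fun s' => F.θ s' j) (fderiv ℝ (fun s' => F.θ s' j) s) s :=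
  (((F.θ_contDiff j).differentiableOn one_ne_zero).differentiableAt
    (F.isOpen_U.mem_nhds hs)).hasFDerivAt

lemma hasFDerivAt_nextAngle (hs : s ∈ F.U) (j : Fin (m + 1)) :
    HasFDerivAt (fun s' => nextAngle (F.θ s') j) (fderiv ℝ (fun s' => F.θ s' (j + 1)) s) s := by
  by_cases h : j.val + 1 < m + 1
  · have hj : j + 1 = ⟨j.val + 1, h⟩ := Fin.ext (by simp [Fin.val_add_one_of_lt (i := j) (by
      rw [Fin.lt_def]; simpa using h)])
    simp only [nextAngle, dif_pos h, ← hj]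
    exact F.hasFDerivAt_θ hs _
  · have hj : j = Fin.last m := Fin.ext (by simp; omega)
    have h1 : (fun s' => nextAngle (F.θ s') j) = fun s' => F.θ s' 0 + 2 * Real.pi := by
      ext s'
      rw [nextAngle, dif_neg h]
    rw [h1, hj, Fin.last_add_one]
    exact (F.hasFDerivAt_θ hs 0).add_const _

lemma hasFDerivAt_β (hs : s ∈ F.U) (j : Fin (m + 1)) :
    HasFDerivAt (fun s' => F.β s' j)
      ((fderiv ℝ (fun s' => F.θ s' j) s).smulRight (F.β s j * I)) s :=
  ((hasDerivAt_pt (F.θ s j)).hasFDerivAt.comp s (F.hasFDerivAt_θ hs j)).congr_fderiv (by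
    ext v; simp [β])

lemma fderiv_β_apply (hs : s ∈ F.U) (j : Fin (m + 1)) (v : E) :
    fderiv ℝ (fun s' => F.β s' j) s v =
      (fderiv ℝ (fun s' => F.θ s' j) s v : ℂ) * (F.β s j * I) := by
  rw [(F.hasFDerivAt_β hs j).fderiv]
  simp

lemma hasFDerivAt_a {j : Fin (m + 1)} {z : ℂ} (hz : (s, z) ∈ F.D j) :
    HasFDerivAt (fun s' => F.a s' j z) (fderiv ℝ (fun s' => F.a s' j z) s) s := by
  have h1 : DifferentiableAt ℝ (fun p : E × ℂ => F.a p.1 j p.2) (s, z) :=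
    ((F.a_contDiff j).differentiableOn one_ne_zero).differentiableAt ((F.isOpen_D j).mem_nhds hz)
  exact (h1.comp s (by fun_prop : DifferentiableAt ℝ (fun s' => (s', z)) s)).hasFDerivAt

/-- The partial derivative is the total one composed with the inclusion of `E`, so it inherits joint
continuity from the `C¹` assumption. -/
lemma continuousOn_fderiv_a (j : Fin (m + 1)) :
    ContinuousOn (fun p : E × ℂ => fderiv ℝ (fun s' => F.a s' j p.2) p.1) (F.D j) := by
  have h1 := (F.a_contDiff j).continuousOn_fderiv_of_isOpen (F.isOpen_D j) le_rfl
  have h2 : ContinuousOn (fun p : E × ℂ =>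
      (fderiv ℝ (fun p : E × ℂ => F.a p.1 j p.2) p).comp (ContinuousLinearMap.inl ℝ E ℂ)) (F.D j) :=
    h1.clm_comp continuousOn_const
  refine h2.congr fun p hp => ?_
  have h3 : DifferentiableAt ℝ (fun p : E × ℂ => F.a p.1 j p.2) (p.1, p.2) :=
    ((F.a_contDiff j).differentiableOn one_ne_zero).differentiableAt ((F.isOpen_D j).mem_nhds hp)
  have h4 : HasFDerivAt (fun s' : E => (s', p.2)) (ContinuousLinearMap.inl ℝ E ℂ) p.1 :=
    hasFDerivAt_prodMk_left p.1 p.2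
  exact (h3.hasFDerivAt.comp p.1 h4).fderiv

lemma contArc_fderiv_a (hs : s ∈ F.U) (j : Fin (m + 1)) (v : E) :
    ContArc (F.θ s j) (nextAngle (F.θ s) j) (fun x => fderiv ℝ (fun s' => F.a s' j x) s v) := by
  have h1 : ContinuousOn (fun t : ℝ => fderiv ℝ (fun s' => F.a s' j (pt t)) s)
      (Set.Icc (F.θ s j) (nextAngle (F.θ s) j)) :=
    (F.continuousOn_fderiv_a j).comp
      (continuous_const.prodMk continuous_pt).continuousOn fun t ht => F.arc_subset j s hs t ht
  exact h1.clm_apply continuousOn_const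

lemma holArc_a (hs : s ∈ F.U) (j : Fin (m + 1)) :
    HolArc (F.θ s j) (nextAngle (F.θ s) j) (F.a s j) :=
  ⟨{z | (s, z) ∈ F.D j}, (F.isOpen_D j).preimage (Continuous.prodMk_right s),
    fun t ht => F.arc_subset j s hs t ht, F.a_analytic j s hs⟩

lemma piecewiseHol_weight (n : ℕ) (hs : s ∈ F.U) : PiecewiseHol (F.θ s) (F.weight n s) := by
  refine ⟨F.θ_strictMono s hs, F.θ_lt s hs, fun j => ?_⟩
  refine HolArc.mul ⟨{0}ᶜ, isOpen_compl_singleton, fun t _ => pt_ne_zero t, ?_⟩ (F.holArc_a hs j)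
  intro z hz
  exact (differentiableAt_zpow.2 (Or.inl hz)).differentiableWithinAt

/-- The derivative of `∮ g(x) a(x; s) dx / (2πi)` in the direction `v`. -/
def variation (s v : E) (g : ℂ → ℂ) : ℂ :=
  arcInt (F.θ s) (fun j x => g x * fderiv ℝ (fun s' => F.a s' j x) s v) +
    ∑ j, g (F.β s j) * (F.a s (j - 1) (F.β s j) - F.a s j (F.β s j)) / (2 * Real.pi * I) *
      fderiv ℝ (fun s' => F.β s' j) s v

lemma variation_congr (v : E) {g g' : ℂ → ℂ} (h : ∀ t, g (pt t) = g' (pt t)) :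
    F.variation s v g = F.variation s v g' := by
  unfold variation
  rw [arcInt_congr (F.θ s) (g := fun j x => g' x * fderiv ℝ (fun s' => F.a s' j x) s v)
    fun j t => by rw [h t]]
  simp only [β, h]

/-- Linearity in `g`, needed to collect the trace of `A⁻¹ ∂A` into a single integral. -/
lemma variation_sum (hs : s ∈ F.U) (v : E) {ι : Type*} (S : Finset ι) (c : ι → ℂ) {g : ι → ℂ → ℂ}
    (hg : ∀ i, Continuous fun t => g i (pt t)) :
    F.variation s v (fun x => ∑ i ∈ S, c i * g i x) = ∑ i ∈ S, c i * F.variation s v (g i) := by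
  have hP := F.piecewiseHol_weight 0 hs
  simp only [variation, mul_add, Finset.sum_add_distrib]
  congr 1
  · simp only [arcInt_eq_sum, Finset.mul_sum]
    rw [Finset.sum_comm]
    refine Finset.sum_congr rfl fun j _ => ?_
    simp only [← arcIntegral_const_mul]
    rw [← arcIntegral_sum (hP.le_nextAngle j)]
    · refine arcIntegral_congr (hP.le_nextAngle j) fun t _ => ?_
      rw [Finset.sum_mul]
      simp only [mul_assoc]
    · intro i _
      exact ContinuousOn.mul continuousOn_const
        (ContinuousOn.mul (hg i).continuousOn (F.contArc_fderiv_a hs j v))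
  · simp only [Finset.sum_mul, Finset.sum_div, Finset.mul_sum]
    rw [Finset.sum_comm]
    refine Finset.sum_congr rfl fun i _ => Finset.sum_congr rfl fun j _ => ?_
    ring

/-- Differentiation of `∮ g(x) a(x; s) dx / (2πi)` in the parameter. -/
lemma exists_hasFDerivAt_arcInt (hs : s ∈ F.U) {g : ℂ → ℂ} (hg : Continuous fun t => g (pt t)) :
    ∃ L : E →L[ℝ] ℂ,
      HasFDerivAt (fun s' => arcInt (F.θ s') (fun j x => g x * F.a s' j x)) L s ∧
      ∀ v, L v = F.variation s v g := by
  have hP := F.piecewiseHol_weight 0 hs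
  have hpi : (2 * Real.pi * I : ℂ) ≠ 0 := two_pi_I_ne_zero
  set h : Fin (m + 1) → E → ℝ → ℂ := fun j s' t =>
    g (pt t) * F.a s' j (pt t) * (pt t * I) / (2 * Real.pi * I) with hh
  set H : Fin (m + 1) → E → ℝ → E →L[ℝ] ℂ := fun j s' t =>
    (g (pt t) * (pt t * I) / (2 * Real.pi * I)) • fderiv ℝ (fun s'' => F.a s'' j (pt t)) s' with hH
  set W : Fin (m + 1) → Set (E × ℝ) := fun j => {p | (p.1, pt p.2) ∈ F.D j} with hW
  have hmap : Continuous fun p : E × ℝ => (p.1, pt p.2) :=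
    continuous_fst.prodMk (continuous_pt.comp continuous_snd)
  have hG : Continuous fun p : E × ℝ => g (pt p.2) := hg.comp continuous_snd
  have hp : Continuous fun p : E × ℝ => pt p.2 := continuous_pt.comp continuous_snd
  have hderiv : ∀ j, HasFDerivAt (fun s' => ∫ t in F.θ s' j..nextAngle (F.θ s') j, h j s' t) _ s :=
    fun j => hasFDerivAt_integral_moving (H := H j) (W := W j) (hP.le_nextAngle j)
      ((F.isOpen_D j).preimage hmap) (fun t ht => F.arc_subset j s hs t ht)
      (by
        have ha : ContinuousOn (fun p : E × ℝ => F.a p.1 j (pt p.2)) (W j) :=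
          (F.a_contDiff j).continuousOn.comp hmap.continuousOn fun _ hp => hp
        exact ((hG.continuousOn.mul ha).mul (hp.mul continuous_const).continuousOn).div_const _)
      (by
        have ha : ContinuousOn (fun p : E × ℝ => fderiv ℝ (fun s'' => F.a s'' j (pt p.2)) p.1)
          (W j) := (F.continuousOn_fderiv_a j).comp hmap.continuousOn fun _ hp => hp
        exact ((hG.mul (hp.mul continuous_const)).div_const _).continuousOn.smul ha)
      (fun p hp => by
        have h1 := (F.hasFDerivAt_a (j := j) hp).const_smul
          (g (pt p.2) * (pt p.2 * I) / (2 * Real.pi * I))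
        refine h1.congr_of_eventuallyEq (Eventually.of_forall fun s' => ?_)
        simp only [hh, smul_eq_mul, Pi.smul_apply]
        ring)
      (F.hasFDerivAt_θ hs j) (F.hasFDerivAt_nextAngle hs j)
  refine ⟨_, HasFDerivAt.fun_sum fun j (_ : j ∈ Finset.univ) => hderiv j, fun v => ?_⟩
  have hint : ∀ j, (∫ t in F.θ s j..nextAngle (F.θ s) j, H j s t) v =
      arcIntegral (F.θ s j) (nextAngle (F.θ s) j)
        (fun x => g x * fderiv ℝ (fun s' => F.a s' j x) s v) := by
    intro j
    rw [ContinuousLinearMap.intervalIntegral_apply]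
    · unfold arcIntegral
      congr 1
      ext t
      simp only [hH, smul_apply, smul_eq_mul]
      ring
    · refine ContinuousOn.intervalIntegrable ?_
      rw [Set.uIcc_of_le (hP.le_nextAngle j)]
      have h1 : Continuous fun t => g (pt t) * (pt t * I) / (2 * Real.pi * I) :=
        (hg.mul (continuous_pt.mul continuous_const)).div_const _
      have h2 : ContinuousOn (fun t : ℝ => fderiv ℝ (fun s'' => F.a s'' j (pt t)) s)
          (Set.Icc (F.θ s j) (nextAngle (F.θ s) j)) :=
        (F.continuousOn_fderiv_a j).comp (continuous_const.prodMk continuous_pt).continuousOn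
          fun t ht => F.arc_subset j s hs t ht
      exact h1.continuousOn.smul h2
  -- The upper end of arc `j` is `β_{j+1}`. The cyclic shift collects at each `β_j` the
  -- contributions of both adjacent arcs, whose difference is `a_{j-1} - a_j`.
  have hshift : ∑ j, ((fderiv ℝ (fun s' => F.θ s' (j + 1)) s v : ℝ) : ℂ) *
        h j s (nextAngle (F.θ s) j) =
      ∑ j, ((fderiv ℝ (fun s' => F.θ s' j) s v : ℝ) : ℂ) * h (j - 1) s (F.θ s j) := by
    refine Fintype.sum_equiv (Equiv.addRight 1) _ _ fun j => ?_
    simp only [Equiv.coe_addRight, add_sub_cancel_right, hh, pt_nextAngle]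
  simp only [sum_apply, sub_apply, add_apply,
    ContinuousLinearMap.smulRight_apply, hint, real_smul]
  rw [Finset.sum_sub_distrib, Finset.sum_add_distrib, hshift, add_sub_assoc,
    ← Finset.sum_sub_distrib, variation, arcInt_eq_sum]
  congr 1
  refine Finset.sum_congr rfl fun j _ => ?_
  rw [F.fderiv_β_apply hs]
  simp only [hh, β]
  ring

/-- The reversed rows of `momentMatrix` and the factor `z ^ (-n)` of the weight combine: `x ^ (j + n
- 1 - i) * x ^ (-n) = x ^ (j - i) / x`. -/
lemma functional_X_pow (n : ℕ) (hs : s ∈ F.U) (i j : Fin n) :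
    (F.piecewiseHol_weight n hs).functional (Polynomial.X ^ ((j : ℕ) + (n - 1 - i))) =
      moment (F.θ s) (F.a s) ((j : ℤ) - (i : ℤ)) := by
  rw [PiecewiseHol.functional_apply, moment]
  refine arcInt_congr _ fun k t => ?_
  have h0 := pt_ne_zero t
  have h1 : ((j : ℤ) - i) = ((j : ℕ) + (n - 1 - i) : ℕ) + (-(n : ℤ)) + 1 := by
    have := i.2
    omega
  rw [h1, zpow_add_one₀ h0, zpow_add₀ h0, zpow_natCast]
  simp only [Polynomial.eval_pow, Polynomial.eval_X, weight]
  field_simp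

lemma T_eq_det (n : ℕ) (hs : s ∈ F.U) :
    F.T n s = (momentMatrix (F.piecewiseHol_weight n hs).functional n).det := by
  rw [T, toeplitz]
  congr 1
  ext i j
  exact (F.functional_X_pow n hs i j).symm

/-- The logarithmic derivative of the Toeplitz determinant. -/
theorem exists_isLogDifferential (n : ℕ) (hs : s ∈ F.U) (h0 : F.T n s ≠ 0) :
    ∃ L : E →L[ℝ] ℂ, IsLogDifferential (F.T n) s L ∧ ∀ v, L v = F.variation s v
      (fun x => polyKernel (kernelMatrix (F.piecewiseHol_weight n hs).functional n) x x *
        x ^ (-(n : ℤ))) := by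
  set M := (F.piecewiseHol_weight n hs).functional with hM
  set g : ℤ → ℂ → ℂ := fun k x => x ^ k / x with hg
  have hgc : ∀ k, Continuous fun t => g k (pt t) := fun k => by
    refine Continuous.div₀ ?_ continuous_pt pt_ne_zero
    exact continuous_pt.zpow₀ k fun t => Or.inl (pt_ne_zero t)
  choose A' hA' hA'v using fun k => F.exists_hasFDerivAt_arcInt hs (hgc k)
  have hA : ∀ i j : Fin n, HasFDerivAt (fun s' =>
      (Matrix.of fun i j : Fin n => moment (F.θ s') (F.a s') ((j : ℤ) - (i : ℤ))) i j)
      (A' ((j : ℤ) - (i : ℤ))) s := by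
    intro i j
    refine (hA' _).congr_of_eventuallyEq (Eventually.of_forall fun s' => ?_)
    simp only [Matrix.of_apply, moment, hg]
    refine arcInt_congr _ fun k t => ?_
    ring
  obtain ⟨L, hL, hLv⟩ := hasFDerivAt_det hA
  refine ⟨_, isLogDifferential_of_hasFDerivAt hL h0, fun v => ?_⟩
  have hmat : (Matrix.of fun i j : Fin n => moment (F.θ s) (F.a s) ((j : ℤ) - (i : ℤ))) =
      momentMatrix M n := by
    ext i j
    exact (F.functional_X_pow n hs i j).symm
  have hinv : ∀ i j, (F.T n s)⁻¹ * (momentMatrix M n).adjugate i j =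
      (momentMatrix M n)⁻¹ i j := by
    intro i j
    rw [Matrix.inv_def, Ring.inverse_eq_inv', ← F.T_eq_det n hs]
    rfl
  -- On the circle `K(x,x) x ^ (-n)` is the sum of the entries of the inverse matrix times `x ^ (i -
  -- j) / x`, and the latter are the functions whose integrals against `a` are the moments. So the
  -- trace in Jacobi's formula becomes one variation.
  have hker : ∀ t, polyKernel (kernelMatrix M n) (pt t) (pt t) * pt t ^ (-(n : ℤ)) =
      ∑ p : Fin n × Fin n, (momentMatrix M n)⁻¹ p.1 p.2 *
        g ((p.1 : ℤ) - (p.2 : ℤ)) (pt t) := by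
    intro t
    have hx := pt_ne_zero t
    rw [Fintype.sum_prod_type, polyKernel, Finset.sum_comm, Finset.sum_mul]
    refine Finset.sum_congr rfl fun k _ => ?_
    rw [Finset.sum_mul]
    refine Finset.sum_bij' (fun i _ => i.rev) (fun i _ => i.rev) (by simp) (by simp) (by simp)
      (by simp) fun i _ => ?_
    rw [kernelMatrix_apply, hg]
    have h1 : ((k : ℤ) - (i.rev : ℕ)) = ((i : ℕ) + (k : ℕ) : ℕ) + (-(n : ℤ)) + 1 := by
      have := i.2
      rw [Fin.val_rev]
      omega
    simp only
    rw [h1, zpow_add_one₀ hx, zpow_add₀ hx, zpow_natCast, pow_add]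
    field_simp
  rw [F.variation_congr v (g' := fun x => ∑ p : Fin n × Fin n, (momentMatrix M n)⁻¹ p.1 p.2 *
    g ((p.1 : ℤ) - (p.2 : ℤ)) x) hker, F.variation_sum hs v Finset.univ _ fun p => hgc _,
    smul_apply, hLv, smul_eq_mul, Finset.mul_sum, Fintype.sum_prod_type]
  refine Finset.sum_congr rfl fun i _ => ?_
  rw [Finset.mul_sum]
  refine Finset.sum_congr rfl fun j _ => ?_
  rw [hmat, ← mul_assoc, hA'v]
  congr 1
  exact hinv i j

end

end SymbolFamily

/-! ### Integrability of the Cauchy kernel where a small circle crosses the unit circle. -/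

lemma intervalIntegrable_inv_sqrt_abs (a b : ℝ) :
    IntervalIntegrable (fun v => (√|v|)⁻¹) volume a b := by
  refine intervalIntegrable_of_even (fun v => by rw [abs_neg]) (fun x hx => ?_)
  have h1 : IntervalIntegrable (fun v : ℝ => v ^ (-(1 / 2) : ℝ)) volume 0 x :=
    intervalIntegral.intervalIntegrable_rpow' (by norm_num)
  refine h1.congr fun v hv => ?_
  rw [Set.uIoc_of_le hx.le] at hv
  rw [abs_of_pos hv.1, Real.rpow_neg hv.1.le, Real.sqrt_eq_rpow]

/-- On `[-π/2, π/2]` one has `|sin v| ≥ (2/π) |v|`; periodicity does the rest. -/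
lemma intervalIntegrable_inv_sqrt_abs_sin (a b : ℝ) :
    IntervalIntegrable (fun v => (√|Real.sin v|)⁻¹) volume a b := by
  have hper : Function.Periodic (fun v => (√|Real.sin v|)⁻¹) Real.pi := fun v => by
    simp only [Real.sin_add_pi, abs_neg]
  refine hper.intervalIntegrable Real.pi_ne_zero (t := -(Real.pi / 2)) ?_ a b
  rw [show -(Real.pi / 2) + Real.pi = Real.pi / 2 by ring]
  have h1 := (intervalIntegrable_inv_sqrt_abs (-(Real.pi / 2)) (Real.pi / 2)).const_mul
    (√(2 / Real.pi))⁻¹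
  refine h1.mono_fun ?_ ?_
  · exact (Real.continuous_sin.abs.sqrt.measurable.inv).aestronglyMeasurable
  · rw [EventuallyLE, ae_restrict_iff' measurableSet_uIoc]
    filter_upwards [Measure.ae_ne volume (0 : ℝ)] with v hv0 hv
    rw [Set.uIoc_of_le (by linarith [Real.pi_pos])] at hv
    have h2 := Real.mul_abs_le_abs_sin (abs_le.2 ⟨hv.1.le, hv.2⟩)
    have hv1 : 0 < |v| := abs_pos.2 hv0
    have hpi := Real.pi_pos
    rw [← mul_inv, ← Real.sqrt_mul (by positivity), Real.norm_of_nonneg (by positivity),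
      Real.norm_of_nonneg (by positivity)]
    gcongr

/-- The inverse square root of a shifted cosine is integrable. -/
lemma intervalIntegrable_inv_sqrt_cos_sub {κ : ℝ} (hκ : |κ| < 1) (a b : ℝ) :
    IntervalIntegrable (fun u => (√|Real.cos u - κ|)⁻¹) volume a b := by
  set α := Real.arccos κ with hα
  have hκ' := abs_lt.1 hκ
  have hcos : Real.cos α = κ := Real.cos_arccos hκ'.1.le hκ'.2.le
  have hsin : 0 < Real.sin α := by
    rw [hα, Real.sin_arccos]
    apply Real.sqrt_pos.2
    nlinarith
  have hhalf : ∀ c : ℝ, IntervalIntegrable (fun u => (√|Real.sin ((u + c) / 2)|)⁻¹) volume a b := by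
    intro c
    have h1 := (intervalIntegrable_inv_sqrt_abs_sin ((a + c) / 2) ((b + c) / 2)).comp_mul_left
      (c := 1 / 2)
    have h2 := h1.comp_add_right c
    convert h2 using 1
    · ext u; congr 4; ring
    · ring
    · ring
  have hint := ((hhalf α).add (hhalf (-α))).const_mul (√(Real.sin α))⁻¹
  refine hint.mono_fun ?_ (ae_of_all _ fun u => ?_)
  · exact ((Real.continuous_cos.sub continuous_const).abs.sqrt.measurable.inv).aestronglyMeasurable
  set A := Real.sin ((u + α) / 2) with hA
  set B := Real.sin ((u + -α) / 2) with hB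
  have hprod : |Real.cos u - κ| = 2 * |A| * |B| := by
    rw [← hcos, Real.cos_sub_cos, abs_mul, abs_mul, abs_neg, abs_two, hA, hB]
    rfl
  -- The two factors of `cos u - cos α` are not small together: the larger one is at least `sin α /
  -- 2`, so only the inverse square root of the smaller one matters.
  have hsum : Real.sin α ≤ |A| + |B| := by
    have h1 : Real.sin α = A * Real.cos ((u + -α) / 2) - Real.cos ((u + α) / 2) * B := by
      rw [hA, hB, ← Real.sin_sub]; congr 1; ring
    have h2 : |A * Real.cos ((u + -α) / 2)| ≤ |A| := by
      rw [abs_mul]; exact mul_le_of_le_one_right (abs_nonneg _) (Real.abs_cos_le_one _)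
    have h3 : |Real.cos ((u + α) / 2) * B| ≤ |B| := by
      rw [abs_mul]; exact mul_le_of_le_one_left (abs_nonneg _) (Real.abs_cos_le_one _)
    linarith [le_abs_self (A * Real.cos ((u + -α) / 2)), neg_abs_le (Real.cos ((u + α) / 2) * B)]
  have key : ∀ x y : ℝ, 0 ≤ y → Real.sin α ≤ 2 * x →
      (√(2 * x * y))⁻¹ ≤ (√(Real.sin α))⁻¹ * (√y)⁻¹ := by
    intro x y hy hx
    rw [Real.sqrt_mul (by linarith), mul_inv]
    gcongr
  have hAi : 0 ≤ (√|A|)⁻¹ := by positivity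
  have hBi : 0 ≤ (√|B|)⁻¹ := by positivity
  have hSi : 0 ≤ (√(Real.sin α))⁻¹ := by positivity
  simp only
  rw [Real.norm_of_nonneg (by positivity), Real.norm_of_nonneg (by positivity), hprod, mul_add]
  rcases le_total |A| |B| with h | h
  · have h1 := key |B| |A| (abs_nonneg _) (by linarith)
    rw [show 2 * |A| * |B| = 2 * |B| * |A| by ring]
    have := mul_nonneg hSi hBi
    linarith
  · have h1 := key |A| |B| (abs_nonneg _) (by linarith)
    have := mul_nonneg hSi hAi
    linarith

lemma ae_cos_sub_ne (τ κ : ℝ) : ∀ᵐ u : ℝ, Real.cos (u - τ) ≠ κ := by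
  have h : {u : ℝ | Real.cos (u - τ) = κ}.Countable := by
    by_cases hex : ∃ u₀, Real.cos u₀ = κ
    · obtain ⟨u₀, hu₀⟩ := hex
      refine ((Set.countable_range fun k : ℤ => 2 * k * Real.pi + u₀ + τ).union
        (Set.countable_range fun k : ℤ => 2 * k * Real.pi - u₀ + τ)).mono fun u hu => ?_
      obtain ⟨k, hk | hk⟩ := Real.cos_eq_cos_iff.1 (hu₀.trans hu.symm)
      · exact Or.inl ⟨k, by simp only; linarith⟩
      · exact Or.inr ⟨k, by simp only; linarith⟩
    · push Not at hex
      have : {u : ℝ | Real.cos (u - τ) = κ} = ∅ := by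
        ext u; simpa using hex (u - τ)
      rw [this]; exact Set.countable_empty
  filter_upwards [h.ae_notMem volume] with u hu using hu

lemma pt_eq (t : ℝ) : pt t = (Real.cos t : ℂ) + Real.sin t * I := by
  simp [pt, circleMap, exp_mul_I]

lemma circleMap_eq (c : ℂ) (ε t : ℝ) : circleMap c ε t = c + ε * pt t := by
  simp [pt, circleMap]

lemma norm_sq_pt_sub_pt (u τ : ℝ) : ‖pt u - pt τ‖ ^ 2 = 2 - 2 * Real.cos (u - τ) := by
  rw [← normSq_eq_norm_sq, normSq_apply, pt_eq, pt_eq, Real.cos_sub]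
  simp only [sub_re, add_re, ofReal_re, mul_re, I_re, mul_zero, ofReal_im, I_im, mul_one, sub_self,
    add_zero, sub_im, add_im, mul_im, zero_add]
  nlinarith [Real.sin_sq_add_cos_sq u, Real.sin_sq_add_cos_sq τ]

lemma norm_sq_circleMap (τ ε t : ℝ) :
    ‖circleMap (pt τ) ε t‖ ^ 2 = 1 + ε ^ 2 + 2 * ε * Real.cos (t - τ) := by
  rw [← normSq_eq_norm_sq, normSq_apply, circleMap_eq, pt_eq, pt_eq, Real.cos_sub]
  simp only [add_re, ofReal_re, mul_re, I_re, mul_zero, ofReal_im, I_im, mul_one, sub_self,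
    add_zero, add_im, mul_im, zero_add, zero_mul, sub_zero]
  have h1 := Real.sin_sq_add_cos_sq t
  have h2 := Real.sin_sq_add_cos_sq τ
  linear_combination h2 + ε ^ 2 * h1

lemma ae_norm_pt_sub_ne (τ : ℝ) {ε : ℝ} : ∀ᵐ u : ℝ, ‖pt u - pt τ‖ ≠ ε := by
  filter_upwards [ae_cos_sub_ne τ (1 - ε ^ 2 / 2)] with u hu h
  have := norm_sq_pt_sub_pt u τ
  rw [h] at this
  exact hu (by linarith)

lemma ae_circleMap_mem_offCircle (τ : ℝ) {ε : ℝ} (hε : 0 < ε) :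
    ∀ᵐ t : ℝ, circleMap (pt τ) ε t ∈ offCircle := by
  filter_upwards [ae_cos_sub_ne τ (-(ε / 2))] with t ht h
  have := norm_sq_circleMap τ ε t
  rw [h] at this
  apply ht
  have h1 : ε * (ε + 2 * Real.cos (t - τ)) = 0 := by linarith
  rcases mul_eq_zero.1 h1 with h2 | h2
  · exact absurd h2 hε.ne'
  · linarith

/-- The singularity of the Cauchy kernel at the crossings of the unit circle with a small circle
around one of its points is dominated by a product of integrable functions. -/
lemma inv_norm_pt_sub_circleMap_le (τ : ℝ) {ε : ℝ} (hε : 0 < ε) (hε1 : ε < 1) {u t : ℝ}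
    (hu : Real.cos (u - τ) ≠ 1 - ε ^ 2 / 2) (ht : Real.cos (t - τ) ≠ -(ε / 2)) :
    ‖pt u - circleMap (pt τ) ε t‖⁻¹ ≤ (3 / (2 * ε)) *
      ((√|Real.cos (t - τ) - -(ε / 2)|)⁻¹ * (√|Real.cos (u - τ) - (1 - ε ^ 2 / 2)|)⁻¹) := by
  set z := circleMap (pt τ) ε t with hz
  set a := |Real.cos (u - τ) - (1 - ε ^ 2 / 2)| with ha
  set b := |Real.cos (t - τ) - -(ε / 2)| with hb
  have ha0 : 0 < a := abs_pos.2 (sub_ne_zero.2 hu)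
  have hb0 : 0 < b := abs_pos.2 (sub_ne_zero.2 ht)
  have h1 := norm_sq_pt_sub_pt u τ
  have h2 := norm_sq_circleMap τ ε t
  rw [← hz] at h2
  have hzc : ‖z - pt τ‖ = ε := by
    rw [hz, circleMap_eq, add_sub_cancel_left, norm_mul, norm_pt, Complex.norm_real,
      Real.norm_of_nonneg hε.le, mul_one]
  set X := ‖pt u - pt τ‖ with hX
  set Z := ‖z‖ with hZ
  have hX0 : 0 ≤ X := norm_nonneg _
  have hZ0 : 0 ≤ Z := norm_nonneg _
  have hX2 : X ≤ 2 := by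
    have := norm_sub_le (pt u) (pt τ)
    rw [norm_pt, norm_pt] at this
    linarith
  have hZ2 : Z ≤ 2 := by
    have : ‖z‖ ≤ ‖pt τ‖ + ‖z - pt τ‖ := by simpa using norm_add_le (pt τ) (z - pt τ)
    rw [norm_pt, hzc] at this
    linarith
  -- The distance `|x - z|` is bounded below in two ways: by how far `x` is from the small circle
  -- and by how far `z` is from the unit circle. Each quantity is expressed through one cosine; the
  -- `3` below bounds `X + ε` and `1 + Z`.
  have hd1 : |X - ε| ≤ ‖pt u - z‖ := by
    have := abs_norm_sub_norm_le (pt u - pt τ) (z - pt τ)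
    rwa [hzc, sub_sub_sub_cancel_right] at this
  have hd2 : |1 - Z| ≤ ‖pt u - z‖ := by
    have := abs_norm_sub_norm_le (pt u) z
    rwa [norm_pt] at this
  have ha1 : 2 * a = |X - ε| * (X + ε) := by
    rw [← abs_of_nonneg (by linarith : 0 ≤ X + ε), ← abs_mul, ha, ← abs_two, ← abs_mul,
      ← abs_neg]
    congr 1
    rw [abs_two]
    linear_combination -h1
  have hb1 : 2 * ε * b = |1 - Z| * (1 + Z) := by
    rw [← abs_of_nonneg (by linarith : 0 ≤ 1 + Z), ← abs_mul, hb,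
      ← abs_of_nonneg (by linarith : 0 ≤ 2 * ε), ← abs_mul, ← abs_neg]
    congr 1
    linear_combination h2
  have ha2 : (2 * ε / 3) * a ≤ ‖pt u - z‖ := by
    have h3 : |X - ε| * (X + ε) ≤ |X - ε| * 3 :=
      mul_le_mul_of_nonneg_left (by linarith) (abs_nonneg _)
    nlinarith
  have hb2 : (2 * ε / 3) * b ≤ ‖pt u - z‖ := by
    have h3 : |1 - Z| * (1 + Z) ≤ |1 - Z| * 3 :=
      mul_le_mul_of_nonneg_left (by linarith) (abs_nonneg _)
    nlinarith
  -- The geometric mean is at most the maximum. It replaces the two bounds by a product in which the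
  -- variables `u` and `t` are separated.
  have hab : (2 * ε / 3) * (√b * √a) ≤ ‖pt u - z‖ := by
    rcases le_total a b with h | h
    · have h3 : √b * √a ≤ b := by
        calc √b * √a ≤ √b * √b := by gcongr
          _ = b := Real.mul_self_sqrt hb0.le
      exact (by gcongr : (2 * ε / 3) * (√b * √a) ≤ (2 * ε / 3) * b).trans hb2
    · have h3 : √b * √a ≤ a := by
        calc √b * √a ≤ √a * √a := by gcongr
          _ = a := Real.mul_self_sqrt ha0.le
      exact (by gcongr : (2 * ε / 3) * (√b * √a) ≤ (2 * ε / 3) * a).trans ha2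
  calc ‖pt u - z‖⁻¹ ≤ ((2 * ε / 3) * (√b * √a))⁻¹ := by
        apply inv_anti₀ _ hab
        positivity
    _ = _ := by rw [mul_inv, mul_inv, inv_div]

/-! ### Cauchy transforms integrated along small circles. -/

/-- Integral of an entire function against the Cauchy kernel along a circle. -/
lemma circleIntegral_div_sub {f : ℂ → ℂ} (hf : Differentiable ℂ f) {c x : ℂ} {ε : ℝ} (hε : 0 < ε)
    (hx : ‖x - c‖ ≠ ε) :
    (2 * Real.pi * I)⁻¹ * (∮ z in C(c, ε), f z / (x - z)) = if ‖x - c‖ < ε then -f x else 0 := by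
  split_ifs with h
  · have h1 := hf.differentiableOn.circleIntegral_sub_inv_smul (c := c) (R := ε) (w := x)
      (by simpa [dist_eq_norm] using h)
    have h2 : (∮ z in C(c, ε), f z / (x - z)) = -(∮ z in C(c, ε), (z - x)⁻¹ • f z) := by
      rw [← neg_one_mul, ← circleIntegral.integral_const_mul]
      congr 1; ext z
      rw [smul_eq_mul, neg_one_mul, ← neg_sub z x, div_neg, div_eq_mul_inv, mul_comm]
    rw [h2, h1, smul_eq_mul, mul_neg, inv_mul_cancel_left₀ two_pi_I_ne_zero]
  · have hne : ∀ z ∈ Metric.closedBall c ε, x - z ≠ 0 := by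
      intro z hz
      rw [sub_ne_zero]
      rintro rfl
      have h1 : ‖x - c‖ ≤ ε := by simpa [dist_eq_norm] using hz
      exact h (lt_of_le_of_ne h1 hx)
    rw [circleIntegral_eq_zero_of_differentiable_on_off_countable hε.le Set.countable_empty,
      mul_zero]
    · exact hf.continuous.continuousOn.div (by fun_prop) hne
    · rintro z ⟨hz, -⟩
      exact hf.differentiableAt.div (by fun_prop) (hne z (Metric.ball_subset_closedBall hz))

/-- Integral of the Cauchy transform of an arc along a small circle that crosses the arc. -/
lemma circleIntegral_mul_cauchyArc {α β : ℝ} (hab : α ≤ β) {φ : ℂ → ℂ} (hφ : ContArc α β φ)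
    {f : ℂ → ℂ} (hf : Differentiable ℂ f) (τ : ℝ) {ε : ℝ} (hε : 0 < ε) (hε1 : ε < 1) :
    CircleIntegrable (fun z => f z * arcIntegral α β (fun x => φ x / (x - z))) (pt τ) ε ∧
    (2 * Real.pi * I)⁻¹ *
        (∮ z in C(pt τ, ε), f z * arcIntegral α β (fun x => φ x / (x - z))) =
      arcIntegral α β (fun x => φ x * if ‖x - pt τ‖ < ε then -f x else 0) := by
  have hpi := Real.pi_gt_three
  have hpi0 : (0 : ℝ) ≤ 2 * Real.pi := by linarith
  set ζ : ℝ → ℂ := circleMap (pt τ) ε with hζ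
  have hζc : Continuous ζ := continuous_circleMap _ _
  set Φ : ℝ → ℝ → ℂ := fun t u =>
    f (ζ t) * (φ (pt u) / (pt u - ζ t) * (pt u * I) / (2 * Real.pi * I)) with hΦ
  set μ := volume.restrict (Set.uIoc 0 (2 * Real.pi)) with hμ
  set ν := volume.restrict (Set.uIoc α β) with hν
  obtain ⟨Cφ, hCφ0, hCφ⟩ := hφ.exists_bound hab
  obtain ⟨Cf, hCf⟩ : ∃ C, ∀ t ∈ Set.Icc 0 (2 * Real.pi), ‖f (ζ t)‖ ≤ C :=
    isCompact_Icc.exists_bound_of_continuousOn (hf.continuous.comp hζc).continuousOn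
  have hCf0 : 0 ≤ Cf := (norm_nonneg _).trans (hCf 0 ⟨le_rfl, hpi0⟩)
  have hmeas : AEStronglyMeasurable (Function.uncurry Φ) (μ.prod ν) := by
    have h1 : AEStronglyMeasurable (fun p : ℝ × ℝ => φ (pt p.2)) (μ.prod ν) :=
      (hφ.aestronglyMeasurable hab).comp_snd
    have h2 : Measurable fun p : ℝ × ℝ => (pt p.2 - ζ p.1)⁻¹ :=
      ((continuous_pt.comp continuous_snd).sub (hζc.comp continuous_fst)).measurable.inv
    have h3 : Continuous fun p : ℝ × ℝ => f (ζ p.1) := hf.continuous.comp (hζc.comp continuous_fst)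
    have h4 : Continuous fun p : ℝ × ℝ => pt p.2 * I / (2 * Real.pi * I) :=
      ((continuous_pt.comp continuous_snd).mul continuous_const).div_const _
    refine ((h3.aestronglyMeasurable.mul (h1.mul h2.aestronglyMeasurable)).mul
      h4.aestronglyMeasurable).congr (ae_of_all _ fun p => ?_)
    simp only [Function.uncurry, hΦ, Pi.mul_apply]
    ring
  have hκ1 : |1 - ε ^ 2 / 2| < 1 := by rw [abs_lt]; constructor <;> nlinarith
  have hκ2 : |-(ε / 2)| < 1 := by rw [abs_lt]; constructor <;> linarith
  have hI1 : Integrable (fun t => (√|Real.cos (t - τ) - -(ε / 2)|)⁻¹) μ := by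
    have h1 := (intervalIntegrable_inv_sqrt_cos_sub hκ2 (0 - τ) (2 * Real.pi - τ)).comp_sub_right τ
    rw [sub_add_cancel, sub_add_cancel] at h1
    exact h1.def'
  have hI2 : Integrable (fun u => (√|Real.cos (u - τ) - (1 - ε ^ 2 / 2)|)⁻¹) ν := by
    have h1 := (intervalIntegrable_inv_sqrt_cos_sub hκ1 (α - τ) (β - τ)).comp_sub_right τ
    rw [sub_add_cancel, sub_add_cancel] at h1
    exact h1.def'
  -- The double integral converges absolutely, being dominated by a product of two integrable
  -- functions of one variable.
  have hint : Integrable (Function.uncurry Φ) (μ.prod ν) := by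
    refine ((hI1.mul_prod hI2).const_mul (Cf * Cφ * (3 / (2 * ε)))).mono' hmeas ?_
    have h1 : ∀ᵐ t ∂μ, Real.cos (t - τ) ≠ -(ε / 2) ∧ t ∈ Set.uIoc 0 (2 * Real.pi) :=
      (ae_restrict_of_ae (ae_cos_sub_ne τ _)).and (ae_restrict_mem measurableSet_uIoc)
    have h2 : ∀ᵐ u ∂ν, Real.cos (u - τ) ≠ 1 - ε ^ 2 / 2 ∧ u ∈ Set.uIoc α β :=
      (ae_restrict_of_ae (ae_cos_sub_ne τ _)).and (ae_restrict_mem measurableSet_uIoc)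
    filter_upwards [Measure.quasiMeasurePreserving_fst.ae h1,
      Measure.quasiMeasurePreserving_snd.ae h2] with p hp1 hp2
    have h3 := inv_norm_pt_sub_circleMap_le τ hε hε1 hp2.1 hp1.1
    have h4 := hp1.2
    have h5 := hp2.2
    rw [Set.uIoc_of_le hpi0] at h4
    rw [Set.uIoc_of_le hab] at h5
    simp only [Function.uncurry, hΦ, norm_mul, norm_div, norm_pt, norm_I, Complex.norm_real,
      Real.norm_eq_abs, abs_of_pos Real.pi_pos, Complex.norm_ofNat, mul_one]
    calc ‖f (ζ p.1)‖ * (‖φ (pt p.2)‖ / ‖pt p.2 - ζ p.1‖ / (2 * Real.pi))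
        ≤ Cf * (Cφ * ((3 / (2 * ε)) * ((√|Real.cos (p.1 - τ) - -(ε / 2)|)⁻¹ *
          (√|Real.cos (p.2 - τ) - (1 - ε ^ 2 / 2)|)⁻¹))) := by
          gcongr
          · exact hCf _ ⟨h4.1.le, h4.2⟩
          · refine (div_le_self (by positivity) (by linarith)).trans ?_
            rw [div_eq_mul_inv]
            gcongr
            exact hCφ _ ⟨h5.1.le, h5.2⟩
      _ = _ := by ring
  have hinner : ∀ t, ∫ u, Φ t u ∂ν = f (ζ t) * arcIntegral α β (fun x => φ x / (x - ζ t)) := by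
    intro t
    rw [arcIntegral, intervalIntegral.integral_of_le hab, hν, Set.uIoc_of_le hab,
      ← integral_const_mul]
  constructor
  · have h1 := hint.integral_prod_left
    simp only [Function.uncurry, hinner] at h1
    rw [CircleIntegrable, intervalIntegrable_iff]
    exact h1
  · have hint' : Integrable (Function.uncurry fun t u => deriv ζ t * Φ t u) (μ.prod ν) := by
      have hdz : ∀ t, ‖deriv ζ t‖ ≤ ε := fun t => by
        rw [hζ, deriv_circleMap, norm_mul, norm_I, mul_one, norm_circleMap_zero, abs_of_pos hε]
      have hdm : AEStronglyMeasurable (fun p : ℝ × ℝ => deriv ζ p.1) (μ.prod ν) := by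
        simp only [hζ, deriv_circleMap]
        exact (((continuous_circleMap 0 ε).comp continuous_fst).mul
          continuous_const).aestronglyMeasurable
      exact hint.bdd_mul hdm (ae_of_all _ fun p => hdz p.1)
    -- After the exchange the circle integral is inner, and Cauchy's formula evaluates it for every
    -- `x` off the small circle, that is for almost every `u`.
    have hswap := integral_integral_swap hint'
    have hlhs : (∮ z in C(pt τ, ε), f z * arcIntegral α β (fun x => φ x / (x - z))) =
        ∫ t, ∫ u, deriv ζ t * Φ t u ∂ν ∂μ := by
      rw [circleIntegral, intervalIntegral.integral_of_le hpi0, hμ, Set.uIoc_of_le hpi0]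
      refine integral_congr_ae (ae_of_all _ fun t => ?_)
      simp only [integral_const_mul, hinner, smul_eq_mul]
      rfl
    rw [hlhs, hswap, arcIntegral, intervalIntegral.integral_of_le hab, hν, Set.uIoc_of_le hab,
      ← integral_const_mul]
    refine integral_congr_ae ?_
    filter_upwards [ae_restrict_of_ae (ae_norm_pt_sub_ne τ (ε := ε))] with u hu
    have h1 := circleIntegral_div_sub hf hε hu
    rw [← h1, circleIntegral, intervalIntegral.integral_of_le hpi0, hμ, Set.uIoc_of_le hpi0,
      ← integral_const_mul, ← integral_const_mul, ← integral_const_mul, ← integral_mul_const,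
      ← integral_div]
    refine integral_congr_ae (ae_of_all _ fun t => ?_)
    simp only [hΦ, smul_eq_mul]
    ring

/-! ### The integrand of the Malgrange form for triangular jumps. -/

lemma upper_inv (u : ℂ) : (upper u)⁻¹ = upper (-u) := by
  refine Matrix.inv_eq_right_inv ?_
  ext i k
  fin_cases i <;> fin_cases k <;> simp [upper, Matrix.mul_apply, Fin.sum_univ_two]

lemma derivPar_upper {E : Type*} [NormedAddCommGroup E] [NormedSpace ℝ E] (f : E → ℂ → ℂ)
    (s v : E) (z : ℂ) :
    derivPar (fun s' z => upper (f s' z)) s v z = !![0, fderiv ℝ (fun s' => f s' z) s v; 0, 0] := by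
  ext i k
  fin_cases i <;> fin_cases k <;> simp [derivPar, upper]

lemma derivPar_const {E : Type*} [NormedAddCommGroup E] [NormedSpace ℝ E]
    (f : ℂ → Matrix (Fin 2) (Fin 2) ℂ) (s v : E) (z : ℂ) :
    derivPar (fun _ z => f z) s v z = 0 := by
  ext i k
  simp [derivPar]

lemma derivZ_upper (f : ℂ → ℂ) (z : ℂ) :
    derivZ (fun z => upper (f z)) z = !![0, deriv f z; 0, 0] := by
  ext i k
  fin_cases i <;> fin_cases k <;> simp [derivZ, upper]

/-- Both factors are strictly upper triangular of size two, so their product is zero. -/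
lemma trace_upper_vartheta (a b u : ℂ) :
    Matrix.trace (!![0, a; 0, 0] * (upper u)⁻¹ * (!![0, b; 0, 0] * (upper u)⁻¹)) = 0 := by
  rw [upper_inv, upper]
  simp [Matrix.trace_fin_two]

/-- The integrand of the Malgrange form for a triangular jump matrix only involves the first
column of the solution. -/
lemma trace_innerLim {G : ℂ → Matrix (Fin 2) (Fin 2) ℂ} {c x : ℂ} {r : ℝ} (hr : 0 < r)
    (hx : ‖x - c‖ = r) {p q : Polynomial ℂ} {O : Set ℂ} (hO : IsOpen O)
    (hOx : O ∈ 𝓝[Metric.ball c r] x) (hp : ∀ z ∈ O, G z 0 0 = p.eval z)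
    (hq : ∀ z ∈ O, G z 1 0 = q.eval z)
    (hdet : ∀ z ∈ O, G z 0 0 * G z 1 1 - G z 0 1 * G z 1 0 = 1)
    (hlim : ∀ i, ∃ L, Tendsto (fun z => G z i 1) (𝓝[Metric.ball c r] x) (𝓝 L)) (d u : ℂ) :
    Matrix.trace ((innerLim c r G x)⁻¹ * innerLim c r (derivZ G) x *
      (!![0, d; 0, 0] * (upper u)⁻¹)) =
      -(q.eval x * p.derivative.eval x - p.eval x * q.derivative.eval x) * d := by
  have := neBot_inner hr hx
  choose L hL using hlim
  have hpoly : ∀ f : Polynomial ℂ, Tendsto (fun z => f.eval z) (𝓝[Metric.ball c r] x)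
      (𝓝 (f.eval x)) := fun f => f.continuous.continuousAt.tendsto.mono_left nhdsWithin_le_nhds
  have h0 : ∀ (i : Fin 2) (f : Polynomial ℂ), (∀ z ∈ O, G z i 0 = f.eval z) →
      Tendsto (fun z => G z i 0) (𝓝[Metric.ball c r] x) (𝓝 (f.eval x)) ∧
      Tendsto (fun z => derivZ G z i 0) (𝓝[Metric.ball c r] x) (𝓝 (f.derivative.eval x)) := by
    intro i f hf
    refine ⟨(hpoly f).congr' ?_, (hpoly f.derivative).congr' ?_⟩
    · filter_upwards [hOx] with z hz using (hf z hz).symm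
    · filter_upwards [hOx] with z hz
      have h1 : (fun y => G y i 0) =ᶠ[𝓝 z] fun y => f.eval y := by
        filter_upwards [hO.mem_nhds hz] with y hy using hf y hy
      simp only [derivZ, Matrix.of_apply]
      rw [h1.deriv_eq, Polynomial.deriv]
  obtain ⟨hp1, hp2⟩ := h0 0 p hp
  obtain ⟨hq1, hq2⟩ := h0 1 q hq
  have hd : p.eval x * L 1 - L 0 * q.eval x = 1 := by
    refine tendsto_nhds_unique ((hp1.mul (hL 1)).sub ((hL 0).mul hq1)) ?_
    refine tendsto_const_nhds.congr' ?_
    filter_upwards [hOx] with z hz using (hdet z hz).symm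
  have hA : innerLim c r G x = !![p.eval x, L 0; q.eval x, L 1] := by
    ext i k
    fin_cases i <;> fin_cases k
    · exact hp1.limUnder_eq
    · exact (hL 0).limUnder_eq
    · exact hq1.limUnder_eq
    · exact (hL 1).limUnder_eq
  have hA' : (innerLim c r G x)⁻¹ = !![L 1, -L 0; -q.eval x, p.eval x] := by
    rw [hA, Matrix.inv_def, Matrix.det_fin_two_of, hd, Ring.inverse_one, one_smul,
      Matrix.adjugate_fin_two_of]
  -- Only the first column of `B` enters the trace. The derivative of the second column need not
  -- have a limit; the junk values of `limUnder` are then harmless.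
  set B := innerLim c r (derivZ G) x with hB
  have hB0 : B 0 0 = p.derivative.eval x := hp2.limUnder_eq
  have hB1 : B 1 0 = q.derivative.eval x := hq2.limUnder_eq
  rw [hA', upper_inv, upper, Matrix.eta_fin_two B, hB0, hB1]
  simp [Matrix.trace_fin_two]
  left
  ring

/-! ### Evaluation of the modified Malgrange form. -/

namespace SymbolFamily

variable {E : Type*} [NormedAddCommGroup E] [NormedSpace ℝ E] {m : ℕ} (F : SymbolFamily E m)
  {s : E} {n : ℕ} {ε R : ℝ} {Γ : ℂ → Matrix (Fin 2) (Fin 2) ℂ}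

lemma norm_β (s : E) (j : Fin (m + 1)) : ‖F.β s j‖ = 1 := norm_pt _

/-- On the arcs and the small circles the jump is unipotent triangular; on the big circle it does
not depend on the parameters. -/
lemma varthetaForm_contour (v : E) : varthetaForm (F.contour n s ε R) s v = 0 := by
  rw [varthetaForm, Fintype.sum_sum_type, Fintype.sum_sum_type]
  have h1 : ∀ i, ∀ x, Matrix.trace (derivZ ((F.contour n s ε R i).jump s) x *
      ((F.contour n s ε R i).jump s x)⁻¹ * (derivPar (F.contour n s ε R i).jump s v x *
        ((F.contour n s ε R i).jump s x)⁻¹)) = 0 := by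
    intro i x
    rcases i with j | j | u
    · simp only [contour, derivPar_upper (fun s' => F.weight n s' j), derivZ_upper,
        trace_upper_vartheta]
    · simp only [contour, derivPar_upper (fun s' z => - cauchy (F.θ s') (F.weight n s') z),
        derivZ_upper, trace_upper_vartheta]
    · simp [contour, derivPar_const]
  simp [h1, JumpArc.integral]

lemma cloak_of_mem_ball (h : F.Admissible s ε R) {j : Fin (m + 1)} {z : ℂ}
    (hz : z ∈ Metric.ball (F.β s j) ε) :
    F.cloak n s ε R Γ z = Γ z * upper (cauchy (F.θ s) (F.weight n s) z) := by
  have hz' : ‖z - F.β s j‖ < ε := by simpa [dist_eq_norm] using hz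
  have h1 : ‖z‖ ≤ ‖F.β s j‖ + ‖z - F.β s j‖ := by simpa using norm_add_le (F.β s j) (z - F.β s j)
  rw [F.norm_β] at h1
  rw [cloak, if_neg (by linarith [h.2.2.1]), if_pos ⟨j, hz'⟩]

lemma cloak_of_forall_lt (h : F.Admissible s ε R) {z : ℂ} (hz : z ∈ Metric.ball (0 : ℂ) 1)
    (hz' : ∀ j, ε < ‖z - F.β s j‖) : F.cloak n s ε R Γ z = Γ z := by
  have h1 : ‖z‖ < 1 := by simpa using hz
  rw [cloak, if_neg (by linarith [h.1, h.2.2.1]), if_neg]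
  rintro ⟨j, hj⟩
  exact lt_asymm hj (hz' j)

/-- The integrand of the Malgrange form on the arcs. -/
lemma trace_arc (hs : s ∈ F.U) (h : F.Admissible s ε R)
    (hΓ : IsRHSolution n (F.θ s) (F.weight n s) Γ)
    {p q : Polynomial ℂ} (hp : ∀ z ∈ offCircle, Γ z 0 0 = p.eval z)
    (hq : ∀ z ∈ offCircle, Γ z 1 0 = q.eval z) {j : Fin (m + 1)} {t : ℝ}
    (ht : t ∈ Set.Ioo (F.θ s j) (nextAngle (F.θ s) j)) (ht' : ∀ k, ε < ‖pt t - F.β s k‖) (v : E) :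
    Matrix.trace ((innerLim 0 1 (F.cloak n s ε R Γ) (pt t))⁻¹ *
      innerLim 0 1 (derivZ (F.cloak n s ε R Γ)) (pt t) *
      (derivPar (fun s' z => upper (F.weight n s' j z)) s v (pt t) *
        (upper (F.weight n s j (pt t)))⁻¹)) =
      -(q.eval (pt t) * p.derivative.eval (pt t) - p.eval (pt t) * q.derivative.eval (pt t)) *
        (pt t ^ (-(n : ℤ)) * fderiv ℝ (fun s' => F.a s' j (pt t)) s v) := by
  set O : Set ℂ := Metric.ball 0 1 ∩ ⋂ k, {z | ε < ‖z - F.β s k‖} with hO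
  have hO2 : IsOpen (⋂ k, {z : ℂ | ε < ‖z - F.β s k‖}) :=
    isOpen_iInter_of_finite fun k => isOpen_lt continuous_const (by fun_prop)
  have hOx : O ∈ 𝓝[Metric.ball 0 1] (pt t) := by
    refine inter_mem self_mem_nhdsWithin (mem_nhdsWithin_of_mem_nhds (hO2.mem_nhds ?_))
    exact Set.mem_iInter.2 ht'
  have hcl : ∀ z ∈ O, F.cloak n s ε R Γ z = Γ z := fun z hz =>
    F.cloak_of_forall_lt h hz.1 (Set.mem_iInter.1 hz.2)
  have hoff : ∀ z ∈ O, z ∈ offCircle := fun z hz => ball_subset_offCircle hz.1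
  rw [derivPar_upper (fun s' => F.weight n s' j)]
  have hderiv : fderiv ℝ (fun s' => F.weight n s' j (pt t)) s v =
      pt t ^ (-(n : ℤ)) * fderiv ℝ (fun s' => F.a s' j (pt t)) s v := by
    have h1 := F.hasFDerivAt_a (F.arc_subset j s hs t ⟨ht.1.le, ht.2.le⟩)
    simp only [weight]
    rw [(h1.const_mul _).fderiv]
    rfl
  rw [hderiv]
  obtain ⟨Γm, hm, -, -⟩ := hΓ.exists_limits ht
  refine trace_innerLim one_pos (by simp [norm_pt]) (Metric.isOpen_ball.inter hO2) hOx
    (fun z hz => by rw [hcl z hz, hp z (hoff z hz)]) (fun z hz => by rw [hcl z hz, hq z (hoff z hz)])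
    (fun z hz => by rw [hcl z hz, hΓ.det_eq_one (hoff z hz)]) (fun i => ⟨Γm i 1, ?_⟩) _ _
  refine (hm i 1).congr' ?_
  filter_upwards [hOx] with z hz
  rw [hcl z hz]

/-- The derivative of the Cauchy transform in the parameter. -/
lemma fderiv_cauchy (hs : s ∈ F.U) {z : ℂ} (hz : z ∈ offCircle) (v : E) :
    fderiv ℝ (fun s' => - cauchy (F.θ s') (F.weight n s') z) s v =
      -F.variation s v (fun x => x ^ (-(n : ℤ)) / (x - z)) := by
  have hg : Continuous fun t => pt t ^ (-(n : ℤ)) / (pt t - z) :=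
    (continuous_pt.zpow₀ _ fun t => Or.inl (pt_ne_zero t)).div₀
      (continuous_pt.sub continuous_const) fun t => sub_ne_zero.2 (pt_ne_of_mem_offCircle hz t)
  obtain ⟨L, hL, hLv⟩ :=
    F.exists_hasFDerivAt_arcInt hs (g := fun x => x ^ (-(n : ℤ)) / (x - z)) hg
  have h1 : (fun s' => - cauchy (F.θ s') (F.weight n s') z) = fun s' =>
      -arcInt (F.θ s') (fun j x => x ^ (-(n : ℤ)) / (x - z) * F.a s' j x) := by
    ext s'
    rw [cauchy]
    congr 1
    refine arcInt_congr _ fun j t => ?_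
    simp only [weight]
    ring
  rw [h1, hL.fun_neg.fderiv, ← hLv]
  rfl

/-- The integrand of the Malgrange form on the small circles. -/
lemma trace_circle (hs : s ∈ F.U) (h : F.Admissible s ε R)
    (hΓ : IsRHSolution n (F.θ s) (F.weight n s) Γ)
    {p q : Polynomial ℂ} (hp : ∀ z ∈ offCircle, Γ z 0 0 = p.eval z)
    (hq : ∀ z ∈ offCircle, Γ z 1 0 = q.eval z) {j : Fin (m + 1)} {x : ℂ}
    (hx : ‖x - F.β s j‖ = ε) (hxo : x ∈ offCircle) (v : E) :
    Matrix.trace ((innerLim (F.β s j) ε (F.cloak n s ε R Γ) x)⁻¹ *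
      innerLim (F.β s j) ε (derivZ (F.cloak n s ε R Γ)) x *
      (derivPar (fun s' z => upper (- cauchy (F.θ s') (F.weight n s') z)) s v x *
        (upper (- cauchy (F.θ s) (F.weight n s) x))⁻¹)) =
      (q.eval x * p.derivative.eval x - p.eval x * q.derivative.eval x) *
        F.variation s v (fun y => y ^ (-(n : ℤ)) / (y - x)) := by
  have hP := F.piecewiseHol_weight n hs
  have hOx : Metric.ball (F.β s j) ε ∩ offCircle ∈ 𝓝[Metric.ball (F.β s j) ε] x :=
    inter_mem self_mem_nhdsWithin (mem_nhdsWithin_of_mem_nhds (isOpen_offCircle.mem_nhds hxo))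
  -- Multiplication by a unipotent upper triangular matrix changes neither the first column nor the
  -- determinant.
  have hcl : ∀ z ∈ Metric.ball (F.β s j) ε ∩ offCircle, ∀ i, F.cloak n s ε R Γ z i 0 = Γ z i 0 ∧
      F.cloak n s ε R Γ z i 1 = Γ z i 0 * cauchy (F.θ s) (F.weight n s) z + Γ z i 1 := by
    intro z hz i
    rw [F.cloak_of_mem_ball h hz.1]
    simp [Matrix.mul_apply, Fin.sum_univ_two, upper]
  rw [derivPar_upper (fun s' z => - cauchy (F.θ s') (F.weight n s') z), F.fderiv_cauchy hs hxo,
    trace_innerLim h.1 hx (Metric.isOpen_ball.inter isOpen_offCircle) hOx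
      (fun z hz => by rw [(hcl z hz 0).1, hp z hz.2])
      (fun z hz => by rw [(hcl z hz 1).1, hq z hz.2])
      (fun z hz => by
        rw [(hcl z hz 0).1, (hcl z hz 0).2, (hcl z hz 1).1, (hcl z hz 1).2]
        linear_combination hΓ.det_eq_one hz.2)]
  · ring
  · intro i
    have hc : ∀ f : ℂ → ℂ, DifferentiableOn ℂ f offCircle →
        Tendsto f (𝓝[Metric.ball (F.β s j) ε] x) (𝓝 (f x)) := fun f hf =>
      (hf.continuousOn.continuousAt (isOpen_offCircle.mem_nhds hxo)).tendsto.mono_left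
        nhdsWithin_le_nhds
    refine ⟨_, (((hc _ (hΓ.holomorphic i 0)).mul (hc _ hP.cauchy_differentiableOn)).add
      (hc _ (hΓ.holomorphic i 1))).congr' ?_⟩
    filter_upwards [hOx] with z hz using (hcl z hz i).2.symm

/-- The contribution of a small circle to the Malgrange form. -/
lemma circleIntegral_mul_variation (hs : s ∈ F.U) (h : F.Admissible s ε R) {f : ℂ → ℂ}
    (hf : Differentiable ℂ f) (j : Fin (m + 1)) (v : E) :
    (2 * Real.pi * I)⁻¹ * (∮ z in C(F.β s j, ε), f z *
        F.variation s v (fun x => x ^ (-(n : ℤ)) / (x - z))) =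
      (∑ k, arcIntegral (F.θ s k) (nextAngle (F.θ s) k) (fun x =>
        (x ^ (-(n : ℤ)) * fderiv ℝ (fun s' => F.a s' k x) s v) *
          if ‖x - F.β s j‖ < ε then -f x else 0)) -
      F.Δ n s j / (2 * Real.pi * I) * f (F.β s j) * fderiv ℝ (fun s' => F.β s' j) s v := by
  obtain ⟨hε, hε1, -, hdisj⟩ := h
  have hP := F.piecewiseHol_weight n hs
  set φ : Fin (m + 1) → ℂ → ℂ := fun k x =>
    x ^ (-(n : ℤ)) * fderiv ℝ (fun s' => F.a s' k x) s v with hφ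
  have hφc : ∀ k, ContArc (F.θ s k) (nextAngle (F.θ s) k) (φ k) := fun k =>
    ContinuousOn.mul (continuous_pt.zpow₀ _ fun t => Or.inl (pt_ne_zero t)).continuousOn
      (F.contArc_fderiv_a hs k v)
  set D : Fin (m + 1) → ℂ := fun k =>
    F.Δ n s k / (2 * Real.pi * I) * fderiv ℝ (fun s' => F.β s' k) s v with hD
  have hsplit : ∀ z, f z * F.variation s v (fun x => x ^ (-(n : ℤ)) / (x - z)) =
      (∑ k, f z * arcIntegral (F.θ s k) (nextAngle (F.θ s) k) (fun x => φ k x / (x - z))) +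
        ∑ k, D k * (f z / (F.β s k - z)) := by
    intro z
    rw [variation, arcInt_eq_sum, mul_add, Finset.mul_sum, Finset.mul_sum]
    congr 1
    · refine Finset.sum_congr rfl fun k _ => ?_
      congr 2
      ext x
      simp only [hφ]
      ring
    · refine Finset.sum_congr rfl fun k _ => ?_
      simp only [hD, Δ, weight]
      ring
  -- No `β_k` lies on the small circle. Only the pole at its own centre is enclosed, so the sum over
  -- `k` reduces to `k = j`.
  have hne : ∀ k, ‖F.β s k - F.β s j‖ ≠ ε := by
    intro k
    by_cases hk : k = j
    · rw [hk, sub_self, norm_zero]; exact hε.ne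
    · have := hdisj k j hk
      linarith
  have hcircle : ∀ k, CircleIntegrable (fun z => f z * arcIntegral (F.θ s k)
        (nextAngle (F.θ s) k) (fun x => φ k x / (x - z))) (F.β s j) ε ∧
      (2 * Real.pi * I)⁻¹ * (∮ z in C(F.β s j, ε), f z * arcIntegral (F.θ s k)
        (nextAngle (F.θ s) k) (fun x => φ k x / (x - z))) =
      arcIntegral (F.θ s k) (nextAngle (F.θ s) k) (fun x =>
        φ k x * if ‖x - F.β s j‖ < ε then -f x else 0) := fun k =>
    circleIntegral_mul_cauchyArc (hP.le_nextAngle k) (hφc k) hf (F.θ s j) hε hε1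
  have hpole : ∀ k, CircleIntegrable (fun z => D k * (f z / (F.β s k - z))) (F.β s j) ε := by
    intro k
    refine ContinuousOn.circleIntegrable hε.le ?_
    refine continuousOn_const.mul (hf.continuous.continuousOn.div (by fun_prop) fun z hz => ?_)
    rw [sub_ne_zero]
    rintro rfl
    exact hne k (by simpa [dist_eq_norm] using hz)
  simp only [hsplit]
  rw [circleIntegral.integral_add (CircleIntegrable.fun_sum _ fun k _ => (hcircle k).1)
      (CircleIntegrable.fun_sum _ fun k _ => hpole k),
    circleIntegral.integral_fun_sum fun k _ => (hcircle k).1,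
    circleIntegral.integral_fun_sum fun k _ => hpole k, mul_add, Finset.mul_sum, Finset.mul_sum,
    sub_eq_add_neg]
  congr 1
  · exact Finset.sum_congr rfl fun k _ => (hcircle k).2
  · have h1 : ∀ k, (2 * Real.pi * I)⁻¹ * (∮ z in C(F.β s j, ε), D k * (f z / (F.β s k - z))) =
        if k = j then -(D j * f (F.β s j)) else 0 := by
      intro k
      rw [circleIntegral.integral_const_mul, mul_left_comm, circleIntegral_div_sub hf hε (hne k)]
      by_cases hk : k = j
      · rw [if_pos hk, hk, if_pos (by simpa using hε)]; ring
      · have := hdisj k j hk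
        rw [if_neg hk, if_neg (by linarith), mul_zero]
    rw [Finset.sum_congr rfl fun k _ => h1 k, Finset.sum_ite_eq', if_pos (Finset.mem_univ j)]
    ring

/-- The pieces of an arc inside and outside the small discs add up to the whole arc. -/
lemma arc_pieces (hs : s ∈ F.U) (h : F.Admissible s ε R) {f φ : ℂ → ℂ} (hf : Continuous f)
    (k : Fin (m + 1)) (hφ : ContArc (F.θ s k) (nextAngle (F.θ s) k) φ) :
    -(∫ t in {t | t ∈ Set.Ioo (F.θ s k) (nextAngle (F.θ s) k) ∧ ∀ j, ε < ‖pt t - F.β s j‖},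
        -f (pt t) * φ (pt t) * (pt t * I) / (2 * Real.pi * I)) -
      ∑ j, arcIntegral (F.θ s k) (nextAngle (F.θ s) k) (fun x =>
        φ x * if ‖x - F.β s j‖ < ε then -f x else 0) =
      arcIntegral (F.θ s k) (nextAngle (F.θ s) k) (fun x => f x * φ x) := by
  have hP := F.piecewiseHol_weight 0 hs
  have hle := hP.le_nextAngle k
  obtain ⟨hε, -, -, hdisj⟩ := h
  set S := Set.Ioc (F.θ s k) (nextAngle (F.θ s) k) with hS
  set H : ℝ → ℂ := fun t => f (pt t) * φ (pt t) * (pt t * I) / (2 * Real.pi * I) with hH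
  have hHint : IntegrableOn H S := by
    have := (ContArc.mul (Continuous.contArc hf) hφ).intervalIntegrable hle
    rwa [intervalIntegrable_iff_integrableOn_Ioc_of_le hle] at this
  set B : Set ℝ := {t | ∀ j, ε < ‖pt t - F.β s j‖} with hB
  set Bj : Fin (m + 1) → Set ℝ := fun j => {t | ‖pt t - F.β s j‖ < ε} with hBj
  have hcd : ∀ j, Continuous fun t => ‖pt t - F.β s j‖ := fun j =>
    (continuous_pt.sub continuous_const).norm
  have hBm : MeasurableSet B := by
    have : B = ⋂ j, {t | ε < ‖pt t - F.β s j‖} := by ext t; simp [hB]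
    rw [this]
    exact MeasurableSet.iInter fun j => (isOpen_lt continuous_const (hcd j)).measurableSet
  have hBjm : ∀ j, MeasurableSet (Bj j) := fun j =>
    (isOpen_lt (hcd j) continuous_const).measurableSet
  have h1 : -(∫ t in {t | t ∈ Set.Ioo (F.θ s k) (nextAngle (F.θ s) k) ∧
      ∀ j, ε < ‖pt t - F.β s j‖}, -f (pt t) * φ (pt t) * (pt t * I) / (2 * Real.pi * I)) =
      ∫ t in S, B.indicator H t := by
    rw [hS, integral_Ioc_eq_integral_Ioo, setIntegral_indicator hBm, ← integral_neg]
    refine integral_congr_ae (ae_of_all _ fun t => ?_)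
    simp only [hH]
    ring
  have h2 : ∀ j, arcIntegral (F.θ s k) (nextAngle (F.θ s) k) (fun x =>
      φ x * if ‖x - F.β s j‖ < ε then -f x else 0) = -∫ t in S, (Bj j).indicator H t := by
    intro j
    rw [arcIntegral, intervalIntegral.integral_of_le hle, ← integral_neg]
    refine integral_congr_ae (ae_of_all _ fun t => ?_)
    simp only [Set.indicator, hBj, Set.mem_ofPred_eq, hH]
    split_ifs <;> ring
  rw [h1, Finset.sum_congr rfl fun j _ => h2 j, Finset.sum_neg_distrib, sub_neg_eq_add,
    ← integral_finsetSum _ fun j _ => hHint.indicator (hBjm j),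
    ← integral_add (hHint.indicator hBm)
      (integrable_finsetSum _ fun j _ => hHint.indicator (hBjm j)),
    arcIntegral, intervalIntegral.integral_of_le hle]
  refine integral_congr_ae ?_
  -- Up to the null set of points on the small circles, each point of the arc is either outside all
  -- discs or in exactly one of them, the discs being disjoint.
  have hae : ∀ᵐ t, ∀ j, ‖pt t - F.β s j‖ ≠ ε :=
    ae_all_iff.2 fun j => ae_norm_pt_sub_ne (F.θ s j)
  filter_upwards [ae_restrict_of_ae hae] with t ht
  change B.indicator H t + ∑ j, (Bj j).indicator H t = H t
  by_cases hex : ∃ j, ‖pt t - F.β s j‖ < ε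
  · obtain ⟨j, hj⟩ := hex
    have hnB : t ∉ B := fun hb => lt_asymm hj (hb j)
    have hjm : t ∈ Bj j := hj
    rw [Set.indicator_of_notMem hnB, zero_add, Finset.sum_eq_single j, Set.indicator_of_mem hjm]
    · intro i _ hij
      have hni : t ∉ Bj i := by
        intro hi
        have h3 := hdisj i j hij
        have h4 : ‖F.β s i - F.β s j‖ ≤ ‖pt t - F.β s j‖ + ‖pt t - F.β s i‖ := by
          have := norm_sub_le (pt t - F.β s j) (pt t - F.β s i)
          rwa [sub_sub_sub_cancel_left] at this
        have h5 : ‖pt t - F.β s i‖ < ε := hi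
        linarith
      exact Set.indicator_of_notMem hni _
    · simp
  · push Not at hex
    have hb : t ∈ B := fun j => lt_of_le_of_ne (hex j) (ht j).symm
    rw [Set.indicator_of_mem hb, Finset.sum_eq_zero, add_zero]
    intro j _
    have hn : t ∉ Bj j := fun hj => absurd (hex j) (not_le.2 hj)
    exact Set.indicator_of_notMem hn _

/-- The modified Malgrange form of the Riemann--Hilbert problem. -/
theorem Omega_eq_variation (hs : s ∈ F.U) (h : F.Admissible s ε R)
    (hΓ : IsRHSolution n (F.θ s) (F.weight n s) Γ) {p q : Polynomial ℂ}
    (hp : ∀ z ∈ offCircle, Γ z 0 0 = p.eval z) (hq : ∀ z ∈ offCircle, Γ z 1 0 = q.eval z) {f : ℂ → ℂ}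
    (hf : ∀ z, f z = q.eval z * p.derivative.eval z - p.eval z * q.derivative.eval z) (v : E) :
    F.Omega n ε R Γ s v = F.variation s v (fun x => f x * x ^ (-(n : ℤ))) := by
  have hε := h.1
  have hfd : Differentiable ℂ f := by
    rw [show f = fun z => q.eval z * p.derivative.eval z - p.eval z * q.derivative.eval z from
      funext hf]
    fun_prop
  have hP := F.piecewiseHol_weight n hs
  set φ : Fin (m + 1) → ℂ → ℂ := fun k x =>
    x ^ (-(n : ℤ)) * fderiv ℝ (fun s' => F.a s' k x) s v with hφ
  have hφc : ∀ k, ContArc (F.θ s k) (nextAngle (F.θ s) k) (φ k) := fun k =>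
    ContinuousOn.mul (continuous_pt.zpow₀ _ fun t => Or.inl (pt_ne_zero t)).continuousOn
      (F.contArc_fderiv_a hs k v)
  rw [Omega, modifiedMalgrange, F.varthetaForm_contour, add_zero, malgrange, Fintype.sum_sum_type,
    Fintype.sum_sum_type]
  set G := F.cloak n s ε R Γ with hG
  have harc : ∀ j : Fin (m + 1), (F.contour n s ε R (Sum.inl j)).integral (fun x => Matrix.trace
      ((innerLim (F.contour n s ε R (Sum.inl j)).center
          (F.contour n s ε R (Sum.inl j)).radius G x)⁻¹ *
        innerLim (F.contour n s ε R (Sum.inl j)).center (F.contour n s ε R (Sum.inl j)).radius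
          (derivZ G) x *
        (derivPar (F.contour n s ε R (Sum.inl j)).jump s v x *
          ((F.contour n s ε R (Sum.inl j)).jump s x)⁻¹))) =
      ∫ t in {t | t ∈ Set.Ioo (F.θ s j) (nextAngle (F.θ s) j) ∧ ∀ k, ε < ‖pt t - F.β s k‖},
        -f (pt t) * φ j (pt t) * (pt t * I) / (2 * Real.pi * I) := by
    intro j
    have hm : MeasurableSet {t | t ∈ Set.Ioo (F.θ s j) (nextAngle (F.θ s) j) ∧
        ∀ k, ε < ‖pt t - F.β s k‖} := by
      refine measurableSet_Ioo.inter ?_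
      have : {t | ∀ k, ε < ‖pt t - F.β s k‖} = ⋂ k, {t | ε < ‖pt t - F.β s k‖} := by ext t; simp
      change MeasurableSet {t | ∀ k, ε < ‖pt t - F.β s k‖}
      rw [this]
      exact MeasurableSet.iInter fun k => (isOpen_lt continuous_const
        (continuous_pt.sub continuous_const).norm).measurableSet
    refine setIntegral_congr_fun hm fun t ht => ?_
    have := F.trace_arc hs h hΓ hp hq ht.1 ht.2 v
    rw [← hf] at this
    exact congrArg (fun y => y * (pt t * I) / (2 * Real.pi * I)) this
  have hcirc : ∀ j : Fin (m + 1), (F.contour n s ε R (Sum.inr (Sum.inl j))).integral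
      (fun x => Matrix.trace
      ((innerLim (F.contour n s ε R (Sum.inr (Sum.inl j))).center
          (F.contour n s ε R (Sum.inr (Sum.inl j))).radius G x)⁻¹ *
        innerLim (F.contour n s ε R (Sum.inr (Sum.inl j))).center
          (F.contour n s ε R (Sum.inr (Sum.inl j))).radius (derivZ G) x *
        (derivPar (F.contour n s ε R (Sum.inr (Sum.inl j))).jump s v x *
          ((F.contour n s ε R (Sum.inr (Sum.inl j))).jump s x)⁻¹))) =
      (2 * Real.pi * I)⁻¹ * (∮ z in C(F.β s j, ε), f z *
        F.variation s v (fun x => x ^ (-(n : ℤ)) / (x - z))) := by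
    intro j
    rw [circleIntegral, intervalIntegral.integral_of_le Real.two_pi_pos.le, ← integral_const_mul]
    refine integral_congr_ae ?_
    -- The crossings with the unit circle, where the integrand is not controlled, form a null set.
    filter_upwards [ae_restrict_of_ae (ae_circleMap_mem_offCircle (F.θ s j) hε)] with t ht
    have hx : ‖circleMap (F.β s j) ε t - F.β s j‖ = ε := by
      rw [circleMap_eq, add_sub_cancel_left, norm_mul, norm_pt, Complex.norm_real,
        Real.norm_of_nonneg hε.le, mul_one]
    have := F.trace_circle hs h hΓ hp hq hx ht v
    rw [← hf] at this
    refine (congrArg (fun y => y * (circleMap 0 ε t * I) / (2 * Real.pi * I)) this).trans ?_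
    rw [deriv_circleMap, smul_eq_mul]
    ring
  have hbig : ∀ u : Unit, (F.contour n s ε R (Sum.inr (Sum.inr u))).integral
      (fun x => Matrix.trace
      ((innerLim (F.contour n s ε R (Sum.inr (Sum.inr u))).center
          (F.contour n s ε R (Sum.inr (Sum.inr u))).radius G x)⁻¹ *
        innerLim (F.contour n s ε R (Sum.inr (Sum.inr u))).center
          (F.contour n s ε R (Sum.inr (Sum.inr u))).radius (derivZ G) x *
        (derivPar (F.contour n s ε R (Sum.inr (Sum.inr u))).jump s v x *
          ((F.contour n s ε R (Sum.inr (Sum.inr u))).jump s x)⁻¹))) = 0 := by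
    intro u
    simp [contour, derivPar_const, JumpArc.integral]
  -- Each small circle yields the parts of the arcs inside its disc and the term with `Δ` at its
  -- centre; `arc_pieces` joins these parts to those outside the discs.
  rw [Finset.sum_congr rfl fun j _ => harc j, Finset.sum_congr rfl fun j _ => hcirc j,
    Finset.sum_congr rfl fun u _ => hbig u, Finset.sum_const_zero, add_zero,
    Finset.sum_congr rfl fun j _ => F.circleIntegral_mul_variation hs h hfd j v,
    Finset.sum_sub_distrib, Finset.sum_comm, variation, arcInt_eq_sum]
  have hpieces := Finset.sum_congr rfl fun k (_ : k ∈ Finset.univ) =>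
    F.arc_pieces hs h hfd.continuous k (hφc k)
  rw [Finset.sum_sub_distrib, Finset.sum_neg_distrib] at hpieces
  have hfin1 : ∑ k, arcIntegral (F.θ s k) (nextAngle (F.θ s) k)
      (fun x => f x * x ^ (-(n : ℤ)) * fderiv ℝ (fun s' => F.a s' k x) s v) =
      ∑ k, arcIntegral (F.θ s k) (nextAngle (F.θ s) k) (fun x => f x * φ k x) := by
    simp only [hφ, mul_assoc]
  have hfin2 : ∑ j, f (F.β s j) * F.β s j ^ (-(n : ℤ)) *
        (F.a s (j - 1) (F.β s j) - F.a s j (F.β s j)) / (2 * Real.pi * I) *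
        fderiv ℝ (fun s' => F.β s' j) s v =
      ∑ j, F.Δ n s j / (2 * Real.pi * I) * f (F.β s j) * fderiv ℝ (fun s' => F.β s' j) s v := by
    refine Finset.sum_congr rfl fun j _ => ?_
    simp only [Δ, weight]
    ring
  rw [hfin1, hfin2]
  linear_combination hpieces

end SymbolFamily

end ToeplitzRHP
end

/-! ### The main theorem. -/

open ToeplitzRHP in
theorem mainTheorem6 {E : Type*} [NormedAddCommGroup E] [NormedSpace ℝ E] [FiniteDimensional ℝ E]
    (m n : ℕ) (F : SymbolFamily E m) (s : E) (hs : s ∈ F.U) :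
    ((∃ Γ, IsRHSolution n (F.θ s) (F.weight n s) Γ) ↔ F.T n s ≠ 0) ∧
    ∀ Γ, IsRHSolution n (F.θ s) (F.weight n s) Γ →
      ∃ K : Matrix (Fin n) (Fin n) ℂ,
        (∀ z w : ℂ, ‖z‖ ≠ 1 → ‖w‖ ≠ 1 → z ≠ w → kernel21 Γ z w = polyKernel K z w) ∧
        ∃ dlnT : E →L[ℝ] ℂ, IsLogDifferential (F.T n) s dlnT ∧
          (∀ ε R : ℝ, F.Admissible s ε R → ∀ v : E, dlnT v = F.Omega n ε R Γ s v) ∧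
          (∀ v : E, dlnT v =
            arcInt (F.θ s) (fun j x =>
              polyKernel K x x * x ^ (-(n : ℤ)) * fderiv ℝ (fun s' => F.a s' j x) s v) +
            ∑ j, F.Δ n s j / (2 * Real.pi * I) * polyKernel K (F.β s j) (F.β s j) *
              fderiv ℝ (fun s' => F.β s' j) s v) := by
  have hP := F.piecewiseHol_weight n hs
  have hne : ∀ Γ, IsRHSolution n (F.θ s) (F.weight n s) Γ → F.T n s ≠ 0 := by
    intro Γ hΓ
    obtain ⟨p, q, ho, -, -⟩ := hΓ.exists_isOrthPair hP
    rw [F.T_eq_det n hs]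
    exact ho.det_ne_zero
  refine ⟨⟨fun ⟨Γ, hΓ⟩ => hne Γ hΓ, fun h => exists_isRHSolution hP ?_⟩, fun Γ hΓ => ?_⟩
  · rwa [F.T_eq_det n hs] at h
  obtain ⟨p, q, ho, hp, hq⟩ := hΓ.exists_isOrthPair hP
  obtain ⟨L, hL, hLv⟩ := F.exists_isLogDifferential n hs (hne Γ hΓ)
  -- The coefficients of the kernel come from the inverse moment matrix, hence do not depend on `Γ`.
  -- Both formulas for the differential are the same `variation`, its argument on the Malgrange side
  -- being rewritten by `polyKernel_diag`.
  refine ⟨kernelMatrix hP.functional n,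
    fun z w hz hw hzw => hΓ.kernel21_eq hP ho hp hq hz hw hzw, L, hL, fun ε R h v => ?_,
    fun v => ?_⟩
  · rw [hLv, F.Omega_eq_variation hs h hΓ hp hq ho.polyKernel_diag v]
  · rw [hLv, SymbolFamily.variation]
    congr 1
    refine Finset.sum_congr rfl fun j _ => ?_
    simp only [SymbolFamily.Δ, SymbolFamily.weight]
    ring
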